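/- **Nets.** A polyhedron is a $3\times3$ net without its corner points: points $A_i,B_i,C_i\in\mathbb R^3$ ($i=1,\dots,4$, indices mod 4) such that $A_1A_2A_3A_4$, $A_1A_2B_2B_1$, $A_2A_3C_3C_2$, $A_3A_4B_4B_3$, $A_4A_1C_1C_4$ are nondegenerate convex quadrilaterals and the triangles $B_iA_iC_i$ are nondegenerate. Its flat angles are $\alpha_i=\angle A_{i-(-1)^i}A_iB_i$, $\beta_i=\angle B_iA_iC_i$, $\gamma_i=\angle C_iA_iA_{5-i}$, $\delta_i=\angle A_{i-1}A_iA_{i+1}$; $\theta_i$ is the oriented dihedral angle at the edge $A_iA_{i+1}$ ($|\theta_i|=\pi$ when the two faces are unfolded into one plane; $\theta_i\in(0,\pi)$ when the side face is on the side of the central face to which $\overrightarrow{A_2A_1}\times\overrightarrow{A_2A_3}$ points). A flexion is a continuous family of pairwise non-congruent polyhedra containing the given one, with corresponding faces congruent; a polyhedron is flexible if it has a flexion parametrized by some $(-\epsilon,\epsilon)$, with the given polyhedron at $0$. **Elliptic and equimodular elliptic type.** A vertex $i$ is elliptic if $\alpha_i\pm\beta_i\pm\gamma_i\pm\delta_i\ne0\pmod{2\pi}$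 for all signs; a polyhedron has elliptic type if all four vertices are elliptic. Let $\sigma_i=\frac{\alpha_i+\beta_i+\gamma_i+\delta_i}2$, $a_i=\frac{\sin\alpha_i}{\sin(\sigma_i-\alpha_i)}$, $b_i=\frac{\sin\beta_i}{\sin(\sigma_i-\beta_i)}$, $c_i=\frac{\sin\gamma_i}{\sin(\sigma_i-\gamma_i)}$, $d_i=\frac{\sin\delta_i}{\sin(\sigma_i-\delta_i)}$, $M_i=a_ib_ic_id_i$, $r_i=a_id_i$, $s_i=c_id_i$, $f_i=a_ic_i$. Equimodular elliptic type means: elliptic type; $M_1=M_2=M_3=M_4=:M$; $r_1=r_2$, $s_1=s_4$, $r_3=r_4$, $s_2=s_3$; and $t_1+e_1t_2+e_2t_3+e_3t_4\in\Lambda$ for some $e_1,e_2,e_3\in\{\pm1\}$. Here $k=\sqrt{1-M}$ for $M<1$ and $k=\sqrt{1-M^{-1}}$ for $M>1$, $K=K(k)$ and $K'=K(\sqrt{1-k^2})$ are the complete elliptic integrals, $\Lambda=\mathbb Z\,4K+\mathbb Z\,2\mathbf iK'$ for $M<1$ and $\Lambda=\mathbb Z\,4K+\mathbb Z(2K+2\mathbf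 iK')$ for $M>1$, and the phase shift $t_i$ is the point of the open segment $(m_iK,\,m_iK+\mathbf iK')$ with $\operatorname{dn}(t_i,k)=\sqrt{f_i}$ for $M<1$ and $1/\sqrt{f_i}$ for $M>1$; with $p_i=\sqrt{r_i-1}$, $q_i=\sqrt{s_i-1}$ in $\mathbb R_{>0}\cup\mathbf i\mathbb R_{>0}$, one has $m_i=0,1,2$ if $\sigma_i<\pi$ and $m_i=2,3,0$ if $\sigma_i>\pi$, for $p_iq_i$ in $\mathbb R_{>0}$, $\mathbf i\mathbb R_{>0}$, $\mathbb R_{<0}$ respectively. **Switching and configurations.** Switching the boundary strip along $A_jA_{j+1}$ replaces the two angles $\alpha$ (for $j$ odd) or $\gamma$ (for $j$ even) in this strip, and $\beta_j,\beta_{j+1}$, with their complements to $\pi$. The complexified configuration space is the set of complex solutions $(w_1,\dots,w_4)$, $w_j=\cot\frac{\theta_j}2$, of the four Bricard equations. The one at the vertex $i$ is obtained from $$\cos\beta_i=\cos\gamma_i(\cos\alpha_i\cos\delta_i+\cos\xi\sin\alpha_i\sin\delta_i)+\cos\eta\sin\gamma_i(\cos\alpha_i\sin\delta_i-\cos\xi\sin\alpha_i\cos\delta_i)+\sin\xi\sin\eta\sin\alpha_i\sin\gamma_i$$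 by substituting $\cos\xi=\frac{w^2-1}{w^2+1}$, $\sin\xi=\frac{2w}{w^2+1}$, $\cos\eta=\frac{z^2-1}{z^2+1}$, $\sin\eta=\frac{2z}{z^2+1}$ and multiplying by $(w^2+1)(z^2+1)$, where $(w,z)=(w_1,w_4),(w_1,w_2),(w_3,w_2),(w_3,w_4)$ for $i=1,2,3,4$. The polyhedron is in the linear compound class if a positive-dimensional irreducible component of this space satisfies $w_1=cw_3$ with a constant $c\ne0$ and $w_1,w_3\not\equiv0$ on it. **Proposition (Example 3).** Consider the flat angles in $(0,\pi)$ with all $\delta_i=\frac\pi2$ and $$\cos\alpha_1=\cos\alpha_4=\tfrac1{\sqrt5},\quad \cos\alpha_2=\cos\alpha_3=\tfrac1{4\sqrt{11}},\quad \cos\beta_1=\cos\beta_4=\tfrac7{5\sqrt2},\quad \cos\beta_2=\cos\beta_3=\tfrac{7\sqrt7}{4\sqrt{22}},$$ $$\cos\gamma_1=-\tfrac1{\sqrt{10}},\quad \cos\gamma_2=-\tfrac1{2\sqrt2},\quad \cos\gamma_3=\tfrac1{2\sqrt2},\quad \cos\gamma_4=\tfrac1{\sqrt{10}},$$ and, for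 $t\in\left(\frac1{\sqrt3},\frac{\sqrt2}{\sqrt3}\right)$ and a choice of sign in $\mp$, the same in both formulae, the dihedral angles $\theta_i\in(0,\pi)$ with $$\cot\tfrac{\theta_1}2=t,\quad \cot\tfrac{\theta_2}2=\frac{5\sqrt7\,t\mp\sqrt{10(3t^2-1)(2-3t^2)}}{4+9t^2},\quad \cot\tfrac{\theta_3}2=\frac1t,\quad \cot\tfrac{\theta_4}2=\frac{6t\mp\sqrt{2(3t^2-1)(2-3t^2)}}{1+3t^2}.\tag{16}$$ For every such $t$ and each choice of sign there is a polyhedron with these flat and dihedral angles, and every such polyhedron (with any edge lengths): 1. is flexible in $\mathbb R^3$, and has a flexion, parametrized by $\tau\in\left(\frac1{\sqrt3},\frac{\sqrt2}{\sqrt3}\right)$ and equal to the given polyhedron at $\tau=t$, all of whose members are such polyhedra with parameter $\tau$ and the same sign, that is, the dihedral angles are given by (16) with $\tau$ in place of $t$; 2. has equimodular elliptic type; 3. belongs to the linear compound class after switching the boundary strip along $A_3A_4$; 4. belongs to none of the other six of Izmestiev's classes (orthodiagonal, isogonal, conjugate-modular, linearly conjugate, chimera, trivial), even after switching any set of boundary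 strips. More strongly, for the switched angles: no vertex is orthodiagonal ($\cos\alpha_i\cos\gamma_i\neq\cos\beta_i\cos\delta_i$); every vertex is elliptic, so that none is an isogram or antiisogram ($\alpha_i=\gamma_i,\ \beta_i=\delta_i$ or $\alpha_i+\gamma_i=\beta_i+\delta_i=\pi$) or a deltoid or antideltoid ($\alpha_i=\delta_i,\ \beta_i=\gamma_i$; $\alpha_i=\beta_i,\ \gamma_i=\delta_i$; $\alpha_i+\delta_i=\beta_i+\gamma_i=\pi$; $\alpha_i+\beta_i=\gamma_i+\delta_i=\pi$); $\frac1{M_i}+\frac1{M_j}\ne1$ for all $i,j$; and no $w_j$ is constant on an infinite set of points of the complexified configuration space. -/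

import Mathlib

noncomputable section

/-- Euclidean 3-space. -/
abbrev E3 := EuclideanSpace ℝ (Fin 3)

/-- A `3 × 3` net without its four corner points: the central face `A₁A₂A₃A₄` and the outer
vertices `Bᵢ`, `Cᵢ`. Indices `1, 2, 3, 4` are taken modulo 4, so `4 = 0` in `Fin 4`. The edges
`A₁A₂` and `A₃A₄` carry the quadrilaterals `A₁A₂B₂B₁` and `A₃A₄B₄B₃`; the edges `A₂A₃` and `A₄A₁`
carry `A₂A₃C₃C₂` and `A₄A₁C₁C₄`. -/
structure Net where
  A : Fin 4 → E3
  B : Fin 4 → E3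
  C : Fin 4 → E3

/-- Planar angles at the four vertices `A₁, …, A₄`. -/
@[ext]
structure FlatAngles where
  α : Fin 4 → ℝ
  β : Fin 4 → ℝ
  γ : Fin 4 → ℝ
  δ : Fin 4 → ℝ

/-- `P, Q, R, S` are the consecutive vertices of a (nondegenerate) convex quadrilateral: the open
diagonals meet and the four points are not collinear. -/
def IsConvexQuad (P Q R S : E3) : Prop :=
  (openSegment ℝ P R ∩ openSegment ℝ Q S).Nonempty ∧ ¬ Collinear ℝ ({P, Q, R, S} : Set E3)

/-- Cross product of vectors in Euclidean 3-space. -/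
def cross (v w : E3) : E3 := WithLp.toLp 2 (crossProduct (WithLp.ofLp v) (WithLp.ofLp w))

namespace Net

/-- The outer neighbour of `A j` in the boundary strip along the edge `A i, A (i + 1)`. -/
def outer (N : Net) (i j : Fin 4) : E3 := if i = 1 ∨ i = 3 then N.B j else N.C j

/-- The consecutive vertices of the quadrilateral attached to the edge `A i, A (i + 1)`. -/
def sideFace (N : Net) (i : Fin 4) : Fin 4 → E3 :=
  ![N.A i, N.A (i + 1), N.outer i (i + 1), N.outer i i]

/-- The corner face at `A i`; its fourth vertex is omitted. -/
def cornerFace (N : Net) (i : Fin 4) : Fin 3 → E3 := ![N.B i, N.A i, N.C i]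

/-- All twelve vertices. -/
def points (N : Net) : Fin 3 × Fin 4 → E3 := fun p => ![N.A p.2, N.B p.2, N.C p.2] p.1

/-- The net has convex faces. (A nondegenerate corner triangle can always be completed to a convex
quadrilateral.) -/
def IsPolyhedron (N : Net) : Prop :=
  IsConvexQuad (N.A 1) (N.A 2) (N.A 3) (N.A 4) ∧
  (∀ i, IsConvexQuad (N.sideFace i 0) (N.sideFace i 1) (N.sideFace i 2) (N.sideFace i 3)) ∧
  (∀ i, ¬ Collinear ℝ ({N.B i, N.A i, N.C i} : Set E3))

/-- Corresponding faces of the two nets are congruent. -/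
def FacesCongruent (N N' : Net) : Prop :=
  Congruent N.A N'.A ∧ (∀ i, Congruent (N.sideFace i) (N'.sideFace i)) ∧
  (∀ i, Congruent (N.cornerFace i) (N'.cornerFace i))

/-- `V` is a flexion of `N`, parametrized by the interval `I`, with `N` at the parameter `t₀`:
a continuous family of polyhedra with faces congruent to those of `N`, no two of its members being
congruent to each other. -/
def IsFlexion (N : Net) (I : Set ℝ) (t₀ : ℝ) (V : ℝ → Net) : Prop :=
  V t₀ = N ∧
  (∀ i, ContinuousOn (fun t => (V t).A i) I ∧ ContinuousOn (fun t => (V t).B i) I ∧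
    ContinuousOn (fun t => (V t).C i) I) ∧
  (∀ t ∈ I, (V t).IsPolyhedron ∧ N.FacesCongruent (V t)) ∧
  (∀ s ∈ I, ∀ t ∈ I, s ≠ t → ¬ Congruent (V s).points (V t).points)

/-- Flexibility in `ℝ³`. -/
def IsFlexible (N : Net) : Prop :=
  ∃ ε : ℝ, 0 < ε ∧ ∃ V : ℝ → Net, N.IsFlexion (Set.Ioo (-ε) ε) 0 V

/-- `αᵢ = ∠ A_{i-(-1)^i} Aᵢ Bᵢ`, `βᵢ = ∠ Bᵢ Aᵢ Cᵢ`, `γᵢ = ∠ Cᵢ Aᵢ A_{5-i}`,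
`δᵢ = ∠ A_{i-1} Aᵢ A_{i+1}`. Modulo 4 one has `i - (-1)^i = 3 - i` and `5 - i = 1 - i`. -/
def flatAngles (N : Net) : FlatAngles where
  α i := EuclideanGeometry.angle (N.A (3 - i)) (N.A i) (N.B i)
  β i := EuclideanGeometry.angle (N.B i) (N.A i) (N.C i)
  γ i := EuclideanGeometry.angle (N.C i) (N.A i) (N.A (1 - i))
  δ i := EuclideanGeometry.angle (N.A (i - 1)) (N.A i) (N.A (i + 1))

/-- Normal of the central face. -/
def centralNormal (N : Net) : E3 := cross (N.A 1 - N.A 2) (N.A 3 - N.A 2)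

/-- Normal of the quadrilateral at the edge `A i, A (i + 1)`, oriented so that it agrees with the
central normal when this quadrilateral is folded onto the central face, and is opposite to it when
the two lie in one plane on different sides of the edge. -/
def sideNormal (N : Net) (i : Fin 4) : E3 := cross (N.A i - N.A (i + 1)) (N.outer i i - N.A i)

/-- Oriented dihedral angle at the edge `A i, A (i + 1)` (the angle between the two faces, equal to
`π` in absolute value when they are unfolded into one plane). It lies in `(0, π)` when the
quadrilateral is on the side of the central face to which the central normal points. -/
def dihedral (N : Net) (i : Fin 4) : ℝ :=
  if 0 < inner ℝ (cross N.centralNormal (N.sideNormal i)) (N.A i - N.A (i + 1)) then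
    InnerProductGeometry.angle N.centralNormal (N.sideNormal i)
  else -InnerProductGeometry.angle N.centralNormal (N.sideNormal i)

end Net

/-! ### Jacobi elliptic functions -/

/-- Complete elliptic integral of the first kind, `k` being the modulus. -/
def ellipticK (k : ℝ) : ℝ := ∫ x in (0 : ℝ)..1, 1 / √((1 - x ^ 2) * (1 - k ^ 2 * x ^ 2))

/-- The complementary modulus. -/
def compModulus (k : ℝ) : ℝ := √(1 - k ^ 2)

/-- Incomplete elliptic integral of the first kind. -/
def ellipticF (k φ : ℝ) : ℝ := ∫ θ in (0 : ℝ)..φ, 1 / √(1 - k ^ 2 * Real.sin θ ^ 2)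

/-- Jacobi amplitude of a real argument: the inverse of `ellipticF k`, which is an increasing
bijection of `ℝ` for `0 ≤ k < 1`. -/
def jacobiAm (k u : ℝ) : ℝ := Function.invFun (ellipticF k) u

def realSn (k u : ℝ) : ℝ := Real.sin (jacobiAm k u)

def realCn (k u : ℝ) : ℝ := Real.cos (jacobiAm k u)

def realDn (k u : ℝ) : ℝ := √(1 - k ^ 2 * realSn k u ^ 2)

/-- Delta amplitude `dn (x + 𝐢 y, k)` of a complex argument, for `0 < k < 1`, by Jacobi's imaginary
transformation and the addition theorem:
`(d c₁ d₁ - 𝐢 k² s c s₁) / (c₁² + k² s² s₁²)` where `s, c, d` are taken at `(x, k)` and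
`s₁, c₁, d₁` at `(y, k')`. It is the meromorphic function `dn`, with value `0` at its poles. -/
def jacobiDn (k : ℝ) (u : ℂ) : ℂ :=
  let k' := compModulus k
  let s := realSn k u.re
  let c := realCn k u.re
  let d := realDn k u.re
  let s₁ := realSn k' u.im
  let c₁ := realCn k' u.im
  let d₁ := realDn k' u.im
  ((d * c₁ * d₁ : ℝ) - Complex.I * (k ^ 2 * s * c * s₁ : ℝ)) /
    ((c₁ ^ 2 + k ^ 2 * s ^ 2 * s₁ ^ 2 : ℝ) : ℂ)

/-- Square root of a real number in `ℝ_{≥0} ∪ 𝐢 ℝ_{>0}`. -/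
def sqrtC (x : ℝ) : ℂ := if 0 ≤ x then ((√x : ℝ) : ℂ) else Complex.I * ((√(-x) : ℝ) : ℂ)

/-- Elliptic modulus `k` attached to `M`. -/
def modulusOf (M : ℝ) : ℝ := if M < 1 then √(1 - M) else √(1 - M⁻¹)

/-- The period lattice `Λ`. -/
def periodLattice (M : ℝ) : Set ℂ :=
  let K : ℂ := (ellipticK (modulusOf M) : ℂ)
  let K' : ℂ := (ellipticK (compModulus (modulusOf M)) : ℂ)
  {z | ∃ m n : ℤ,
    z = 4 * K * m + (if M < 1 then 2 * Complex.I * K' else 2 * K + 2 * Complex.I * K') * n}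

namespace FlatAngles

variable (a : FlatAngles)

def σ (i : Fin 4) : ℝ := (a.α i + a.β i + a.γ i + a.δ i) / 2

def a' (i : Fin 4) : ℝ := Real.sin (a.α i) / Real.sin (a.σ i - a.α i)

def b' (i : Fin 4) : ℝ := Real.sin (a.β i) / Real.sin (a.σ i - a.β i)

def c' (i : Fin 4) : ℝ := Real.sin (a.γ i) / Real.sin (a.σ i - a.γ i)

def d' (i : Fin 4) : ℝ := Real.sin (a.δ i) / Real.sin (a.σ i - a.δ i)

def M (i : Fin 4) : ℝ := a.a' i * a.b' i * a.c' i * a.d' i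

def r (i : Fin 4) : ℝ := a.a' i * a.d' i

def s (i : Fin 4) : ℝ := a.c' i * a.d' i

def f (i : Fin 4) : ℝ := a.a' i * a.c' i

/-- Amplitudes. -/
def p (i : Fin 4) : ℂ := sqrtC (a.r i - 1)

def q (i : Fin 4) : ℂ := sqrtC (a.s i - 1)

/-- The vertex `A i` is elliptic: `αᵢ ± βᵢ ± γᵢ ± δᵢ ≠ 0 (mod 2π)` for all choices of signs. -/
def EllipticAt (i : Fin 4) : Prop :=
  ∀ e₁ ∈ ({1, -1} : Set ℝ), ∀ e₂ ∈ ({1, -1} : Set ℝ), ∀ e₃ ∈ ({1, -1} : Set ℝ), ∀ n : ℤ,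
    a.α i + e₁ * a.β i + e₂ * a.γ i + e₃ * a.δ i ≠ 2 * Real.pi * n

/-- Elliptic type. -/
def IsElliptic : Prop := ∀ i, a.EllipticAt i

open Classical in
/-- The number `m` such that the phase shift `tᵢ` is on the segment `(m K, m K + 𝐢 K')`, according
to the value of `pᵢ qᵢ` (in `ℝ_{>0}`, in `𝐢 ℝ_{>0}` or in `ℝ_{<0}`) and to whether `σᵢ < π`. -/
def phaseIndex (i : Fin 4) : ℝ :=
  if ∃ ρ : ℝ, 0 < ρ ∧ a.p i * a.q i = ρ then (if a.σ i < Real.pi then 0 else 2)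
  else if ∃ ρ : ℝ, 0 < ρ ∧ a.p i * a.q i = Complex.I * ρ then (if a.σ i < Real.pi then 1 else 3)
  else (if a.σ i < Real.pi then 2 else 0)

/-- `t` is the phase shift at the vertex `A i`, for the common modulus given by `M`. -/
def IsPhaseShift (M : ℝ) (i : Fin 4) (t : ℂ) : Prop :=
  let K : ℂ := (ellipticK (modulusOf M) : ℂ)
  let K' : ℂ := (ellipticK (compModulus (modulusOf M)) : ℂ)
  jacobiDn (modulusOf M) t = (if M < 1 then ((√(a.f i) : ℝ) : ℂ) else ((1 / √(a.f i) : ℝ) : ℂ)) ∧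
  t ∈ openSegment ℝ ((a.phaseIndex i : ℂ) * K) ((a.phaseIndex i : ℂ) * K + Complex.I * K')

/-- Equimodular elliptic type: elliptic, with equal moduli, matching amplitudes at common vertices,
and a sum of phase shifts which is a period. -/
def IsEquimodularElliptic : Prop :=
  a.IsElliptic ∧
  (a.M 1 = a.M 2 ∧ a.M 2 = a.M 3 ∧ a.M 3 = a.M 4) ∧
  (a.r 1 = a.r 2 ∧ a.s 1 = a.s 4 ∧ a.r 3 = a.r 4 ∧ a.s 2 = a.s 3) ∧
  ∃ t : Fin 4 → ℂ, (∀ i, a.IsPhaseShift (a.M 1) i (t i)) ∧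
    ∃ e₁ ∈ ({1, -1} : Set ℂ), ∃ e₂ ∈ ({1, -1} : Set ℂ), ∃ e₃ ∈ ({1, -1} : Set ℂ),
      t 1 + e₁ * t 2 + e₂ * t 3 + e₃ * t 4 ∈ periodLattice (a.M 1)

end FlatAngles

/-! ### Switching boundary strips -/

/-- The index `j` of the boundary strip (along the edge `A j, A (j + 1)`) containing the angle
`αᵢ`: this is `1` for `i = 1, 2` and `3` for `i = 3, 4`. -/
def αStrip : Fin 4 → Fin 4 := ![3, 1, 1, 3]

/-- The index of the boundary strip containing `γᵢ`: `4` for `i = 1, 4` and `2` for `i = 2, 3`. -/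
def γStrip : Fin 4 → Fin 4 := ![4, 4, 2, 2]

namespace FlatAngles

variable (a : FlatAngles)

/-- Switching all the boundary strips in `S`. Switching the strip along `A j, A (j + 1)` replaces
with their complements to `π` the two angles `α` or `γ` in this strip and the angles `β` at `A j`
and `A (j + 1)`; a `β` that is replaced twice returns to its value. -/
def switch (S : Finset (Fin 4)) : FlatAngles where
  α i := if αStrip i ∈ S then Real.pi - a.α i else a.α i
  β i := if Xor (αStrip i ∈ S) (γStrip i ∈ S) then Real.pi - a.β i else a.β i
  γ i := if γStrip i ∈ S then Real.pi - a.γ i else a.γ i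
  δ i := a.δ i

/-! ### The complexified configuration space and the classes -/

open MvPolynomial in
/-- Bricard's equation at the vertex `A i`, in the cotangents `X j = cot (θⱼ / 2)`. With `w, z` the
two of them at the edges of the central face at `A i`, it is the spherical cosine theorem
`cos β = cos γ (cos α cos δ + cos ξ sin α sin δ) + cos η sin γ (cos α sin δ - cos ξ sin α cos δ)`
`+ sin ξ sin η sin α sin γ` multiplied by `(w² + 1) (z² + 1)`, where `cot (ξ / 2) = w` and
`cot (η / 2) = z`. -/
def bricard (i : Fin 4) : MvPolynomial (Fin 4) ℂ :=
  let w : MvPolynomial (Fin 4) ℂ := X (αStrip i)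
  let z : MvPolynomial (Fin 4) ℂ := X (γStrip i)
  let cα := Real.cos (a.α i)
  let sα := Real.sin (a.α i)
  let cγ := Real.cos (a.γ i)
  let sγ := Real.sin (a.γ i)
  let cδ := Real.cos (a.δ i)
  let sδ := Real.sin (a.δ i)
  C ((cγ * cα * cδ - Real.cos (a.β i) : ℝ) : ℂ) * (w ^ 2 + 1) * (z ^ 2 + 1)
    + C ((cγ * sα * sδ : ℝ) : ℂ) * (w ^ 2 - 1) * (z ^ 2 + 1)
    + C ((sγ * cα * sδ : ℝ) : ℂ) * (w ^ 2 + 1) * (z ^ 2 - 1)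
    - C ((sγ * sα * cδ : ℝ) : ℂ) * (w ^ 2 - 1) * (z ^ 2 - 1)
    + C ((4 * sα * sγ : ℝ) : ℂ) * w * z

/-- The complexified configuration space: the complex solutions of all Bricard's equations. -/
def configSpace : Set (Fin 4 → ℂ) := {w | ∀ i, MvPolynomial.eval w (a.bricard i) = 0}

/-- Linear compound class: some component of the complexified configuration space satisfies
`cot (θ₁ / 2) / cot (θ₃ / 2) = const`. Components are given by their prime ideals, the minimal primes
over the ideal of Bricard's polynomials; the component is required to have positive dimension (its
prime is not maximal), and the constant to be nonzero, the two cotangents not vanishing identically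
on the component. -/
def IsLinearCompound : Prop :=
  ∃ P ∈ (Ideal.span (Set.range a.bricard)).minimalPrimes, ¬ P.IsMaximal ∧
    MvPolynomial.X 1 ∉ P ∧ MvPolynomial.X 3 ∉ P ∧
    ∃ c : ℂ, c ≠ 0 ∧ MvPolynomial.X 1 - MvPolynomial.C c * MvPolynomial.X 3 ∈ P

/-- Orthodiagonal vertex: the corresponding spherical quadrilateral has orthogonal diagonals. -/
def OrthodiagonalAt (i : Fin 4) : Prop :=
  Real.cos (a.α i) * Real.cos (a.γ i) = Real.cos (a.β i) * Real.cos (a.δ i)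

/-- The corresponding spherical quadrilateral is an isogram or an antiisogram. -/
def IsogramAt (i : Fin 4) : Prop :=
  (a.α i = a.γ i ∧ a.β i = a.δ i) ∨
  (a.α i + a.γ i = Real.pi ∧ a.β i + a.δ i = Real.pi)

/-- The corresponding spherical quadrilateral is a deltoid or an antideltoid. -/
def DeltoidAt (i : Fin 4) : Prop :=
  (a.α i = a.δ i ∧ a.β i = a.γ i) ∨ (a.α i = a.β i ∧ a.γ i = a.δ i) ∨
  (a.α i + a.δ i = Real.pi ∧ a.β i + a.γ i = Real.pi) ∨
  (a.α i + a.β i = Real.pi ∧ a.γ i + a.δ i = Real.pi)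

/-! The remaining six classes of Izmestiev. Each of them consists of several types, with further
equations on the angles. They occur below only in the claim that a polyhedron is in none of them,
and each predicate is deliberately the widest one: it asks for the condition shared by all types of
the class at a single vertex (or pair of vertices) only, and for nothing else. So every member of
the class satisfies it, and its negation is stronger than exclusion from the class. -/

/-- Orthodiagonal class (involutive and antiinvolutive types): orthodiagonal vertices. -/
def InOrthodiagonalClass : Prop := ∃ i, a.OrthodiagonalAt i

/-- Isogonal class: vertices that are isograms or antiisograms. -/
def InIsogonalClass : Prop := ∃ i, a.IsogramAt i

/-- Conjugate-modular class: conjugate moduli at different vertices. -/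
def InConjugateModularClass : Prop := ∃ i j, 1 / a.M i + 1 / a.M j = 1

/-- Linearly conjugate class: vertices that are antideltoids (deltoids after a switch). -/
def InLinearlyConjugateClass : Prop := ∃ i, a.DeltoidAt i

/-- Chimeras: combinations of vertices of different kinds, not all of which are elliptic (each type
contains conic vertices, (anti)deltoids or (anti)isograms). -/
def InChimeraClass : Prop := ∃ i, ¬ a.EllipticAt i

/-- Trivial class: there is an infinite family of configurations, real or complex, with one of the
dihedral angles constant. -/
def InTrivialClass : Prop :=
  ∃ (i : Fin 4) (c : ℂ), {w ∈ a.configSpace | w i = c}.Infinite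

end FlatAngles

/-! ### The example -/

/-- The flat angles of the example; the entries are listed in the order `4, 1, 2, 3`. -/
def exampleAngles : FlatAngles where
  α := ![Real.arccos (1 / √5), Real.arccos (1 / √5),
    Real.arccos (1 / (4 * √11)), Real.arccos (1 / (4 * √11))]
  β := ![Real.arccos (7 / (5 * √2)), Real.arccos (7 / (5 * √2)),
    Real.arccos (7 * √7 / (4 * √22)), Real.arccos (7 * √7 / (4 * √22))]
  γ := ![Real.arccos (1 / √10), Real.arccos (-(1 / √10)),
    Real.arccos (-(1 / (2 * √2))), Real.arccos (1 / (2 * √2))]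
  δ := fun _ => Real.pi / 2

/-- The cotangents of the dihedral half-angles, in the order `4, 1, 2, 3`; the sign `e = ±1` stands
for the two choices of the sign of the square roots. -/
def exampleCot (e t : ℝ) : Fin 4 → ℝ :=
  ![(6 * t - e * √(2 * (3 * t ^ 2 - 1) * (2 - 3 * t ^ 2))) / (1 + 3 * t ^ 2),
    t,
    (5 * √7 * t - e * √(10 * (3 * t ^ 2 - 1) * (2 - 3 * t ^ 2))) / (4 + 9 * t ^ 2),
    1 / t]

/-- The range of the parameter. -/
def exampleRange : Set ℝ := Set.Ioo (1 / √3) (√2 / √3)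

/-- `N` is a polyhedron of the example, with sign `e` and parameter `t`. The edge lengths are
arbitrary. -/
def IsExample (e t : ℝ) (N : Net) : Prop :=
  N.IsPolyhedron ∧ N.flatAngles = exampleAngles ∧
  ∀ i, N.dihedral i ∈ Set.Ioo 0 Real.pi ∧ Real.cot (N.dihedral i / 2) = exampleCot e t i

end

/-! ### Trigonometric values of the example -/

section Values

/-! Since every δ is right, Bricard's equation at a vertex contains only the monomials w²z², w², z²,
1 and wz. For the given angles the substitution w₃ = 1/w₁ turns the equations at A₄ and A₃ into
those at A₁ and A₂, up to nonzero factors. With t = w₁ the system becomes 3t²w₄² + 6t² + w₄² + 4 =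
12tw₄ and 9t²w₂² + 10t² + 4w₂² + 5 = 10√7·tw₂. The quarter discriminants are 2D and 10D with D =
(3t² - 1)(2 - 3t²). They are positive on the parameter range, so the roots are real, and products of
roots being positive makes all of them positive (`exampleCot_zero_eq`, `exampleCot_two_eq`,
`cosineTheorem_exampleCot`).

In space, four right angles force the central face to be a rectangle, and each side face is a flat
quadrilateral turned about its edge by the dihedral angle; `exists_rectNet` recovers these flat data
from an arbitrary polyhedron of the example. Keeping the flat data and varying the cotangents
preserves the side faces, and the corner angles are preserved because Bricard's equation is the
spherical cosine theorem (`angle_corner`). The distance from B₁ to A₄ separates the members, so this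
is a flexion.

Equimodularity: all `M` equal 1/2, so k = k' = 1/√2 and K = K'. Each phase shift is 𝐢F(arctan xᵢ)
with fᵢ = 1 + xᵢ²/2. The substitution x ↦ 1/(k'x) shows that F(arctan x) + F(arctan y) is constant
when k'xy = 1 (`ellipticF_arctan_add_eq`). The pairs x₁, x₄ and x₂, x₃ both satisfy this, whence t₁
- t₂ - t₃ + t₄ = 0.

Linear compound: after the switch, the equations at A₄ and A₃ are those at A₁ and A₂ with w₁
replaced by -w₃. The curve w₁ = -w₃ = t is described by a generic point with t transcendental over
ℂ. The kernel of evaluation there is a prime, and it is minimal because modulo any smaller prime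
containing the equations all coordinates remain algebraic over w₁ (`ker_mem_minimalPrimes`).

Exclusion: switching keeps the sines and changes only signs of cosines, so each exclusion is proved
once for all such sign patterns (`IsExampleUpToSigns`). No cosine of α, β, γ vanishes, `M` depends
only on sines, ellipticity is tested on squares, and |cos β| dominates the other terms in every
coefficient of Bricard's polynomial. So fixing one cotangent leaves only finitely many
configurations. -/

lemma sqrt_ten_eq : √(10 : ℝ) = √2 * √5 := by
  rw [← Real.sqrt_mul (by norm_num)]; norm_num

lemma sqrt_twentytwo_eq : √(22 : ℝ) = √2 * √11 := by
  rw [← Real.sqrt_mul (by norm_num)]; norm_num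

/-- The cosine and sine of an angle of the form `arccos x`. -/
lemma cos_sin_arccos {x y : ℝ} (hy : 0 ≤ y) (h : x ^ 2 + y ^ 2 = 1) :
    Real.cos (Real.arccos x) = x ∧ Real.sin (Real.arccos x) = y := by
  constructor
  · exact Real.cos_arccos (by nlinarith) (by nlinarith)
  · rw [Real.sin_arccos, show 1 - x ^ 2 = y ^ 2 by linarith, Real.sqrt_sq hy]

/-- Closed forms of `cos α`, in the order `4, 1, 2, 3`. -/
noncomputable def exampleCosα : Fin 4 → ℝ := ![√5 / 5, √5 / 5, √11 / 44, √11 / 44]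
noncomputable def exampleSinα : Fin 4 → ℝ := ![2 * √5 / 5, 2 * √5 / 5, 5 * √7 * √11 / 44, 5 * √7 * √11 / 44]
noncomputable def exampleCosβ : Fin 4 → ℝ :=
  ![7 * √2 / 10, 7 * √2 / 10, 7 * √7 * √2 * √11 / 88, 7 * √7 * √2 * √11 / 88]
noncomputable def exampleSinβ : Fin 4 → ℝ := ![√2 / 10, √2 / 10, 3 * √2 * √11 / 88, 3 * √2 * √11 / 88]
noncomputable def exampleCosγ : Fin 4 → ℝ := ![√2 * √5 / 10, -(√2 * √5 / 10), -(√2 / 4), √2 / 4]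
noncomputable def exampleSinγ : Fin 4 → ℝ := ![3 * √2 * √5 / 10, 3 * √2 * √5 / 10, √2 * √7 / 4, √2 * √7 / 4]

lemma exampleAngles_α (i : Fin 4) : Real.cos (exampleAngles.α i) = exampleCosα i ∧
    Real.sin (exampleAngles.α i) = exampleSinα i := by
  have h5 : √(5 : ℝ) ^ 2 = 5 := Real.sq_sqrt (by norm_num)
  have h7 : √(7 : ℝ) ^ 2 = 7 := Real.sq_sqrt (by norm_num)
  have h11 : √(11 : ℝ) ^ 2 = 11 := Real.sq_sqrt (by norm_num)
  have p5 : 0 < √(5 : ℝ) := by positivity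
  have p11 : 0 < √(11 : ℝ) := by positivity
  have e1 : 1 / √(5 : ℝ) = √5 / 5 := by field_simp; linarith
  have e2 : 1 / (4 * √(11 : ℝ)) = √11 / 44 := by field_simp; linarith
  fin_cases i <;>
    simp only [exampleAngles, exampleCosα, exampleSinα, Fin.mk_zero, Fin.mk_one, Fin.reduceFinMk,
      Matrix.cons_val, e1, e2] <;>
    refine cos_sin_arccos (by positivity) ?_ <;>
    simp only [div_pow, mul_pow, h5, h7, h11] <;> norm_num

lemma exampleAngles_β (i : Fin 4) : Real.cos (exampleAngles.β i) = exampleCosβ i ∧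
    Real.sin (exampleAngles.β i) = exampleSinβ i := by
  have h2 : √(2 : ℝ) ^ 2 = 2 := Real.sq_sqrt (by norm_num)
  have h7 : √(7 : ℝ) ^ 2 = 7 := Real.sq_sqrt (by norm_num)
  have h11 : √(11 : ℝ) ^ 2 = 11 := Real.sq_sqrt (by norm_num)
  have p2 : 0 < √(2 : ℝ) := by positivity
  have p11 : 0 < √(11 : ℝ) := by positivity
  have e1 : 7 / (5 * √(2 : ℝ)) = 7 * √2 / 10 := by field_simp; linarith
  have e2 : 7 * √(7 : ℝ) / (4 * (√2 * √11)) = 7 * √7 * √2 * √11 / 88 := by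
    field_simp; rw [h2, h11]; norm_num
  fin_cases i <;>
    simp only [exampleAngles, exampleCosβ, exampleSinβ, Fin.mk_zero, Fin.mk_one, Fin.reduceFinMk,
      Matrix.cons_val, sqrt_twentytwo_eq, e1, e2] <;>
    refine cos_sin_arccos (by positivity) ?_ <;>
    simp only [div_pow, mul_pow, h2, h7, h11] <;> norm_num

lemma exampleAngles_γ (i : Fin 4) : Real.cos (exampleAngles.γ i) = exampleCosγ i ∧
    Real.sin (exampleAngles.γ i) = exampleSinγ i := by
  have h2 : √(2 : ℝ) ^ 2 = 2 := Real.sq_sqrt (by norm_num)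
  have h5 : √(5 : ℝ) ^ 2 = 5 := Real.sq_sqrt (by norm_num)
  have h7 : √(7 : ℝ) ^ 2 = 7 := Real.sq_sqrt (by norm_num)
  have p2 : 0 < √(2 : ℝ) := by positivity
  have p5 : 0 < √(5 : ℝ) := by positivity
  have e1 : 1 / (√(2 : ℝ) * √5) = √2 * √5 / 10 := by field_simp; rw [h2, h5]; norm_num
  have e2 : 1 / (2 * √(2 : ℝ)) = √2 / 4 := by field_simp; linarith
  fin_cases i <;>
    simp only [exampleAngles, exampleCosγ, exampleSinγ, Fin.mk_zero, Fin.mk_one, Fin.reduceFinMk,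
      Matrix.cons_val, sqrt_ten_eq, e1, e2] <;>
    refine cos_sin_arccos (by positivity) ?_ <;>
    simp only [div_pow, mul_pow, neg_sq, h2, h5, h7] <;> norm_num

lemma exampleAngles_δ (i : Fin 4) : exampleAngles.δ i = Real.pi / 2 := rfl

end Values

/-! ### Products of the sines of half-sums, for `δ = π / 2` -/

namespace FlatAngles

variable (a : FlatAngles)

/-- Product-to-sum: the two arguments have difference γ - α and sum β + δ, so the right angle δ
removes the half-sum σ. The three companions below work in the same way. -/
lemma two_mul_sin_σ_α_mul_sin_σ_γ (i : Fin 4) (hδ : a.δ i = Real.pi / 2) :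
    2 * (Real.sin (a.σ i - a.α i) * Real.sin (a.σ i - a.γ i)) =
      Real.cos (a.α i) * Real.cos (a.γ i) + Real.sin (a.α i) * Real.sin (a.γ i)
        + Real.sin (a.β i) := by
  have h := Real.cos_sub (a.σ i - a.α i) (a.σ i - a.γ i)
  have h' := Real.cos_add (a.σ i - a.α i) (a.σ i - a.γ i)
  rw [show a.σ i - a.α i - (a.σ i - a.γ i) = a.γ i - a.α i by ring, Real.cos_sub] at h
  rw [show a.σ i - a.α i + (a.σ i - a.γ i) = a.β i + Real.pi / 2 by rw [σ, hδ]; ring,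
    Real.cos_add_pi_div_two] at h'
  linarith

lemma two_mul_sin_σ_β_mul_sin_σ_δ (i : Fin 4) (hδ : a.δ i = Real.pi / 2) :
    2 * (Real.sin (a.σ i - a.β i) * Real.sin (a.σ i - a.δ i)) =
      Real.sin (a.β i) + Real.sin (a.α i) * Real.sin (a.γ i)
        - Real.cos (a.α i) * Real.cos (a.γ i) := by
  have h := Real.cos_sub (a.σ i - a.β i) (a.σ i - a.δ i)
  have h' := Real.cos_add (a.σ i - a.β i) (a.σ i - a.δ i)
  rw [show a.σ i - a.β i - (a.σ i - a.δ i) = Real.pi / 2 - a.β i by rw [hδ]; ring,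
    Real.cos_pi_div_two_sub] at h
  rw [show a.σ i - a.β i + (a.σ i - a.δ i) = a.α i + a.γ i by rw [σ, hδ]; ring,
    Real.cos_add] at h'
  linarith

lemma two_mul_sin_σ_α_mul_sin_σ_δ (i : Fin 4) (hδ : a.δ i = Real.pi / 2) :
    2 * (Real.sin (a.σ i - a.α i) * Real.sin (a.σ i - a.δ i)) =
      Real.sin (a.α i) + Real.sin (a.β i) * Real.sin (a.γ i)
        - Real.cos (a.β i) * Real.cos (a.γ i) := by
  have h := Real.cos_sub (a.σ i - a.α i) (a.σ i - a.δ i)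
  have h' := Real.cos_add (a.σ i - a.α i) (a.σ i - a.δ i)
  rw [show a.σ i - a.α i - (a.σ i - a.δ i) = Real.pi / 2 - a.α i by rw [hδ]; ring,
    Real.cos_pi_div_two_sub] at h
  rw [show a.σ i - a.α i + (a.σ i - a.δ i) = a.β i + a.γ i by rw [σ, hδ]; ring,
    Real.cos_add] at h'
  linarith

lemma two_mul_sin_σ_γ_mul_sin_σ_δ (i : Fin 4) (hδ : a.δ i = Real.pi / 2) :
    2 * (Real.sin (a.σ i - a.γ i) * Real.sin (a.σ i - a.δ i)) =
      Real.sin (a.γ i) + Real.sin (a.α i) * Real.sin (a.β i)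
        - Real.cos (a.α i) * Real.cos (a.β i) := by
  have h := Real.cos_sub (a.σ i - a.γ i) (a.σ i - a.δ i)
  have h' := Real.cos_add (a.σ i - a.γ i) (a.σ i - a.δ i)
  rw [show a.σ i - a.γ i - (a.σ i - a.δ i) = Real.pi / 2 - a.γ i by rw [hδ]; ring,
    Real.cos_pi_div_two_sub] at h
  rw [show a.σ i - a.γ i + (a.σ i - a.δ i) = a.α i + a.β i by rw [σ, hδ]; ring,
    Real.cos_add] at h'
  linarith

lemma f_eq (i : Fin 4) (hδ : a.δ i = Real.pi / 2) :
    a.f i = 2 * Real.sin (a.α i) * Real.sin (a.γ i) /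
      (Real.cos (a.α i) * Real.cos (a.γ i) + Real.sin (a.α i) * Real.sin (a.γ i)
        + Real.sin (a.β i)) := by
  rw [← a.two_mul_sin_σ_α_mul_sin_σ_γ i hδ, f, a', c', div_mul_div_comm, mul_assoc,
    mul_div_mul_left _ _ two_ne_zero]

lemma r_eq (i : Fin 4) (hδ : a.δ i = Real.pi / 2) :
    a.r i = 2 * Real.sin (a.α i) / (Real.sin (a.α i) + Real.sin (a.β i) * Real.sin (a.γ i)
        - Real.cos (a.β i) * Real.cos (a.γ i)) := by
  rw [← a.two_mul_sin_σ_α_mul_sin_σ_δ i hδ, r, a', d', div_mul_div_comm,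
    mul_div_mul_left _ _ two_ne_zero]
  rw [hδ, Real.sin_pi_div_two, mul_one]

lemma s_eq (i : Fin 4) (hδ : a.δ i = Real.pi / 2) :
    a.s i = 2 * Real.sin (a.γ i) / (Real.sin (a.γ i) + Real.sin (a.α i) * Real.sin (a.β i)
        - Real.cos (a.α i) * Real.cos (a.β i)) := by
  rw [← a.two_mul_sin_σ_γ_mul_sin_σ_δ i hδ, s, c', d', div_mul_div_comm,
    mul_div_mul_left _ _ two_ne_zero]
  rw [hδ, Real.sin_pi_div_two, mul_one]

/-- The four sines in the denominators pair into (X + Y)(X - Y) with Y = cos α cos γ. Only the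
square of Y survives, so `M` is a function of the sines and is unaffected by switching. -/
lemma M_eq (i : Fin 4) (hδ : a.δ i = Real.pi / 2) :
    a.M i = 4 * Real.sin (a.α i) * Real.sin (a.β i) * Real.sin (a.γ i) /
      ((Real.sin (a.β i) + Real.sin (a.α i) * Real.sin (a.γ i)) ^ 2
        - (1 - Real.sin (a.α i) ^ 2) * (1 - Real.sin (a.γ i) ^ 2)) := by
  have h : (Real.sin (a.β i) + Real.sin (a.α i) * Real.sin (a.γ i)) ^ 2
        - (1 - Real.sin (a.α i) ^ 2) * (1 - Real.sin (a.γ i) ^ 2) =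
      2 * 2 * (Real.sin (a.σ i - a.α i) * Real.sin (a.σ i - a.γ i) *
       (Real.sin (a.σ i - a.β i) * Real.sin (a.σ i - a.δ i))) := by
    rw [mul_mul_mul_comm, a.two_mul_sin_σ_α_mul_sin_σ_γ i hδ,
      a.two_mul_sin_σ_β_mul_sin_σ_δ i hδ, ← Real.cos_sq', ← Real.cos_sq']
    ring
  have hδ' : Real.sin (a.δ i) = 1 := by rw [hδ, Real.sin_pi_div_two]
  rw [h, M, a', b', c', d', hδ', div_mul_div_comm, div_mul_div_comm, div_mul_div_comm,
    mul_assoc 4, mul_assoc 4, show (4 : ℝ) = 2 * 2 by norm_num, mul_div_mul_left _ _ (by norm_num)]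
  congr 1 <;> ring

end FlatAngles

section Signs

lemma exampleSinα_pos (i : Fin 4) : 0 < exampleSinα i := by
  fin_cases i <;> simp [exampleSinα]

lemma exampleSinβ_pos (i : Fin 4) : 0 < exampleSinβ i := by
  fin_cases i <;> simp [exampleSinβ]

lemma exampleSinγ_pos (i : Fin 4) : 0 < exampleSinγ i := by
  fin_cases i <;> simp [exampleSinγ]

lemma exampleCosα_pos (i : Fin 4) : 0 < exampleCosα i := by
  fin_cases i <;> simp [exampleCosα]

lemma exampleCosβ_pos (i : Fin 4) : 0 < exampleCosβ i := by
  fin_cases i <;> simp [exampleCosβ]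

lemma exampleCosγ_ne_zero (i : Fin 4) : exampleCosγ i ≠ 0 := by
  fin_cases i <;> simp [exampleCosγ]

end Signs

/-- Angles which agree with those of the example up to some complements to `π`. -/
structure IsExampleUpToSigns (a : FlatAngles) : Prop where
  δ : ∀ i, a.δ i = Real.pi / 2
  sinα : ∀ i, Real.sin (a.α i) = exampleSinα i
  sinβ : ∀ i, Real.sin (a.β i) = exampleSinβ i
  sinγ : ∀ i, Real.sin (a.γ i) = exampleSinγ i
  cosα : ∀ i, Real.cos (a.α i) = exampleCosα i ∨ Real.cos (a.α i) = -exampleCosα i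
  cosβ : ∀ i, Real.cos (a.β i) = exampleCosβ i ∨ Real.cos (a.β i) = -exampleCosβ i
  cosγ : ∀ i, Real.cos (a.γ i) = exampleCosγ i ∨ Real.cos (a.γ i) = -exampleCosγ i

/-- A complement to π keeps the sine and negates the cosine. -/
lemma isExampleUpToSigns_switch (S : Finset (Fin 4)) :
    IsExampleUpToSigns (exampleAngles.switch S) where
  δ _ := rfl
  sinα i := by
    simp only [FlatAngles.switch]; split_ifs <;> simp [exampleAngles_α]
  sinβ i := by
    simp only [FlatAngles.switch]; split_ifs <;> simp [exampleAngles_β]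
  sinγ i := by
    simp only [FlatAngles.switch]; split_ifs <;> simp [exampleAngles_γ]
  cosα i := by
    simp only [FlatAngles.switch]; split_ifs <;> simp [exampleAngles_α]
  cosβ i := by
    simp only [FlatAngles.switch]; split_ifs <;> simp [exampleAngles_β]
  cosγ i := by
    simp only [FlatAngles.switch]; split_ifs <;> simp [exampleAngles_γ]

lemma isExampleUpToSigns_exampleAngles : IsExampleUpToSigns exampleAngles where
  δ _ := rfl
  sinα i := (exampleAngles_α i).2
  sinβ i := (exampleAngles_β i).2
  sinγ i := (exampleAngles_γ i).2
  cosα i := .inl (exampleAngles_α i).1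
  cosβ i := .inl (exampleAngles_β i).1
  cosγ i := .inl (exampleAngles_γ i).1

/-! ### The coefficients of Bricard's equations for `δ = π / 2` -/

namespace FlatAngles

variable (a : FlatAngles)

/-- Coefficients of `w² z²`, `w²`, `z²` and `1` in Bricard's polynomial with `δ = π / 2`. -/
noncomputable def bricardCoeff (i : Fin 4) : Fin 4 → ℝ :=
  ![-Real.cos (a.β i) + Real.cos (a.γ i) * Real.sin (a.α i) + Real.sin (a.γ i) * Real.cos (a.α i),
    -Real.cos (a.β i) + Real.cos (a.γ i) * Real.sin (a.α i) - Real.sin (a.γ i) * Real.cos (a.α i),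
    -Real.cos (a.β i) - Real.cos (a.γ i) * Real.sin (a.α i) + Real.sin (a.γ i) * Real.cos (a.α i),
    -Real.cos (a.β i) - Real.cos (a.γ i) * Real.sin (a.α i) - Real.sin (a.γ i) * Real.cos (a.α i)]

/-- Stated over an arbitrary ℂ-algebra so that it serves at complex points, at a generic point of
the curve, and in quotients of the polynomial ring. -/
lemma aeval_bricard {R : Type*} [CommRing R] [Algebra ℂ R] (i : Fin 4)
    (hδ : a.δ i = Real.pi / 2) (w : Fin 4 → R) :
    MvPolynomial.aeval w (a.bricard i) =
      algebraMap ℂ R (a.bricardCoeff i 0) * w (αStrip i) ^ 2 * w (γStrip i) ^ 2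
      + algebraMap ℂ R (a.bricardCoeff i 1) * w (αStrip i) ^ 2
      + algebraMap ℂ R (a.bricardCoeff i 2) * w (γStrip i) ^ 2
      + algebraMap ℂ R (a.bricardCoeff i 3)
      + algebraMap ℂ R ((4 * Real.sin (a.α i) * Real.sin (a.γ i) : ℝ) : ℂ)
        * w (αStrip i) * w (γStrip i) := by
  simp only [bricard, hδ, Real.cos_pi_div_two, Real.sin_pi_div_two, mul_zero, mul_one, zero_sub,
    map_add, map_sub, map_mul, map_pow, map_one, MvPolynomial.aeval_X, MvPolynomial.aeval_C,
    bricardCoeff, Matrix.cons_val, Complex.ofReal_add, Complex.ofReal_sub, Complex.ofReal_neg,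
    map_neg, Complex.ofReal_zero, map_zero]
  ring

end FlatAngles

/-! ### Ellipticity, the value of `M`, and exclusion from the other classes. -/

namespace IsExampleUpToSigns

variable {a : FlatAngles} (h : IsExampleUpToSigns a)

include h

lemma sinα_pos (i : Fin 4) : 0 < Real.sin (a.α i) := by rw [h.sinα]; exact exampleSinα_pos i

lemma sinγ_pos (i : Fin 4) : 0 < Real.sin (a.γ i) := by rw [h.sinγ]; exact exampleSinγ_pos i

lemma cosα_ne_zero (i : Fin 4) : Real.cos (a.α i) ≠ 0 := by
  have := (exampleCosα_pos i).ne'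
  rcases h.cosα i with h | h <;> rw [h] <;> simpa

lemma cosβ_ne_zero (i : Fin 4) : Real.cos (a.β i) ≠ 0 := by
  have := (exampleCosβ_pos i).ne'
  rcases h.cosβ i with h | h <;> rw [h] <;> simpa

lemma cosγ_ne_zero (i : Fin 4) : Real.cos (a.γ i) ≠ 0 := by
  have := exampleCosγ_ne_zero i
  rcases h.cosγ i with h | h <;> rw [h] <;> simpa

/-- Each of the four coefficients in `bricardCoeff` is -cos β plus these two products with some
signs. The strict domination therefore makes all of them nonzero, whatever the signs of the cosines.
-/
lemma abs_cosβ_gt (i : Fin 4) : |Real.cos (a.γ i) * Real.sin (a.α i)|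
    + |Real.sin (a.γ i) * Real.cos (a.α i)| < |Real.cos (a.β i)| := by
  have p2 : 0 < √(2 : ℝ) := by positivity
  have h5 : √(5 : ℝ) * √5 = 5 := Real.mul_self_sqrt (by norm_num)
  have q : 0 < √(7 : ℝ) * √2 * √11 := by positivity
  have abs_eq {x y : ℝ} (h : x = y ∨ x = -y) : |x| = |y| := by
    rcases h with rfl | rfl <;> simp
  rw [abs_mul, abs_mul, abs_eq (h.cosα i), abs_eq (h.cosβ i), abs_eq (h.cosγ i), h.sinα, h.sinγ,
    abs_of_pos (exampleCosα_pos i), abs_of_pos (exampleCosβ_pos i),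
    abs_of_pos (exampleSinα_pos i), abs_of_pos (exampleSinγ_pos i)]
  fin_cases i <;>
  simp only [Fin.mk_zero, Fin.mk_one, Fin.reduceFinMk, Matrix.cons_val, exampleCosα, exampleSinα,
    exampleCosβ, exampleCosγ, exampleSinγ, abs_neg]
  · rw [abs_of_pos (by positivity)]
    linear_combination (1 / 5) * p2 + √2 / 10 * h5
  · rw [abs_of_pos (by positivity)]
    linear_combination (1 / 5) * p2 + √2 / 10 * h5
  · rw [abs_of_pos (by positivity)]
    linear_combination (1 / 22) * q
  · rw [abs_of_pos (by positivity)]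
    linear_combination (1 / 22) * q

lemma bricardCoeff_ne_zero (i j : Fin 4) : a.bricardCoeff i j ≠ 0 := by
  have H := h.abs_cosβ_gt i
  intro H'
  have h1 := abs_le.1 (le_refl |Real.cos (a.γ i) * Real.sin (a.α i)|)
  have h2 := abs_le.1 (le_refl |Real.sin (a.γ i) * Real.cos (a.α i)|)
  refine H.not_ge (abs_le.2 ?_)
  fin_cases j <;> simp only [Fin.mk_zero, Fin.mk_one, Fin.reduceFinMk, Matrix.cons_val,
    FlatAngles.bricardCoeff] at H' <;> constructor <;> linarith [h1.1, h1.2, h2.1, h2.2]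

lemma M_eq (i : Fin 4) : a.M i = 1 / 2 := by
  have h2 : √(2 : ℝ) ^ 2 = 2 := Real.sq_sqrt (by norm_num)
  have h5 : √(5 : ℝ) ^ 2 = 5 := Real.sq_sqrt (by norm_num)
  have h7 : √(7 : ℝ) ^ 2 = 7 := Real.sq_sqrt (by norm_num)
  have h11 : √(11 : ℝ) ^ 2 = 11 := Real.sq_sqrt (by norm_num)
  rw [a.M_eq i (h.δ i), h.sinα, h.sinβ, h.sinγ]
  have e (x y z : ℝ) : (y + x * z) ^ 2 - (1 - x ^ 2) * (1 - z ^ 2)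
    = y ^ 2 + x ^ 2 + z ^ 2 + 2 * (x * y * z) - 1 := by ring
  rw [e]
  fin_cases i <;>
  simp only [Fin.mk_zero, Fin.mk_one, Fin.reduceFinMk, Matrix.cons_val, exampleSinα,
    exampleSinβ, exampleSinγ]
  · rw [show 2 * √(5 : ℝ) / 5 * (√2 / 10) * (3 * √2 * √5 / 10) = 3 / 250 * (√2 ^ 2 * √5 ^ 2) by ring]
    simp only [div_pow, mul_pow, h2, h5]
    rw [show 4 * (2 * √(5 : ℝ) / 5) * (√2 / 10) * (3 * √2 * √5 / 10) =
      12 / 250 * (√2 ^ 2 * √5 ^ 2) by ring, h2, h5]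
    norm_num
  · rw [show 2 * √(5 : ℝ) / 5 * (√2 / 10) * (3 * √2 * √5 / 10) = 3 / 250 * (√2 ^ 2 * √5 ^ 2) by ring]
    simp only [div_pow, mul_pow, h2, h5]
    rw [show 4 * (2 * √(5 : ℝ) / 5) * (√2 / 10) * (3 * √2 * √5 / 10) =
      12 / 250 * (√2 ^ 2 * √5 ^ 2) by ring, h2, h5]
    norm_num
  · rw [show 5 * √(7 : ℝ) * √11 / 44 * (3 * √2 * √11 / 88) * (√2 * √7 / 4) =
      15 / 15488 * (√7 ^ 2 * √11 ^ 2 * √2 ^ 2) by ring]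
    simp only [div_pow, mul_pow, h2, h7, h11]
    rw [show 4 * (5 * √(7 : ℝ) * √11 / 44) * (3 * √2 * √11 / 88) * (√2 * √7 / 4) =
      15 / 3872 * (√7 ^ 2 * √11 ^ 2 * √2 ^ 2) by ring, h2, h7, h11]
    norm_num
  · rw [show 5 * √(7 : ℝ) * √11 / 44 * (3 * √2 * √11 / 88) * (√2 * √7 / 4) =
      15 / 15488 * (√7 ^ 2 * √11 ^ 2 * √2 ^ 2) by ring]
    simp only [div_pow, mul_pow, h2, h7, h11]
    rw [show 4 * (5 * √(7 : ℝ) * √11 / 44) * (3 * √2 * √11 / 88) * (√2 * √7 / 4) =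
      15 / 3872 * (√7 ^ 2 * √11 ^ 2 * √2 ^ 2) by ring, h2, h7, h11]
    norm_num

/-- This is ellipticity in squared form: if α ± β ± γ ± π/2 were a multiple of 2π, then cos(α ± β)
would equal sin γ up to sign. -/
lemma cos_add_β_sq_ne (i : Fin 4) (e : ℝ) (he : e = 1 ∨ e = -1) :
    (Real.cos (a.α i) * Real.cos (a.β i) - e * (Real.sin (a.α i) * Real.sin (a.β i))) ^ 2
      ≠ Real.sin (a.γ i) ^ 2 := by
  have h2 : √(2 : ℝ) ^ 2 = 2 := Real.sq_sqrt (by norm_num)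
  have h5 : √(5 : ℝ) ^ 2 = 5 := Real.sq_sqrt (by norm_num)
  have h7 : √(7 : ℝ) ^ 2 = 7 := Real.sq_sqrt (by norm_num)
  have h11 : √(11 : ℝ) ^ 2 = 11 := Real.sq_sqrt (by norm_num)
  -- Only the product of the signs of cos α and cos β matters.
  have key : ∃ x : ℝ, (x = 1 ∨ x = -1) ∧
      Real.cos (a.α i) * Real.cos (a.β i) = x * (exampleCosα i * exampleCosβ i) := by
    rcases h.cosα i with hα | hα <;> rcases h.cosβ i with hβ | hβ <;> rw [hα, hβ]
    · exact ⟨1, by simp⟩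
    · exact ⟨-1, by simp⟩
    · exact ⟨-1, by simp⟩
    · exact ⟨1, by simp⟩
  obtain ⟨x, hx, hc⟩ := key
  rw [hc, h.sinα, h.sinβ, h.sinγ]
  fin_cases i <;>
  simp only [Fin.mk_zero, Fin.mk_one, Fin.reduceFinMk, Matrix.cons_val, exampleSinα, exampleCosα,
    exampleCosβ, exampleSinβ, exampleSinγ]
  · rw [show (x * (√(5 : ℝ) / 5 * (7 * √2 / 10)) - e * (2 * √5 / 5 * (√2 / 10))) ^ 2 =
      √5 ^ 2 * √2 ^ 2 * (7 * x - 2 * e) ^ 2 / 2500 by ring]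
    simp only [div_pow, mul_pow, h2, h5]
    rcases hx with rfl | rfl <;> rcases he with rfl | rfl <;> norm_num
  · rw [show (x * (√(5 : ℝ) / 5 * (7 * √2 / 10)) - e * (2 * √5 / 5 * (√2 / 10))) ^ 2 =
      √5 ^ 2 * √2 ^ 2 * (7 * x - 2 * e) ^ 2 / 2500 by ring]
    simp only [div_pow, mul_pow, h2, h5]
    rcases hx with rfl | rfl <;> rcases he with rfl | rfl <;> norm_num
  · rw [show (x * (√(11 : ℝ) / 44 * (7 * √7 * √2 * √11 / 88)) -
        e * (5 * √7 * √11 / 44 * (3 * √2 * √11 / 88))) ^ 2 =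
      √11 ^ 2 * √11 ^ 2 * √7 ^ 2 * √2 ^ 2 * (7 * x - 15 * e) ^ 2 / 14992384 by ring]
    simp only [div_pow, mul_pow, h2, h7, h11]
    rcases hx with rfl | rfl <;> rcases he with rfl | rfl <;> norm_num
  · rw [show (x * (√(11 : ℝ) / 44 * (7 * √7 * √2 * √11 / 88)) -
        e * (5 * √7 * √11 / 44 * (3 * √2 * √11 / 88))) ^ 2 =
      √11 ^ 2 * √11 ^ 2 * √7 ^ 2 * √2 ^ 2 * (7 * x - 15 * e) ^ 2 / 14992384 by ring]
    simp only [div_pow, mul_pow, h2, h7, h11]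
    rcases hx with rfl | rfl <;> rcases he with rfl | rfl <;> norm_num

lemma isElliptic : a.IsElliptic := by
  intro i e₁ h₁ e₂ h₂ e₃ h₃ n H
  simp only [Set.mem_insert_iff, Set.mem_singleton_iff] at h₁ h₂ h₃
  refine h.cos_add_β_sq_ne i e₁ h₁ ?_
  have hc : Real.cos (a.α i + e₁ * a.β i) =
      Real.cos (a.α i) * Real.cos (a.β i) - e₁ * (Real.sin (a.α i) * Real.sin (a.β i)) := by
    rw [Real.cos_add]
    rcases h₁ with rfl | rfl <;> simp
  rw [← hc, show a.α i + e₁ * a.β i = -(e₂ * a.γ i + e₃ * a.δ i) + n * (2 * Real.pi) by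
    linarith, Real.cos_add_int_mul_two_pi, Real.cos_neg, h.δ]
  rcases h₃ with rfl | rfl
  · rw [one_mul, Real.cos_add_pi_div_two]
    rcases h₂ with rfl | rfl <;> simp
  · rw [neg_one_mul, ← sub_eq_add_neg, Real.cos_sub_pi_div_two]
    rcases h₂ with rfl | rfl <;> simp

lemma not_inOrthodiagonalClass : ¬ a.InOrthodiagonalClass := by
  rintro ⟨i, hi⟩
  rw [FlatAngles.OrthodiagonalAt, h.δ, Real.cos_pi_div_two, mul_zero] at hi
  exact mul_ne_zero (h.cosα_ne_zero i) (h.cosγ_ne_zero i) hi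

lemma not_inIsogonalClass : ¬ a.InIsogonalClass := by
  rintro ⟨i, ⟨-, hi⟩ | ⟨-, hi⟩⟩ <;> rw [h.δ] at hi
  · exact h.cosβ_ne_zero i (by rw [hi, Real.cos_pi_div_two])
  · exact h.cosβ_ne_zero i (by rw [show a.β i = Real.pi / 2 by linarith, Real.cos_pi_div_two])

lemma not_inConjugateModularClass : ¬ a.InConjugateModularClass := by
  rintro ⟨i, j, hij⟩
  rw [h.M_eq, h.M_eq] at hij
  norm_num at hij

lemma not_inLinearlyConjugateClass : ¬ a.InLinearlyConjugateClass := by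
  rintro ⟨i, ⟨hi, -⟩ | ⟨-, hi⟩ | ⟨hi, -⟩ | ⟨-, hi⟩⟩ <;> rw [h.δ] at hi
  · exact h.cosα_ne_zero i (by rw [hi, Real.cos_pi_div_two])
  · exact h.cosγ_ne_zero i (by rw [hi, Real.cos_pi_div_two])
  · exact h.cosα_ne_zero i (by rw [show a.α i = Real.pi / 2 by linarith, Real.cos_pi_div_two])
  · exact h.cosγ_ne_zero i (by rw [show a.γ i = Real.pi / 2 by linarith, Real.cos_pi_div_two])

lemma not_inChimeraClass : ¬ a.InChimeraClass := by
  rintro ⟨i, hi⟩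
  exact hi (h.isElliptic i)

end IsExampleUpToSigns

/-- A quadratic equation that is not trivial has finitely many roots. -/
lemma finite_setOf_quadratic_eq_zero {p q r : ℂ} (h : q ≠ 0 ∨ r ≠ 0) :
    {z : ℂ | p * z ^ 2 + q * z + r = 0}.Finite := by
  set P : Polynomial ℂ := .C p * .X ^ 2 + .C q * .X + .C r with hP
  have hP0 : P ≠ 0 := by
    intro H
    have h1 := congrArg (Polynomial.coeff · 1) H
    have h0 := congrArg (Polynomial.coeff · 0) H
    simp [hP, Polynomial.coeff_X, Polynomial.coeff_C] at h0 h1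
    tauto
  refine (P.rootSet_finite ℂ).subset fun z hz => ?_
  rw [Polynomial.mem_rootSet]
  exact ⟨hP0, by simpa [hP] using hz⟩

namespace IsExampleUpToSigns

variable {a : FlatAngles} (h : IsExampleUpToSigns a)

include h

lemma eval_bricard_eq_zero {w : Fin 4 → ℂ} (hw : w ∈ a.configSpace) (i : Fin 4) :
    (a.bricardCoeff i 0 : ℂ) * w (αStrip i) ^ 2 * w (γStrip i) ^ 2
      + a.bricardCoeff i 1 * w (αStrip i) ^ 2
      + a.bricardCoeff i 2 * w (γStrip i) ^ 2
      + a.bricardCoeff i 3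
      + ((4 * Real.sin (a.α i) * Real.sin (a.γ i) : ℝ) : ℂ)
        * w (αStrip i) * w (γStrip i) = 0 := by
  have := a.aeval_bricard i (h.δ i) w
  rw [MvPolynomial.aeval_eq_eval, hw i] at this
  exact this.symm

lemma linear_coeff_ne_zero (i : Fin 4) :
    ((4 * Real.sin (a.α i) * Real.sin (a.γ i) : ℝ) : ℂ) ≠ 0 := by
  have h1 := h.sinα_pos i
  have h2 := h.sinγ_pos i
  exact_mod_cast (by positivity : (4 * Real.sin (a.α i) * Real.sin (a.γ i) : ℝ) ≠ 0)

/-- One cotangent at a vertex determines the other one up to finitely many possibilities. -/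
lemma finite_image_γStrip {s : Set (Fin 4 → ℂ)} (hs : s ⊆ a.configSpace) (i : Fin 4)
    (hf : ((fun w => w (αStrip i)) '' s).Finite) : ((fun w => w (γStrip i)) '' s).Finite := by
  refine (hf.biUnion (t := fun c => {z : ℂ | (a.bricardCoeff i 0 * c ^ 2 + a.bricardCoeff i 2)
    * z ^ 2 + (((4 * Real.sin (a.α i) * Real.sin (a.γ i) : ℝ) : ℂ) * c) * z
      + (a.bricardCoeff i 1 * c ^ 2 + a.bricardCoeff i 3) = 0}) fun c _ =>
    finite_setOf_quadratic_eq_zero ?_).subset ?_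
  -- Where the linear coefficient vanishes with c, the constant term is a nonzero Bricard
  -- coefficient; elsewhere the linear coefficient itself is nonzero.
  · rcases eq_or_ne c 0 with rfl | hc
    · right
      simpa using h.bricardCoeff_ne_zero i 3
    · exact .inl (mul_ne_zero (h.linear_coeff_ne_zero i) hc)
  · rintro _ ⟨w, hw, rfl⟩
    refine Set.mem_biUnion (Set.mem_image_of_mem _ hw) ?_
    have := h.eval_bricard_eq_zero (hs hw) i
    simp only [Set.mem_ofPred_eq]
    rw [← this]
    ring

lemma finite_image_αStrip {s : Set (Fin 4 → ℂ)} (hs : s ⊆ a.configSpace) (i : Fin 4)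
    (hf : ((fun w => w (γStrip i)) '' s).Finite) : ((fun w => w (αStrip i)) '' s).Finite := by
  refine (hf.biUnion (t := fun c => {z : ℂ | (a.bricardCoeff i 0 * c ^ 2 + a.bricardCoeff i 1)
    * z ^ 2 + (((4 * Real.sin (a.α i) * Real.sin (a.γ i) : ℝ) : ℂ) * c) * z
      + (a.bricardCoeff i 2 * c ^ 2 + a.bricardCoeff i 3) = 0}) fun c _ =>
    finite_setOf_quadratic_eq_zero ?_).subset ?_
  · rcases eq_or_ne c 0 with rfl | hc
    · right
      simpa using h.bricardCoeff_ne_zero i 3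
    · exact .inl (mul_ne_zero (h.linear_coeff_ne_zero i) hc)
  · rintro _ ⟨w, hw, rfl⟩
    refine Set.mem_biUnion (Set.mem_image_of_mem _ hw) ?_
    have := h.eval_bricard_eq_zero (hs hw) i
    simp only [Set.mem_ofPred_eq]
    rw [← this]
    ring

lemma not_inTrivialClass : ¬ a.InTrivialClass := by
  rintro ⟨i, c, hinf⟩
  refine hinf ?_
  set s := {w ∈ a.configSpace | w i = c}
  have hs : s ⊆ a.configSpace := fun w hw => hw.1
  have hi : ((fun w => w i) '' s).Finite :=
    (Set.finite_singleton c).subset (by rintro _ ⟨w, hw, rfl⟩; exact hw.2)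
  have s10 : ((fun w => w 1) '' s).Finite → ((fun w => w 0) '' s).Finite :=
    h.finite_image_γStrip hs 1
  have s12 : ((fun w => w 1) '' s).Finite → ((fun w => w 2) '' s).Finite :=
    h.finite_image_γStrip hs 2
  have s30 : ((fun w => w 3) '' s).Finite → ((fun w => w 0) '' s).Finite :=
    h.finite_image_γStrip hs 0
  have s32 : ((fun w => w 3) '' s).Finite → ((fun w => w 2) '' s).Finite :=
    h.finite_image_γStrip hs 3
  have s01 : ((fun w => w 0) '' s).Finite → ((fun w => w 1) '' s).Finite :=
    h.finite_image_αStrip hs 1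
  have s21 : ((fun w => w 2) '' s).Finite → ((fun w => w 1) '' s).Finite :=
    h.finite_image_αStrip hs 2
  have s03 : ((fun w => w 0) '' s).Finite → ((fun w => w 3) '' s).Finite :=
    h.finite_image_αStrip hs 0
  have s23 : ((fun w => w 2) '' s).Finite → ((fun w => w 3) '' s).Finite :=
    h.finite_image_αStrip hs 3
  -- The four cotangents form a cycle, neighbours being related by one Bricard equation. Finiteness
  -- spreads from coordinate `i` to coordinate 1, and from there to all.
  have h1 : ((fun w => w 1) '' s).Finite := by
    fin_cases i
    exacts [s01 hi, hi, s21 hi, s21 (s32 hi)]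
  have hall : ∀ j, ((fun w => w j) '' s).Finite := by
    intro j
    fin_cases j
    exacts [s10 h1, h1, s12 h1, s23 (s12 h1)]
  exact (Set.Finite.pi' hall).subset fun w hw j => ⟨w, hw, rfl⟩

end IsExampleUpToSigns

/-! ### The linear compound class -/

section MinimalPrimes

open MvPolynomial

lemma isAlgebraic_of_quadratic {T D : Type*} [CommRing T] [CommRing D] [Algebra T D] {p q r : T}
    (hq : q ≠ 0) {z : D}
    (h : algebraMap T D p * z ^ 2 + algebraMap T D q * z + algebraMap T D r = 0) :
    IsAlgebraic T z := by
  refine ⟨.C p * .X ^ 2 + .C q * .X + .C r, fun H => hq ?_, by simpa using h⟩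
  simpa [Polynomial.coeff_X, Polynomial.coeff_C] using congrArg (Polynomial.coeff · 1) H

/-- The kernel of a homomorphism from a polynomial ring onto a domain, one coordinate `x` of which
is transcendental, is a minimal prime over `I`, if all coordinates are algebraic over `x` modulo any
prime between `I` and the kernel. -/
lemma ker_mem_minimalPrimes {K σ L : Type*} [Field K] [CommRing L] [IsDomain L] [Algebra K L]
    (I : Ideal (MvPolynomial σ K)) (φ : MvPolynomial σ K →ₐ[K] L) (i : σ)
    (ht : Transcendental K (φ (X i))) (hI : I ≤ RingHom.ker φ)
    (halg : ∀ Q : Ideal (MvPolynomial σ K), Q.IsPrime → I ≤ Q → Q ≤ RingHom.ker φ →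
      ∀ j, IsAlgebraic (Algebra.adjoin K {Ideal.Quotient.mk Q (X i)})
        (Ideal.Quotient.mk Q (X j))) :
    RingHom.ker φ ∈ I.minimalPrimes := by
  refine ⟨⟨RingHom.ker_isPrime φ, hI⟩, fun Q ⟨hQ, hIQ⟩ hle => ?_⟩
  intro x hx
  by_contra hxQ
  set R := Algebra.adjoin K {Ideal.Quotient.mk Q (X i)}
  -- If Q were strictly below the kernel, ψ would kill the nonzero class of x. That class is
  -- algebraic over K[Xᵢ], so a nonzero polynomial in Xᵢ would be killed too, against transcendence.
  let ψ : (MvPolynomial σ K ⧸ Q) →ₐ[K] L := Ideal.Quotient.liftₐ Q φ fun a ha => hle ha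
  have hψ (p : MvPolynomial σ K) : ψ (Ideal.Quotient.mk Q p) = φ p := rfl
  have halgT : ∀ y : MvPolynomial σ K ⧸ Q, IsAlgebraic R y := by
    intro y
    obtain ⟨p, rfl⟩ := Ideal.Quotient.mk_surjective y
    induction p using MvPolynomial.induction_on with
    | C c => exact isAlgebraic_algebraMap (A := MvPolynomial σ K ⧸ Q) (algebraMap K R c)
    | add p q hp hq => rw [map_add]; exact hp.add hq
    | mul_X p j hp => rw [map_mul]; exact hp.mul (halg Q hQ hIQ hle j)
  have hne : Ideal.Quotient.mk Q x ≠ 0 := fun h => hxQ (Ideal.Quotient.eq_zero_iff_mem.1 h)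
  have hmem : Ideal.Quotient.mk Q x ∈ RingHom.ker ψ := hx
  refine Ideal.comap_ne_bot_of_algebraic_mem (R := R) hne hmem (halgT _) ?_
  rw [eq_bot_iff]
  rintro ⟨y, hy⟩ hyψ
  obtain ⟨p, rfl⟩ := (Algebra.adjoin_singleton_eq_range_aeval K (Ideal.Quotient.mk Q (X i))).le hy
  have h0 : ψ (Polynomial.aeval (Ideal.Quotient.mk Q (X i)) p) = 0 := hyψ
  rw [← Polynomial.aeval_algHom_apply, hψ] at h0
  have hp : p = 0 := by
    by_contra hp
    exact ht ⟨p, hp, h0⟩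
  subst hp
  exact Subtype.ext (map_zero _)

/-- By the Nullstellensatz a maximal ideal is the ideal of a point, on which the coordinate i is a
constant of K; a transcendental value rules this out. -/
lemma not_isMaximal_ker {K σ L : Type*} [Field K] [IsAlgClosed K] [Finite σ] [CommRing L]
    [Algebra K L] (φ : MvPolynomial σ K →ₐ[K] L) (i : σ)
    (ht : Transcendental K (φ (X i))) : ¬ (RingHom.ker φ).IsMaximal := by
  intro h
  obtain ⟨x, hx⟩ := (isMaximal_iff_eq_vanishingIdeal_singleton).1 h
  have : X i - C (x i) ∈ RingHom.ker φ := by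
    rw [hx, mem_vanishingIdeal_iff]
    rintro y rfl
    simp
  rw [RingHom.mem_ker, map_sub, sub_eq_zero] at this
  refine ht ?_
  rw [this, ← algebraMap_eq, AlgHom.commutes]
  exact isAlgebraic_algebraMap _

end MinimalPrimes

/-- The coefficients at A₄ and A₁ are proportional with factor -1, and likewise at A₂ and A₃. The
linear coefficients agree within each pair, so the equations within a pair coincide when w₁ = -w₃.
-/
lemma exampleAngles_switch_three_bricardCoeff :
    (exampleAngles.switch {3}).bricardCoeff = fun i =>
      ![(√2 / 5) • ![3, 6, 1, 4], (-√2 / 5) • ![3, 6, 1, 4],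
        (-√7 * √2 * √11 / 88) • ![9, 10, 4, 5], (√7 * √2 * √11 / 88) • ![9, 10, 4, 5]] i := by
  have h5 : √(5 : ℝ) ^ 2 = 5 := Real.sq_sqrt (by norm_num)
  have hα (i) := exampleAngles_α i
  have hβ (i) := exampleAngles_β i
  have hγ (i) := exampleAngles_γ i
  ext i j
  fin_cases i <;> simp only [FlatAngles.bricardCoeff, FlatAngles.switch, αStrip, γStrip,
    Fin.mk_zero, Fin.mk_one, Fin.reduceFinMk, Matrix.cons_val, Finset.mem_singleton, Fin.reduceEq,
    if_true, if_false, Real.cos_pi_sub, Real.sin_pi_sub, hα, hβ, hγ, exampleCosα, exampleSinα,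
    exampleCosβ, exampleCosγ, exampleSinγ, xor_true, xor_false, id] <;>
    fin_cases j <;> simp [hβ, exampleCosβ] <;> ring_nf <;> (try simp only [h5]) <;> ring

lemma exampleAngles_switch_three_linear_coeff (i : Fin 4) :
    4 * Real.sin ((exampleAngles.switch {3}).α i) * Real.sin ((exampleAngles.switch {3}).γ i) =
      ![12 * √2 / 5, 12 * √2 / 5, 35 * √2 * √11 / 44, 35 * √2 * √11 / 44] i := by
  have h5 : √(5 : ℝ) ^ 2 = 5 := Real.sq_sqrt (by norm_num)
  have h7 : √(7 : ℝ) ^ 2 = 7 := Real.sq_sqrt (by norm_num)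
  have h := isExampleUpToSigns_switch {3}
  rw [h.sinα, h.sinγ]
  fin_cases i <;> simp [exampleSinα, exampleSinγ] <;> ring_nf <;> simp only [h5, h7] <;> ring

lemma aeval_bricard_switch_three_zero {R : Type*} [CommRing R] [Algebra ℂ R] (w : Fin 4 → R) :
    MvPolynomial.aeval w ((exampleAngles.switch {3}).bricard 0) = algebraMap ℂ R ((√2 / 5 : ℝ) : ℂ)
      * (3 * w 3 ^ 2 * w 0 ^ 2 + 6 * w 3 ^ 2 + w 0 ^ 2 + 4 + 12 * w 3 * w 0) := by
  rw [FlatAngles.aeval_bricard _ _ rfl, exampleAngles_switch_three_bricardCoeff,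
    exampleAngles_switch_three_linear_coeff]
  simp only [αStrip, γStrip, Matrix.cons_val, Pi.smul_apply, smul_eq_mul]
  push_cast
  rw [show (12 : ℂ) * (√2 : ℝ) / 5 = (√2 : ℝ) / 5 * 12 by ring]
  simp only [map_mul, map_ofNat]
  ring

lemma aeval_bricard_switch_three_one {R : Type*} [CommRing R] [Algebra ℂ R] (w : Fin 4 → R) :
    MvPolynomial.aeval w ((exampleAngles.switch {3}).bricard 1) =
      algebraMap ℂ R ((-√2 / 5 : ℝ) : ℂ)
      * (3 * w 1 ^ 2 * w 0 ^ 2 + 6 * w 1 ^ 2 + w 0 ^ 2 + 4 - 12 * w 1 * w 0) := by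
  rw [FlatAngles.aeval_bricard _ _ rfl, exampleAngles_switch_three_bricardCoeff,
    exampleAngles_switch_three_linear_coeff]
  simp only [αStrip, γStrip, Matrix.cons_val, Pi.smul_apply, smul_eq_mul]
  push_cast
  rw [show (12 : ℂ) * (√2 : ℝ) / 5 = -(-(√2 : ℝ) / 5 * 12) by ring]
  simp only [map_neg, map_mul, map_ofNat]
  ring

lemma aeval_bricard_switch_three_two {R : Type*} [CommRing R] [Algebra ℂ R] (w : Fin 4 → R) :
    MvPolynomial.aeval w ((exampleAngles.switch {3}).bricard 2) =
      algebraMap ℂ R ((-√7 * √2 * √11 / 88 : ℝ) : ℂ) * (9 * w 1 ^ 2 * w 2 ^ 2 + 10 * w 1 ^ 2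
        + 4 * w 2 ^ 2 + 5 - 10 * algebraMap ℂ R (√7 : ℝ) * w 1 * w 2) := by
  have h7 : √(7 : ℝ) ^ 2 = 7 := Real.sq_sqrt (by norm_num)
  rw [FlatAngles.aeval_bricard _ _ rfl, exampleAngles_switch_three_bricardCoeff,
    exampleAngles_switch_three_linear_coeff]
  simp only [αStrip, γStrip, Matrix.cons_val, Pi.smul_apply, smul_eq_mul]
  rw [show 35 * √2 * √11 / 44 = -((-√7 * √2 * √11 / 88) * 10 * √7) by
    linear_combination (-10 * √2 * √11 / 88) * h7]
  rw [Complex.ofReal_neg, map_neg]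
  simp only [Complex.ofReal_mul, Complex.ofReal_ofNat, map_mul, map_ofNat]
  ring

lemma aeval_bricard_switch_three_three {R : Type*} [CommRing R] [Algebra ℂ R] (w : Fin 4 → R) :
    MvPolynomial.aeval w ((exampleAngles.switch {3}).bricard 3) =
      algebraMap ℂ R ((√7 * √2 * √11 / 88 : ℝ) : ℂ) * (9 * w 3 ^ 2 * w 2 ^ 2 + 10 * w 3 ^ 2
        + 4 * w 2 ^ 2 + 5 + 10 * algebraMap ℂ R (√7 : ℝ) * w 3 * w 2) := by
  have h7 : √(7 : ℝ) ^ 2 = 7 := Real.sq_sqrt (by norm_num)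
  rw [FlatAngles.aeval_bricard _ _ rfl, exampleAngles_switch_three_bricardCoeff,
    exampleAngles_switch_three_linear_coeff]
  simp only [αStrip, γStrip, Matrix.cons_val, Pi.smul_apply, smul_eq_mul]
  rw [show 35 * √2 * √11 / 44 = (√7 * √2 * √11 / 88) * 10 * √7 by
    linear_combination (-10 * √2 * √11 / 88) * h7]
  simp only [Complex.ofReal_mul, Complex.ofReal_ofNat, map_mul, map_ofNat]
  ring

/-- If a nonzero `y` is algebraic over `R` and related to `z` by an equation of the shape of
Bricard's, then `z` is algebraic over `R`. -/
lemma IsAlgebraic.of_bricard {K D : Type*} [Field K] [CommRing D] [IsDomain D] [Algebra K D]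
    (R : Subalgebra K D) {y z : D} (hy : IsAlgebraic R y) (hy0 : y ≠ 0) {A B C E F : K} (hF : F ≠ 0)
    (h : algebraMap K D A * y ^ 2 * z ^ 2 + algebraMap K D B * y ^ 2 + algebraMap K D C * z ^ 2
      + algebraMap K D E + algebraMap K D F * y * z = 0) : IsAlgebraic R z := by
  set T := Subalgebra.algebraicClosure R D
  let y' : T := ⟨y, hy⟩
  let g : K →+* T := (algebraMap R T).comp (algebraMap K R)
  have hg (c : K) : algebraMap T D (g c) = algebraMap K D c := rfl
  -- Over the algebraic closure T of R in D, the relation is a quadratic in z whose linear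
  -- coefficient F·y is nonzero; its leading coefficient may vanish.
  refine IsAlgebraic.restrictScalars R (S := T) (isAlgebraic_of_quadratic
    (p := g A * y' ^ 2 + g C) (q := g F * y') (r := g B * y' ^ 2 + g E) ?_ ?_)
  · intro H
    have := congrArg (algebraMap T D) H
    rw [map_mul, hg, map_zero] at this
    exact mul_ne_zero ((map_ne_zero_iff _ (algebraMap K D).injective).2 hF) hy0 this
  · simp only [map_add, map_mul, map_pow, hg, show algebraMap T D y' = y from rfl]
    rw [← h]
    ring

lemma isLinearCompound_of_transcendental {L : Type*} [Field L] [IsAlgClosed L] [Algebra ℂ L]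
    {t : L} (ht : Transcendental ℂ t) :
    (exampleAngles.switch {3}).IsLinearCompound := by
  set a := exampleAngles.switch {3} with ha
  have h : IsExampleUpToSigns a := isExampleUpToSigns_switch {3}
  let z : ℝ → L := fun x => algebraMap ℂ L x
  have hz (x : ℝ) : algebraMap ℂ L x = z x := rfl
  have zsq (n : ℕ) : z √n ^ 2 = n := by
    simp only [z, ← map_pow, ← Complex.ofReal_pow, Real.sq_sqrt n.cast_nonneg]
    rw [Complex.ofReal_natCast, map_natCast]
  have z5 : z √5 ^ 2 = 5 := by exact_mod_cast zsq 5
  have z7 : z √7 ^ 2 = 7 := by exact_mod_cast zsq 7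
  have hne {p : Polynomial ℂ} (hp : p ≠ 0) : Polynomial.aeval t p ≠ 0 := fun H => ht ⟨p, hp, H⟩
  have hne' {p : Polynomial ℂ} (c : ℂ) (hp : p.eval c ≠ 0) : Polynomial.aeval t p ≠ 0 :=
    hne fun H => hp (by rw [H, Polynomial.eval_zero])
  have ht0 : t ≠ 0 := by simpa using hne' (p := .X) 1 (by simp)
  have hd (u v : ℕ) (hu : u ≠ 0) : (u : L) + v * t ^ 2 ≠ 0 := by
    have := hne' (p := .C (u : ℂ) + .C (v : ℂ) * .X ^ 2) 0 (by simpa using hu)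
    rwa [map_add, map_mul, map_pow, Polynomial.aeval_C, Polynomial.aeval_C, Polynomial.aeval_X,
      map_natCast, map_natCast] at this
  have d4 : 1 + 3 * t ^ 2 ≠ 0 := by exact_mod_cast hd 1 3 (by norm_num)
  have d2 : 4 + 9 * t ^ 2 ≠ 0 := by exact_mod_cast hd 4 9 (by norm_num)
  have n4 : 4 + 6 * t ^ 2 ≠ 0 := by exact_mod_cast hd 4 6 (by norm_num)
  have n2 : 5 + 10 * t ^ 2 ≠ 0 := by exact_mod_cast hd 5 10 (by norm_num)
  -- One square root solves both quadratics: the quarter discriminant for `w 2` is five times the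
  -- one for `w 0`, which explains the factor √5.
  obtain ⟨s, hs⟩ := IsAlgClosed.exists_pow_nat_eq (2 * (3 * t ^ 2 - 1) * (2 - 3 * t ^ 2)) two_pos
  let w : Fin 4 → L := ![(6 * t - s) / (1 + 3 * t ^ 2), t,
    (5 * z √7 * t - z √5 * s) / (4 + 9 * t ^ 2), -t]
  have w0 : w 0 * (1 + 3 * t ^ 2) = 6 * t - s := div_mul_cancel₀ _ d4
  have w2 : w 2 * (4 + 9 * t ^ 2) = 5 * z √7 * t - z √5 * s := div_mul_cancel₀ _ d2
  have w1 : w 1 = t := rfl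
  have w3 : w 3 = -t := rfl
  have e0 : 3 * t ^ 2 * w 0 ^ 2 + 6 * t ^ 2 + w 0 ^ 2 + 4 - 12 * t * w 0 = 0 := by
    refine (mul_eq_zero.1 ?_).resolve_left d4
    linear_combination (w 0 * (1 + 3 * t ^ 2) - 6 * t - s) * w0 + hs
  have e2 : 9 * t ^ 2 * w 2 ^ 2 + 10 * t ^ 2 + 4 * w 2 ^ 2 + 5 - 10 * z √7 * t * w 2 = 0 := by
    refine (mul_eq_zero.1 ?_).resolve_left d2
    linear_combination (w 2 * (4 + 9 * t ^ 2) - 5 * z √7 * t - z √5 * s) * w2 + 5 * hs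
      + s ^ 2 * z5 - 25 * t ^ 2 * z7
  have h0 : w 0 ≠ 0 := by
    intro H; rw [H] at e0; apply n4; linear_combination e0
  have h2 : w 2 ≠ 0 := by
    intro H; rw [H] at e2; apply n2; linear_combination e2
  have hw : ∀ i, MvPolynomial.aeval w (a.bricard i) = 0 := by
    intro i
    fin_cases i
    · refine (aeval_bricard_switch_three_zero w).trans ?_
      rw [w3]; linear_combination algebraMap ℂ L ((√2 / 5 : ℝ) : ℂ) * e0
    · refine (aeval_bricard_switch_three_one w).trans ?_
      rw [w1]; linear_combination algebraMap ℂ L ((-√2 / 5 : ℝ) : ℂ) * e0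
    · refine (aeval_bricard_switch_three_two w).trans ?_
      rw [w1, hz √7]
      linear_combination algebraMap ℂ L ((-√7 * √2 * √11 / 88 : ℝ) : ℂ) * e2
    · refine (aeval_bricard_switch_three_three w).trans ?_
      rw [w3, hz √7]
      linear_combination algebraMap ℂ L ((√7 * √2 * √11 / 88 : ℝ) : ℂ) * e2
  set φ : MvPolynomial (Fin 4) ℂ →ₐ[ℂ] L := MvPolynomial.aeval w with hφ
  have hX (i) : φ (MvPolynomial.X i) = w i := MvPolynomial.aeval_X w i
  have ht' : Transcendental ℂ (φ (MvPolynomial.X 1)) := by rw [hX]; exact ht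
  refine ⟨RingHom.ker φ, ker_mem_minimalPrimes _ φ 1 ht' ?_ ?_, not_isMaximal_ker φ 1 ht', ?_, ?_,
    -1, by norm_num, ?_⟩
  · rw [Ideal.span_le]
    rintro _ ⟨i, rfl⟩
    exact hw i
  · intro Q hQ hIQ hle
    set x : Fin 4 → MvPolynomial (Fin 4) ℂ ⧸ Q := fun j => Ideal.Quotient.mk Q (MvPolynomial.X j)
    -- Q lies in the kernel, so a coordinate that is nonzero at the generic point is nonzero modulo
    -- Q.
    have hx0 (j) (hj : w j ≠ 0) : x j ≠ 0 := by
      intro H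
      have := hle (Ideal.Quotient.eq_zero_iff_mem.1 H)
      rw [RingHom.mem_ker, hX] at this
      exact hj this
    have hxb (j) : MvPolynomial.aeval x (a.bricard j) = 0 := by
      have : MvPolynomial.aeval x = Ideal.Quotient.mkₐ ℂ Q := by
        ext j; simp [x]
      rw [this]
      exact Ideal.Quotient.eq_zero_iff_mem.2 (hIQ (Ideal.subset_span ⟨j, rfl⟩))
    simp only [a.aeval_bricard _ (h.δ _)] at hxb
    have a1 : IsAlgebraic (Algebra.adjoin ℂ {x 1}) (x 1) :=
      isAlgebraic_algebraMap (A := MvPolynomial (Fin 4) ℂ ⧸ Q)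
        (⟨x 1, Algebra.self_mem_adjoin_singleton ℂ _⟩ : Algebra.adjoin ℂ {x 1})
    have a0 : IsAlgebraic (Algebra.adjoin ℂ {x 1}) (x 0) :=
      a1.of_bricard _ (hx0 1 ht0) (h.linear_coeff_ne_zero 1) (hxb 1)
    have a2 : IsAlgebraic (Algebra.adjoin ℂ {x 1}) (x 2) :=
      a1.of_bricard _ (hx0 1 ht0) (h.linear_coeff_ne_zero 2) (hxb 2)
    have a3 : IsAlgebraic (Algebra.adjoin ℂ {x 1}) (x 3) := by
      -- Here one passes from the γ-strip to the α-strip, so the coefficients of the two pure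
      -- squares trade places.
      refine a2.of_bricard _ (hx0 2 h2) (h.linear_coeff_ne_zero 3) (A := a.bricardCoeff 3 0)
        (B := a.bricardCoeff 3 2) (C := a.bricardCoeff 3 1) (E := a.bricardCoeff 3 3) ?_
      rw [← hxb 3]
      simp only [αStrip, γStrip, Matrix.cons_val]
      ring
    intro j
    fin_cases j
    exacts [a0, a1, a2, a3]
  · rw [RingHom.mem_ker, hX]; exact ht0
  · rw [RingHom.mem_ker, hX]; exact neg_ne_zero.2 ht0
  · rw [RingHom.mem_ker, map_sub, map_mul, hX, hX, w1, w3, hφ, MvPolynomial.aeval_C]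
    simp

lemma isLinearCompound_exampleAngles_switch : (exampleAngles.switch {3}).IsLinearCompound :=
  isLinearCompound_of_transcendental (L := AlgebraicClosure (RatFunc ℂ))
    ((transcendental_algebraMap_iff (algebraMap (RatFunc ℂ) _).injective).2
      RatFunc.transcendental_X)

/-! ### Elliptic integrals -/

section EllipticIntegrals

variable {k : ℝ}

lemma one_sub_mul_sin_sq_pos (hk : k ^ 2 < 1) (θ : ℝ) : 0 < 1 - k ^ 2 * Real.sin θ ^ 2 := by
  nlinarith [Real.sin_sq_add_cos_sq θ, sq_nonneg (Real.cos θ), sq_nonneg (Real.sin θ), sq_nonneg k]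

lemma hasDerivAt_ellipticF (hk : k ^ 2 < 1) (φ : ℝ) :
    HasDerivAt (ellipticF k) (1 / √(1 - k ^ 2 * Real.sin φ ^ 2)) φ := by
  have hc : Continuous fun θ => 1 / √(1 - k ^ 2 * Real.sin θ ^ 2) := by
    refine continuous_const.div (by fun_prop) fun θ => ?_
    exact (Real.sqrt_pos.2 (one_sub_mul_sin_sq_pos hk θ)).ne'
  exact (hc.integral_hasStrictDerivAt 0 φ).hasDerivAt

lemma strictMono_ellipticF (hk : k ^ 2 < 1) : StrictMono (ellipticF k) :=
  strictMono_of_hasDerivAt_pos (hasDerivAt_ellipticF hk) fun φ =>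
    one_div_pos.2 (Real.sqrt_pos.2 (one_sub_mul_sin_sq_pos hk φ))

lemma jacobiAm_ellipticF (hk : k ^ 2 < 1) (φ : ℝ) : jacobiAm k (ellipticF k φ) = φ :=
  Function.leftInverse_invFun (strictMono_ellipticF hk).injective φ

lemma ellipticF_zero : ellipticF k 0 = 0 := intervalIntegral.integral_same

lemma jacobiAm_zero (hk : k ^ 2 < 1) : jacobiAm k 0 = 0 := by
  simpa [ellipticF_zero] using jacobiAm_ellipticF hk 0

/-- The substitution x = sin θ. -/
lemma ellipticK_eq_ellipticF (hk : k ^ 2 < 1) : ellipticK k = ellipticF k (Real.pi / 2) := by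
  have hd : ∀ x ∈ Set.Ioo (0 : ℝ) 1, HasDerivAt (fun x => ellipticF k (Real.arcsin x))
      (1 / √((1 - x ^ 2) * (1 - k ^ 2 * x ^ 2))) x := by
    intro x hx
    have h1 := Real.hasDerivAt_arcsin (x := x) (by linarith [hx.1]) hx.2.ne
    have h2 := (hasDerivAt_ellipticF hk (Real.arcsin x)).comp x h1
    rw [Real.sin_arcsin (by linarith [hx.1]) hx.2.le] at h2
    refine h2.congr_deriv ?_
    rw [Real.sqrt_mul (by nlinarith [hx.1, hx.2])]
    rw [one_div_mul_one_div, mul_comm √(1 - k ^ 2 * x ^ 2)]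
  have hc : ContinuousOn (fun x => ellipticF k (Real.arcsin x)) (Set.Icc 0 1) :=
    (continuous_iff_continuousAt.2 fun x =>
      ((hasDerivAt_ellipticF hk x).continuousAt)).comp_continuousOn
      Real.continuous_arcsin.continuousOn
  -- The integrand is unbounded at 1; it is integrable as a nonnegative derivative of a function
  -- continuous up to the endpoints.
  have hi := intervalIntegral.integrableOn_deriv_of_nonneg hc hd fun x _ => by positivity
  have := intervalIntegral.integral_eq_sub_of_hasDerivAt_of_le zero_le_one hc hd
    ((intervalIntegrable_iff_integrableOn_Ioc_of_le zero_le_one).2 hi)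
  rw [ellipticK, this, Real.arcsin_one, Real.arcsin_zero, ellipticF_zero, sub_zero]

/-- In the variable x = tan φ the integrand becomes algebraic and acquires the symmetry x ↦ 1/(k'x).
-/
lemma hasDerivAt_ellipticF_arctan (hk : k ^ 2 < 1) (x : ℝ) :
    HasDerivAt (fun x => ellipticF k (Real.arctan x))
      (1 / √((1 + x ^ 2) * (1 + (1 - k ^ 2) * x ^ 2))) x := by
  refine ((hasDerivAt_ellipticF hk (Real.arctan x)).comp x
    (Real.hasDerivAt_arctan x)).congr_deriv ?_
  have h1 : 0 < 1 + x ^ 2 := by positivity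
  have h2 : 1 + (1 - k ^ 2) * x ^ 2 = (1 + x ^ 2) * (1 - k ^ 2 * Real.sin (Real.arctan x) ^ 2) := by
    rw [Real.sin_arctan, div_pow, Real.sq_sqrt h1.le]
    field_simp
    ring
  rw [h2, ← mul_assoc, Real.sqrt_mul (by positivity), ← sq, Real.sqrt_sq h1.le]
  field_simp

/-- The quarter period minus an argument: `F (arctan x) + F (arctan y)` does not depend on `x` if
`k' x y = 1`. -/
lemma ellipticF_arctan_add_eq (hk : k ^ 2 < 1) {x y u v : ℝ} (hx : 0 < x) (hu : 0 < u)
    (hxy : compModulus k * x * y = 1) (huv : compModulus k * u * v = 1) :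
    ellipticF k (Real.arctan x) + ellipticF k (Real.arctan y) =
      ellipticF k (Real.arctan u) + ellipticF k (Real.arctan v) := by
  have hκ : 0 < compModulus k := Real.sqrt_pos.2 (by linarith)
  have hκ2 : 1 - k ^ 2 = compModulus k ^ 2 := (Real.sq_sqrt (by linarith)).symm
  set κ := compModulus k
  obtain rfl : y = (κ * x)⁻¹ := by exact eq_inv_of_mul_eq_one_right (by linarith)
  obtain rfl : v = (κ * u)⁻¹ := by exact eq_inv_of_mul_eq_one_right (by linarith)
  have hd : ∀ x ∈ Set.Ioi (0 : ℝ), HasDerivAt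
      (fun x => ellipticF k (Real.arctan x) + ellipticF k (Real.arctan (κ * x)⁻¹)) 0 x := by
    intro x hx
    have hx : 0 < x := hx
    have h1 := hasDerivAt_ellipticF_arctan hk x
    have h2 : HasDerivAt (fun x => (κ * x)⁻¹) (-κ / (κ * x) ^ 2) x := 
      (((hasDerivAt_id x).const_mul κ).inv (mul_pos hκ hx).ne').congr_deriv (by simp)
    refine (h1.add ((hasDerivAt_ellipticF_arctan hk (κ * x)⁻¹).comp x h2)).congr_deriv ?_
    rw [hκ2]
    -- The involution x ↦ 1/(κx) carries the differential to its negative, so the derivatives of the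
    -- two terms cancel.
    have : √((1 + x ^ 2) * (1 + κ ^ 2 * x ^ 2)) =
        κ * x ^ 2 * √((1 + (κ * x)⁻¹ ^ 2) * (1 + κ ^ 2 * (κ * x)⁻¹ ^ 2)) := by
      rw [← Real.sqrt_sq (show 0 ≤ κ * x ^ 2 by positivity), ← Real.sqrt_mul (by positivity)]
      congr 1
      field_simp
      ring
    rw [this]
    have : 0 < √((1 + (κ * x)⁻¹ ^ 2) * (1 + κ ^ 2 * (κ * x)⁻¹ ^ 2)) := by positivity
    field_simp
    ring
  exact isOpen_Ioi.is_const_of_deriv_eq_zero isPreconnected_Ioi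
    (fun x hx => (hd x hx).differentiableAt.differentiableWithinAt)
    (fun x hx => (hd x hx).deriv) hx hu

/-- The delta amplitude on the imaginary axis. -/
lemma jacobiDn_I_mul_ellipticF_arctan (hk : k ^ 2 < 1) (hk' : compModulus k ^ 2 < 1) (x : ℝ) :
    jacobiDn k (Complex.I * ellipticF (compModulus k) (Real.arctan x)) =
      ((√(1 + k ^ 2 * x ^ 2) : ℝ) : ℂ) := by
  have h1 : (Complex.I * ellipticF (compModulus k) (Real.arctan x) : ℂ).re = 0 := by simp
  have h2 : (Complex.I * ellipticF (compModulus k) (Real.arctan x) : ℂ).im =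
    ellipticF (compModulus k) (Real.arctan x) := by simp
  have hκ2 : compModulus k ^ 2 = 1 - k ^ 2 := Real.sq_sqrt (by linarith)
  simp only [jacobiDn, h1, h2, realDn, realCn, realSn, jacobiAm_zero hk, jacobiAm_ellipticF hk']
  simp only [Real.sin_zero, Real.cos_zero, mul_zero, zero_mul, Complex.ofReal_zero, sub_zero,
    one_mul, zero_pow two_ne_zero, Real.sqrt_one, add_zero]
  rw [← Complex.ofReal_div]
  congr 1
  -- On the imaginary axis the formula reduces to d₁/c₁, and at amplitude arctan x its square is (1
  -- + x²)(1 - k'² sin²) = 1 + k²x².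
  rw [sq (Real.cos _), mul_div_mul_left _ _ (Real.cos_arctan_pos x).ne', Real.sin_arctan,
    Real.cos_arctan, div_pow, Real.sq_sqrt (by positivity), hκ2, div_div_eq_mul_div, div_one,
    ← Real.sqrt_mul']
  · congr 1
    field_simp
    ring
  · positivity

end EllipticIntegrals

/-! ### Equimodular elliptic type -/

section Equimodular

lemma exampleAngles_f (i : Fin 4) : exampleAngles.f i = ![3 / 2, 2, 7 / 4, 5 / 3] i := by
  have h2 : √(2 : ℝ) ^ 2 = 2 := Real.sq_sqrt (by norm_num)
  have h5 : √(5 : ℝ) ^ 2 = 5 := Real.sq_sqrt (by norm_num)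
  have h7 : √(7 : ℝ) ^ 2 = 7 := Real.sq_sqrt (by norm_num)
  rw [FlatAngles.f_eq _ _ rfl, (exampleAngles_α i).1, (exampleAngles_α i).2, (exampleAngles_β i).2,
    (exampleAngles_γ i).1, (exampleAngles_γ i).2]
  fin_cases i <;>
  simp only [Fin.mk_zero, Fin.mk_one, Fin.reduceFinMk, Matrix.cons_val, exampleSinα, exampleCosα,
    exampleCosγ, exampleSinβ, exampleSinγ]
  · rw [show √(5 : ℝ) / 5 * (√2 * √5 / 10) + 2 * √5 / 5 * (3 * √2 * √5 / 10) + √2 / 10 =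
      √2 * (7 * √5 ^ 2 + 5) / 50 by ring, h5]
    field_simp
    rw [h5]; norm_num
  · rw [show √(5 : ℝ) / 5 * -(√2 * √5 / 10) + 2 * √5 / 5 * (3 * √2 * √5 / 10) + √2 / 10 =
      √2 * (5 * √5 ^ 2 + 5) / 50 by ring, h5]
    field_simp
    rw [h5]; norm_num
  · rw [show √(11 : ℝ) / 44 * -(√2 / 4) + 5 * √7 * √11 / 44 * (√2 * √7 / 4)
      + 3 * √2 * √11 / 88 = √2 * √11 * (5 * √7 ^ 2 + 5) / 176 by ring, h7]
    field_simp
    rw [h7]; norm_num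
  · rw [show √(11 : ℝ) / 44 * (√2 / 4) + 5 * √7 * √11 / 44 * (√2 * √7 / 4)
      + 3 * √2 * √11 / 88 = √2 * √11 * (5 * √7 ^ 2 + 7) / 176 by ring, h7]
    field_simp
    rw [h7]; norm_num

lemma exampleAngles_r (i : Fin 4) : exampleAngles.r i = ![5 / 2, 4 / 3, 4 / 3, 5 / 2] i := by
  have h2 : √(2 : ℝ) ^ 2 = 2 := Real.sq_sqrt (by norm_num)
  rw [FlatAngles.r_eq _ _ rfl, (exampleAngles_α i).2, (exampleAngles_β i).1, (exampleAngles_β i).2,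
    (exampleAngles_γ i).1, (exampleAngles_γ i).2]
  fin_cases i <;>
  simp only [Fin.mk_zero, Fin.mk_one, Fin.reduceFinMk, Matrix.cons_val, exampleSinα, exampleCosβ,
    exampleCosγ, exampleSinβ, exampleSinγ]
  · rw [show 2 * √(5 : ℝ) / 5 + √2 / 10 * (3 * √2 * √5 / 10) - 7 * √2 / 10 * (√2 * √5 / 10) =
      √5 * (40 - 4 * √2 ^ 2) / 100 by ring, h2]
    field_simp
    norm_num
  · rw [show 2 * √(5 : ℝ) / 5 + √2 / 10 * (3 * √2 * √5 / 10) - 7 * √2 / 10 * -(√2 * √5 / 10) =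
      √5 * (40 + 10 * √2 ^ 2) / 100 by ring, h2]
    field_simp
    norm_num
  · rw [show 5 * √(7 : ℝ) * √11 / 44 + 3 * √2 * √11 / 88 * (√2 * √7 / 4)
      - 7 * √7 * √2 * √11 / 88 * -(√2 / 4) = √7 * √11 * (40 + 10 * √2 ^ 2) / 352 by ring, h2]
    field_simp
    norm_num
  · rw [show 5 * √(7 : ℝ) * √11 / 44 + 3 * √2 * √11 / 88 * (√2 * √7 / 4)
      - 7 * √7 * √2 * √11 / 88 * (√2 / 4) = √7 * √11 * (40 - 4 * √2 ^ 2) / 352 by ring, h2]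
    field_simp
    norm_num

lemma exampleAngles_s (i : Fin 4) : exampleAngles.s i = ![3, 3, 11 / 6, 11 / 6] i := by
  have h11 : √(11 : ℝ) ^ 2 = 11 := Real.sq_sqrt (by norm_num)
  rw [FlatAngles.s_eq _ _ rfl, (exampleAngles_α i).1, (exampleAngles_α i).2, (exampleAngles_β i).1,
    (exampleAngles_β i).2, (exampleAngles_γ i).2]
  fin_cases i <;>
  simp only [Fin.mk_zero, Fin.mk_one, Fin.reduceFinMk, Matrix.cons_val, exampleSinα, exampleCosα,
    exampleCosβ, exampleSinβ, exampleSinγ]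
  · rw [show 3 * √2 * √(5 : ℝ) / 10 + 2 * √5 / 5 * (√2 / 10) - √5 / 5 * (7 * √2 / 10) =
      √2 * √5 / 5 by ring]
    field_simp
    norm_num
  · rw [show 3 * √2 * √(5 : ℝ) / 10 + 2 * √5 / 5 * (√2 / 10) - √5 / 5 * (7 * √2 / 10) =
      √2 * √5 / 5 by ring]
    field_simp
    norm_num
  · rw [show √2 * √(7 : ℝ) / 4 + 5 * √7 * √11 / 44 * (3 * √2 * √11 / 88)
      - √11 / 44 * (7 * √7 * √2 * √11 / 88) = √2 * √7 * (968 + 8 * √11 ^ 2) / 3872 by ring, h11]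
    field_simp
    norm_num
  · rw [show √2 * √(7 : ℝ) / 4 + 5 * √7 * √11 / 44 * (3 * √2 * √11 / 88)
      - √11 / 44 * (7 * √7 * √2 * √11 / 88) = √2 * √7 * (968 + 8 * √11 ^ 2) / 3872 by ring, h11]
    field_simp
    norm_num

lemma exampleAngles_mem_Icc (i : Fin 4) : exampleAngles.α i ∈ Set.Icc 0 Real.pi ∧
    exampleAngles.β i ∈ Set.Icc 0 Real.pi ∧ exampleAngles.γ i ∈ Set.Icc 0 Real.pi := by
  fin_cases i <;> simp only [exampleAngles, Fin.mk_zero, Fin.mk_one, Fin.reduceFinMk,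
    Matrix.cons_val] <;>
    exact ⟨⟨Real.arccos_nonneg _, Real.arccos_le_pi _⟩, ⟨Real.arccos_nonneg _, Real.arccos_le_pi _⟩,
      ⟨Real.arccos_nonneg _, Real.arccos_le_pi _⟩⟩

/-- Here α is acute, δ is right, and β + γ < π because cos β > -cos γ. -/
lemma exampleAngles_σ_lt_pi (i : Fin 4) : exampleAngles.σ i < Real.pi := by
  obtain ⟨hα, hβ, hγ⟩ := exampleAngles_mem_Icc i
  have h1 : exampleAngles.α i < Real.pi / 2 := by
    by_contra! h
    refine (Real.cos_nonpos_of_pi_div_two_le_of_le h (by linarith [hα.2])).not_gt ?_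
    rw [(exampleAngles_α i).1]
    exact exampleCosα_pos i
  have h2 : exampleAngles.β i < Real.pi - exampleAngles.γ i := by
    by_contra! h
    refine (Real.cos_le_cos_of_nonneg_of_le_pi (by linarith [hγ.2]) hβ.2 h).not_gt ?_
    rw [Real.cos_pi_sub, (exampleAngles_β i).1, (exampleAngles_γ i).1]
    have p2 : 0 < √(2 : ℝ) := by positivity
    have l5 : √(5 : ℝ) < 7 := by rw [Real.sqrt_lt' (by norm_num)]; norm_num
    have l77 : 4 < √(7 : ℝ) * √11 := by
      rw [← Real.sqrt_mul (by norm_num), Real.lt_sqrt (by norm_num)]; norm_num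
    fin_cases i <;> simp only [exampleCosβ, exampleCosγ, Fin.mk_zero, Fin.mk_one, Fin.reduceFinMk,
      Matrix.cons_val]
    · have : 0 < √(2 : ℝ) * √5 := by positivity
      linarith
    · nlinarith
    · nlinarith [mul_lt_mul_of_pos_left l77 p2]
    · have : 0 < √(7 : ℝ) * √2 * √11 := by positivity
      linarith
  rw [FlatAngles.σ, exampleAngles_δ]
  linarith

/-- Both r and s exceed 1, so the amplitudes are real and positive. -/
lemma exampleAngles_phaseIndex (i : Fin 4) : exampleAngles.phaseIndex i = 0 := by
  have hr : 0 < exampleAngles.r i - 1 := by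
    rw [exampleAngles_r]; fin_cases i <;> simp <;> norm_num
  have hs : 0 < exampleAngles.s i - 1 := by
    rw [exampleAngles_s]; fin_cases i <;> simp <;> norm_num
  rw [FlatAngles.phaseIndex, if_pos, if_pos (exampleAngles_σ_lt_pi i)]
  refine ⟨√(exampleAngles.r i - 1) * √(exampleAngles.s i - 1), by positivity, ?_⟩
  rw [FlatAngles.p, FlatAngles.q, sqrtC, sqrtC, if_pos hr.le, if_pos hs.le, Complex.ofReal_mul]

/-- For M = 1/2 the modulus is its own complement, so K' = K. The value of dn is √(1 + x²/2), and
the point lies inside the segment because arctan x is strictly between 0 and π/2. -/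
lemma isPhaseShift_exampleAngles {i : Fin 4} {x : ℝ} (hx : 0 < x)
    (hf : exampleAngles.f i = 1 + 1 / 2 * x ^ 2) :
    exampleAngles.IsPhaseShift (1 / 2) i (Complex.I * ellipticF √(1 / 2) (Real.arctan x)) := by
  have hk : modulusOf (1 / 2) = √(1 / 2) := by
    rw [modulusOf, if_pos (by norm_num)]; norm_num
  have hsq : √(1 / 2 : ℝ) ^ 2 = 1 / 2 := Real.sq_sqrt (by norm_num)
  have hlt : √(1 / 2 : ℝ) ^ 2 < 1 := by rw [hsq]; norm_num
  have hk' : compModulus √(1 / 2) = √(1 / 2) := by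
    rw [compModulus, hsq]; norm_num
  have hmono := strictMono_ellipticF hlt
  have h0 : 0 < ellipticF √(1 / 2) (Real.arctan x) := by
    rw [← ellipticF_zero (k := √(1 / 2))]
    exact hmono (Real.arctan_pos.2 hx)
  have h1 : ellipticF √(1 / 2) (Real.arctan x) < ellipticK √(1 / 2) := by
    rw [ellipticK_eq_ellipticF hlt]
    exact hmono (Real.arctan_lt_pi_div_two x)
  simp only [FlatAngles.IsPhaseShift, hk, hk', exampleAngles_phaseIndex]
  rw [if_pos (by norm_num)]
  constructor
  · have := jacobiDn_I_mul_ellipticF_arctan hlt (by rwa [hk']) x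
    rw [hk', hsq] at this
    rw [this, hf]
  · set u := ellipticF √(1 / 2) (Real.arctan x)
    set K := ellipticK √(1 / 2)
    have hK : 0 < K := h0.trans h1
    refine ⟨1 - u / K, u / K, by rw [sub_pos, div_lt_one hK]; exact h1, by positivity, by ring, ?_⟩
    have : (K : ℂ) ≠ 0 := by exact_mod_cast hK.ne'
    simp only [Complex.real_smul, Complex.ofReal_zero, zero_mul, mul_zero, zero_add,
      Complex.ofReal_div]
    field_simp

lemma isEquimodularElliptic_exampleAngles : exampleAngles.IsEquimodularElliptic := by
  have h := isExampleUpToSigns_exampleAngles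
  refine ⟨h.isElliptic, by simp only [h.M_eq, and_self], ?_, ?_⟩
  · simp only [exampleAngles_r, exampleAngles_s]
    refine ⟨rfl, rfl, rfl, rfl⟩
  rw [h.M_eq]
  have hsq : √(1 / 2 : ℝ) ^ 2 = 1 / 2 := Real.sq_sqrt (by norm_num)
  have hlt : √(1 / 2 : ℝ) ^ 2 < 1 := by rw [hsq]; norm_num
  have hk' : compModulus √(1 / 2) = √(1 / 2) := by
    rw [compModulus, hsq]; norm_num
  -- These solve f = 1 + x²/2, in the order 4, 1, 2, 3.
  let x : Fin 4 → ℝ := ![1, √2, √(3 / 2), √(4 / 3)]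
  refine ⟨fun i => Complex.I * ellipticF √(1 / 2) (Real.arctan (x i)), fun i => ?_,
    -1, by simp, -1, by simp, 1, by simp, 0, 0, ?_⟩
  · apply isPhaseShift_exampleAngles
    · fin_cases i <;> simp [x]
    · rw [exampleAngles_f]
      fin_cases i <;> simp only [x, Fin.mk_zero, Fin.mk_one, Fin.reduceFinMk, Matrix.cons_val] <;>
        first | (rw [Real.sq_sqrt (by norm_num)]; norm_num) | norm_num
  -- Both products √2·1 and √(3/2)·√(4/3) equal √2 = 1/k', so t₁ + t₄ = t₂ + t₃ and the signed sum
  -- is the zero period.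
  · have := ellipticF_arctan_add_eq hlt (x := √2) (y := 1) (u := √(3 / 2)) (v := √(4 / 3))
      (by positivity) (by positivity)
      (by rw [hk', mul_one, ← Real.sqrt_mul (by norm_num)]; norm_num)
      (by rw [hk', ← Real.sqrt_mul (by norm_num), ← Real.sqrt_mul (by norm_num)]; norm_num)
    have hC := congrArg (fun r : ℝ => (r : ℂ)) this
    simp only [Complex.ofReal_add] at hC
    simp only [x, Matrix.cons_val, Int.cast_zero, mul_zero, add_zero]
    linear_combination Complex.I * hC

end Equimodular

open scoped InnerProductSpace

/-! ### Vectors in Euclidean 3-space -/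

section Cross

lemma inner_E3 (x y : E3) : ⟪x, y⟫_ℝ = x 0 * y 0 + x 1 * y 1 + x 2 * y 2 := by
  simp [PiLp.inner_apply, Fin.sum_univ_three, mul_comm]

lemma cross_apply_zero (x y : E3) : cross x y 0 = x 1 * y 2 - x 2 * y 1 := by
  simp [cross, crossProduct]

lemma cross_apply_one (x y : E3) : cross x y 1 = x 2 * y 0 - x 0 * y 2 := by
  simp [cross, crossProduct]

lemma cross_apply_two (x y : E3) : cross x y 2 = x 0 * y 1 - x 1 * y 0 := by
  simp [cross, crossProduct]

lemma E3_ext {x y : E3} (h0 : x 0 = y 0) (h1 : x 1 = y 1) (h2 : x 2 = y 2) : x = y := by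
  ext i; fin_cases i <;> assumption

lemma cross_cross_eq (x y z : E3) : cross x (cross y z) = ⟪x, z⟫_ℝ • y - ⟪x, y⟫_ℝ • z := by
  apply E3_ext <;>
  simp only [cross_apply_zero, cross_apply_one, cross_apply_two, inner_E3, PiLp.sub_apply,
    PiLp.smul_apply, smul_eq_mul] <;> ring

lemma cross_swap (x y : E3) : cross y x = -cross x y := by
  apply E3_ext <;>
  simp only [cross_apply_zero, cross_apply_one, cross_apply_two, PiLp.neg_apply] <;> ring

lemma cross_self_eq_zero (x : E3) : cross x x = 0 := by
  apply E3_ext <;>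
  simp only [cross_apply_zero, cross_apply_one, cross_apply_two, PiLp.zero_apply] <;> ring

lemma cross_add_right (x y z : E3) : cross x (y + z) = cross x y + cross x z := by
  apply E3_ext <;>
  simp only [cross_apply_zero, cross_apply_one, cross_apply_two, PiLp.add_apply] <;> ring

lemma cross_smul_right (x y : E3) (c : ℝ) : cross x (c • y) = c • cross x y := by
  apply E3_ext <;>
  simp only [cross_apply_zero, cross_apply_one, cross_apply_two, PiLp.smul_apply, smul_eq_mul] <;>
  ring

lemma cross_add_left (x y z : E3) : cross (x + y) z = cross x z + cross y z := by
  rw [cross_swap, cross_add_right, neg_add, ← cross_swap, ← cross_swap]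

lemma cross_smul_left (x y : E3) (c : ℝ) : cross (c • x) y = c • cross x y := by
  rw [cross_swap, cross_smul_right, ← smul_neg, ← cross_swap]

lemma cross_neg_left (x y : E3) : cross (-x) y = -cross x y := by
  rw [← neg_one_smul ℝ x, cross_smul_left, neg_one_smul]

lemma cross_neg_right (x y : E3) : cross x (-y) = -cross x y := by
  rw [← neg_one_smul ℝ y, cross_smul_right, neg_one_smul]

lemma inner_cross_self_left (x y : E3) : ⟪x, cross x y⟫_ℝ = 0 := by
  rw [inner_E3, cross_apply_zero, cross_apply_one, cross_apply_two]; ring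

lemma inner_cross_self_right (x y : E3) : ⟪y, cross x y⟫_ℝ = 0 := by
  rw [inner_E3, cross_apply_zero, cross_apply_one, cross_apply_two]; ring

lemma inner_cross_cross (x y : E3) :
    ⟪cross x y, cross x y⟫_ℝ = ⟪x, x⟫_ℝ * ⟪y, y⟫_ℝ - ⟪x, y⟫_ℝ ^ 2 := by
  simp only [inner_E3, cross_apply_zero, cross_apply_one, cross_apply_two]; ring

end Cross

/-- `u, v, n` is a positively oriented orthonormal basis. -/
structure IsFrame (u v n : E3) : Prop where
  uu : ⟪u, u⟫_ℝ = 1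
  vv : ⟪v, v⟫_ℝ = 1
  nn : ⟪n, n⟫_ℝ = 1
  uv : ⟪u, v⟫_ℝ = 0
  un : ⟪u, n⟫_ℝ = 0
  vn : ⟪v, n⟫_ℝ = 0
  cross_uv : cross u v = n
  cross_vn : cross v n = u
  cross_nu : cross n u = v

lemma isFrame_cross {u v : E3} (uu : ⟪u, u⟫_ℝ = 1) (vv : ⟪v, v⟫_ℝ = 1) (uv : ⟪u, v⟫_ℝ = 0) :
    IsFrame u v (cross u v) where
  uu := uu
  vv := vv
  nn := by rw [inner_cross_cross, uu, vv, uv]; norm_num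
  uv := uv
  un := inner_cross_self_left u v
  vn := inner_cross_self_right u v
  cross_uv := rfl
  cross_vn := by rw [cross_cross_eq, vv, real_inner_comm, uv]; simp
  cross_nu := by rw [cross_swap, cross_cross_eq, uu, uv]; simp

namespace IsFrame

variable {u v n : E3} (h : IsFrame u v n)

include h

/-- A quarter turn about n; its iterates give the frames at the four edges of the rectangle. -/
lemma rotate : IsFrame (-v) u n where
  uu := by simpa using h.vv
  vv := h.uu
  nn := h.nn
  uv := by rw [inner_neg_left, real_inner_comm, h.uv, neg_zero]
  un := by rw [inner_neg_left, h.vn, neg_zero]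
  vn := h.un
  cross_uv := by rw [cross_neg_left, ← cross_swap, h.cross_uv]
  cross_vn := by rw [cross_swap, h.cross_nu]
  cross_nu := by rw [cross_neg_right, ← cross_swap, h.cross_vn]

lemma inner_eq (x y z x' y' z' : ℝ) :
    ⟪x • u + y • v + z • n, x' • u + y' • v + z' • n⟫_ℝ = x * x' + y * y' + z * z' := by
  have vu := h.uv
  have nu := h.un
  have nv := h.vn
  rw [real_inner_comm] at vu nu nv
  simp only [inner_add_left, inner_add_right, real_inner_smul_left, real_inner_smul_right, h.uu,
    h.vv, h.nn, h.uv, h.un, h.vn, vu, nu, nv]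
  ring

lemma cross_eq (x y z x' y' z' : ℝ) :
    cross (x • u + y • v + z • n) (x' • u + y' • v + z' • n) =
      (y * z' - z * y') • u + (z * x' - x * z') • v + (x * y' - y * x') • n := by
  simp only [cross_add_left, cross_add_right, cross_smul_left, cross_smul_right,
    cross_self_eq_zero, h.cross_uv, h.cross_vn, h.cross_nu, cross_swap u v, cross_swap v n,
    cross_swap n u]
  module

/-- Compare two evaluations of n × (n × w): directly by the triple product formula, and after
expanding n × w through n = u × v. -/
lemma eq_add (w : E3) : w = ⟪u, w⟫_ℝ • u + ⟪v, w⟫_ℝ • v + ⟪n, w⟫_ℝ • n := by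
  have h1 := cross_cross_eq n n w
  have h2 : cross n w = ⟪u, w⟫_ℝ • v - ⟪v, w⟫_ℝ • u := by
    rw [cross_swap, ← h.cross_uv, cross_cross_eq, real_inner_comm w, real_inner_comm w]
    module
  rw [h2, h.nn, sub_eq_add_neg, ← neg_smul, cross_add_right, cross_smul_right, cross_smul_right,
    h.cross_nu, cross_swap, h.cross_vn] at h1
  rw [one_smul, eq_sub_iff_add_eq, ← eq_sub_iff_add_eq'] at h1
  exact h1.trans (by module)

end IsFrame

/-! ### Angles and polar coordinates -/

section Polar

variable {V : Type*} [NormedAddCommGroup V] [InnerProductSpace ℝ V] {e f : V}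

lemma norm_add_smul_sq (ee : ⟪e, e⟫_ℝ = 1) (ff : ⟪f, f⟫_ℝ = 1) (ef : ⟪e, f⟫_ℝ = 0) (x y : ℝ) :
    ‖x • e + y • f‖ ^ 2 = x ^ 2 + y ^ 2 := by
  have fe := ef
  rw [real_inner_comm] at fe
  rw [← real_inner_self_eq_norm_sq]
  simp only [inner_add_left, inner_add_right, real_inner_smul_left, real_inner_smul_right, ee, ff,
    ef, fe]
  ring

/-- Polar coordinates of a vector in terms of the angle with the axis. -/
lemma exists_polar (ee : ⟪e, e⟫_ℝ = 1) (ff : ⟪f, f⟫_ℝ = 1) (ef : ⟪e, f⟫_ℝ = 0) {x y : ℝ}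
    (hy : 0 < y) : ∃ ρ : ℝ, 0 < ρ ∧ x = ρ * Real.cos (InnerProductGeometry.angle e (x • e + y • f))
      ∧ y = ρ * Real.sin (InnerProductGeometry.angle e (x • e + y • f)) := by
  have hn := norm_add_smul_sq ee ff ef x y
  have he : ‖e‖ = 1 := by rw [norm_eq_sqrt_real_inner, ee, Real.sqrt_one]
  have hi : ⟪e, x • e + y • f⟫_ℝ = x := by
    rw [inner_add_right, real_inner_smul_right, real_inner_smul_right, ee, ef]; ring
  have hc := InnerProductGeometry.cos_angle_mul_norm_mul_norm e (x • e + y • f)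
  rw [hi, he, one_mul] at hc
  set φ := InnerProductGeometry.angle e (x • e + y • f)
  have hρ : 0 < ‖x • e + y • f‖ := by
    by_contra! h
    nlinarith [norm_nonneg (x • e + y • f), sq_nonneg x]
  set ρ := ‖x • e + y • f‖
  refine ⟨ρ, hρ, by linarith, ?_⟩
  have hs : 0 ≤ Real.sin φ := InnerProductGeometry.sin_angle_nonneg _ _
  have : y ^ 2 = (ρ * Real.sin φ) ^ 2 := by
    rw [mul_pow, Real.sin_sq]
    linear_combination (x + ρ * Real.cos φ) * hc - hn
  exact (pow_left_inj₀ hy.le (by positivity) two_ne_zero).1 this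

lemma angle_polar (ee : ⟪e, e⟫_ℝ = 1) (ff : ⟪f, f⟫_ℝ = 1) (ef : ⟪e, f⟫_ℝ = 0) {ρ φ : ℝ}
    (hρ : 0 < ρ) (hφ : φ ∈ Set.Icc 0 Real.pi) :
    InnerProductGeometry.angle e ((ρ * Real.cos φ) • e + (ρ * Real.sin φ) • f) = φ := by
  have he : ‖e‖ = 1 := by rw [norm_eq_sqrt_real_inner, ee, Real.sqrt_one]
  have hn : ‖(ρ * Real.cos φ) • e + (ρ * Real.sin φ) • f‖ = ρ := by
    rw [← pow_left_inj₀ (norm_nonneg _) hρ.le two_ne_zero, norm_add_smul_sq ee ff ef]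
    linear_combination ρ ^ 2 * Real.sin_sq_add_cos_sq φ
  rw [InnerProductGeometry.angle, hn, he, inner_add_right, real_inner_smul_right,
    real_inner_smul_right, ee, ef, show (ρ * Real.cos φ * 1 + ρ * Real.sin φ * 0) / (1 * ρ)
      = Real.cos φ by field_simp; ring, Real.arccos_cos hφ.1 hφ.2]

end Polar

/-! ### Folding a side face -/

/-- The vector with planar coordinates `x, y` in the half-plane bounded by `ℝ u` which is obtained
from the half-plane of `m` by the rotation with cosine `c` and sine `s` towards `n`. -/
def fold (u m n : E3) (c s x y : ℝ) : E3 := x • u + (y * c) • m + (y * s) • n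

/-- A quadrilateral `P Q R S` in the plane with `P = (ℓ, 0)`, `Q = (0, 0)`, `R = (xR, yR)` and
`S = (xS, yS)`. -/
structure FlatSide where
  ℓ : ℝ
  xS : ℝ
  yS : ℝ
  xR : ℝ
  yR : ℝ

/-- The quadrilateral is convex and has angles `φ` at `P` and `φ'` at `Q`. -/
structure FlatSide.HasAngles (F : FlatSide) (φ φ' : ℝ) : Prop where
  ℓ_pos : 0 < F.ℓ
  yS_pos : 0 < F.yS
  yR_pos : 0 < F.yR
  diag : ∃ a b : ℝ, (0 < a ∧ a < 1) ∧ (0 < b ∧ b < 1) ∧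
    (1 - a) * F.ℓ + a * F.xR = b * F.xS ∧ a * F.yR = b * F.yS
  polarS : ∃ ρ : ℝ, 0 < ρ ∧ F.ℓ - F.xS = ρ * Real.cos φ ∧ F.yS = ρ * Real.sin φ
  polarR : ∃ ρ : ℝ, 0 < ρ ∧ F.xR = ρ * Real.cos φ' ∧ F.yR = ρ * Real.sin φ'

section Fold

variable {u m n : E3} {c s : ℝ}

lemma fold_sub (x y x' y' : ℝ) :
    fold u m n c s x y - fold u m n c s x' y' = fold u m n c s (x - x') (y - y') := by
  unfold fold; module

lemma smul_fold (r x y : ℝ) : r • fold u m n c s x y = fold u m n c s (r * x) (r * y) := by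
  unfold fold; module

lemma fold_zero_right (x : ℝ) : fold u m n c s x 0 = x • u := by
  unfold fold; module

lemma fold_eq (x y : ℝ) : fold u m n c s x y = x • u + y • fold u m n c s 0 1 := by
  unfold fold; module

namespace IsFrame

variable (h : IsFrame u m n)

include h

lemma inner_fold_zero_one (hcs : c ^ 2 + s ^ 2 = 1) :
    ⟪fold u m n c s 0 1, fold u m n c s 0 1⟫_ℝ = 1 := by
  rw [fold, h.inner_eq]; linear_combination hcs

lemma inner_left_fold_zero_one : ⟪u, fold u m n c s 0 1⟫_ℝ = 0 := by
  have := h.inner_eq 1 0 0 0 (1 * c) (1 * s)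
  simpa [fold] using this

lemma norm_fold_sq (hcs : c ^ 2 + s ^ 2 = 1) (x y : ℝ) :
    ‖fold u m n c s x y‖ ^ 2 = x ^ 2 + y ^ 2 := by
  rw [fold_eq, norm_add_smul_sq h.uu (h.inner_fold_zero_one hcs) h.inner_left_fold_zero_one]

lemma norm_fold (hcs : c ^ 2 + s ^ 2 = 1) (x y : ℝ) :
    ‖fold u m n c s x y‖ = √(x ^ 2 + y ^ 2) := by
  rw [← h.norm_fold_sq hcs, Real.sqrt_sq (norm_nonneg _)]

end IsFrame

end Fold

lemma not_collinear_of_angle {P Q R : E3} (hP : P ≠ Q) (hR : R ≠ Q)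
    (h0 : EuclideanGeometry.angle P Q R ≠ 0) (hπ : EuclideanGeometry.angle P Q R ≠ Real.pi) :
    ¬ Collinear ℝ {P, Q, R} := by
  rw [EuclideanGeometry.collinear_iff_eq_or_eq_or_angle_eq_zero_or_angle_eq_pi]
  tauto

section SideFace

variable {u m n Q : E3} {c s : ℝ} {F : FlatSide} {φ φ' : ℝ}

lemma angle_fold_left (h : IsFrame u m n) (hcs : c ^ 2 + s ^ 2 = 1) (hF : F.HasAngles φ φ')
    (hφ : φ ∈ Set.Icc 0 Real.pi) : EuclideanGeometry.angle Q (Q + F.ℓ • u)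
      (Q + fold u m n c s F.xS F.yS) = φ := by
  obtain ⟨ρ, hρ, h1, h2⟩ := hF.polarS
  rw [EuclideanGeometry.angle]
  have e1 : Q -ᵥ (Q + F.ℓ • u) = F.ℓ • (-u) := by simp
  have e2 : Q + fold u m n c s F.xS F.yS -ᵥ (Q + F.ℓ • u) =
      (ρ * Real.cos φ) • (-u) + (ρ * Real.sin φ) • fold u m n c s 0 1 := by
    rw [← h1, ← h2, vsub_eq_sub, add_sub_add_left_eq_sub, fold_eq]; module
  rw [e1, e2, InnerProductGeometry.angle_smul_left_of_pos _ _ hF.ℓ_pos]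
  exact angle_polar (by rw [inner_neg_neg, h.uu]) (h.inner_fold_zero_one hcs)
    (by rw [inner_neg_left, h.inner_left_fold_zero_one, neg_zero]) hρ hφ

lemma angle_fold_right (h : IsFrame u m n) (hcs : c ^ 2 + s ^ 2 = 1) (hF : F.HasAngles φ φ')
    (hφ : φ' ∈ Set.Icc 0 Real.pi) : EuclideanGeometry.angle (Q + F.ℓ • u) Q
      (Q + fold u m n c s F.xR F.yR) = φ' := by
  obtain ⟨ρ, hρ, h1, h2⟩ := hF.polarR
  rw [EuclideanGeometry.angle]
  have e1 : Q + F.ℓ • u -ᵥ Q = F.ℓ • u := by simp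
  have e2 : Q + fold u m n c s F.xR F.yR -ᵥ Q =
      (ρ * Real.cos φ') • u + (ρ * Real.sin φ') • fold u m n c s 0 1 := by
    rw [← h1, ← h2, vsub_eq_sub, add_sub_cancel_left, fold_eq]
  rw [e1, e2, InnerProductGeometry.angle_smul_left_of_pos _ _ hF.ℓ_pos]
  exact angle_polar h.uu (h.inner_fold_zero_one hcs) h.inner_left_fold_zero_one hρ hφ

lemma isConvexQuad_fold (h : IsFrame u m n) (hcs : c ^ 2 + s ^ 2 = 1) (hF : F.HasAngles φ φ') :
    IsConvexQuad (Q + F.ℓ • u) Q (Q + fold u m n c s F.xR F.yR)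
      (Q + fold u m n c s F.xS F.yS) := by
  constructor
  · obtain ⟨a, b, ha, hb, h1, h2⟩ := hF.diag
    refine ⟨Q + b • fold u m n c s F.xS F.yS, ⟨1 - a, a, by linarith, by linarith, by ring, ?_⟩,
      ⟨1 - b, b, by linarith, by linarith, by ring, by module⟩⟩
    rw [smul_fold, ← h1, ← h2, fold_eq F.xR, fold_eq (_ + _)]
    module
  · intro hcol
    have hℓ := hF.ℓ_pos
    have hy := hF.yR_pos
    have hsub : ({Q + F.ℓ • u, Q, Q + fold u m n c s F.xR F.yR} : Set E3) ⊆
      {Q + F.ℓ • u, Q, Q + fold u m n c s F.xR F.yR, Q + fold u m n c s F.xS F.yS} := by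
      intro x hx
      simp only [Set.mem_insert_iff, Set.mem_singleton_iff] at hx ⊢
      tauto
    have hangle : 0 < InnerProductGeometry.angle u
        (F.xR • u + F.yR • fold u m n c s 0 1) ∧ InnerProductGeometry.angle u
        (F.xR • u + F.yR • fold u m n c s 0 1) < Real.pi := by
      obtain ⟨ρ, hρ, -, h2⟩ := exists_polar h.uu (h.inner_fold_zero_one hcs)
        h.inner_left_fold_zero_one (x := F.xR) hy
      have hsin : 0 < Real.sin (InnerProductGeometry.angle u
        (F.xR • u + F.yR • fold u m n c s 0 1)) := by
        by_contra! hneg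
        exact hy.not_ge (h2.le.trans (mul_nonpos_of_nonneg_of_nonpos hρ.le hneg))
      refine ⟨(InnerProductGeometry.angle_nonneg _ _).lt_of_ne fun H => ?_,
        (InnerProductGeometry.angle_le_pi _ _).lt_of_ne fun H => ?_⟩
      · rw [← H, Real.sin_zero] at hsin; exact hsin.false
      · rw [H, Real.sin_pi] at hsin; exact hsin.false
    have hval : EuclideanGeometry.angle (Q + F.ℓ • u) Q (Q + fold u m n c s F.xR F.yR) =
        InnerProductGeometry.angle u (F.xR • u + F.yR • fold u m n c s 0 1) := by
      rw [EuclideanGeometry.angle, vsub_eq_sub, vsub_eq_sub, add_sub_cancel_left,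
        add_sub_cancel_left, InnerProductGeometry.angle_smul_left_of_pos _ _ hℓ, fold_eq F.xR]
    refine not_collinear_of_angle ?_ ?_ ?_ ?_ (hcol.subset hsub)
    · rw [Ne, add_eq_left, smul_eq_zero, not_or]
      refine ⟨hℓ.ne', fun hu => ?_⟩
      have := h.uu
      rw [hu, inner_zero_left] at this
      norm_num at this
    · rw [Ne, add_eq_left]
      intro H
      have := h.norm_fold_sq hcs F.xR F.yR
      rw [H, norm_zero] at this
      nlinarith [sq_nonneg F.xR]
    · rw [hval]; exact hangle.1.ne'
    · rw [hval]; exact hangle.2.ne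

/-- The dihedral angle is the angle of the rotation by which the side face is folded. -/
lemma cross_fold (h : IsFrame u m n) (ℓ x y : ℝ) :
    cross (ℓ • u) (fold u m n c s x y) = (ℓ * y) • (c • n + s • (-m)) := by
  have := h.cross_eq ℓ 0 0 x (y * c) (y * s)
  rw [zero_smul, zero_smul, add_zero, add_zero] at this
  rw [fold, this]
  module

/-- The sign test in `Net.dihedral` thus detects the sine of the folding angle. -/
lemma inner_cross_normal (h : IsFrame u m n) (c s : ℝ) :
    ⟪cross n (c • n + s • (-m)), u⟫_ℝ = s := by
  rw [cross_add_right, cross_smul_right, cross_smul_right, cross_self_eq_zero, cross_neg_right,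
    ← cross_swap, h.cross_vn, smul_zero, zero_add, real_inner_smul_left, h.uu, mul_one]

/-- A convex quadrilateral `P Q R S`, whose half-plane at the edge `P Q` includes with the
half-plane of `m` an angle `θ` strictly between `0` and `π`, is obtained by folding a flat one. -/
lemma exists_flatSide (h : IsFrame u m n) {ℓ θ : ℝ} (hℓ : 0 < ℓ) {R S : E3}
    (hconv : IsConvexQuad (Q + ℓ • u) Q R S)
    (hpos : 0 < ⟪cross n (cross (ℓ • u) (S - (Q + ℓ • u))), ℓ • u⟫_ℝ)
    (hθ : InnerProductGeometry.angle n (cross (ℓ • u) (S - (Q + ℓ • u))) = θ) :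
    ∃ F : FlatSide, F.ℓ = ℓ ∧
      F.HasAngles (EuclideanGeometry.angle Q (Q + ℓ • u) S)
        (EuclideanGeometry.angle (Q + ℓ • u) Q R) ∧
      S = Q + fold u m n (Real.cos θ) (Real.sin θ) F.xS F.yS ∧
      R = Q + fold u m n (Real.cos θ) (Real.sin θ) F.xR F.yR := by
  have hcs : Real.cos θ ^ 2 + Real.sin θ ^ 2 = 1 := Real.cos_sq_add_sin_sq θ
  have hS := h.eq_add (S - Q)
  set x := ⟪u, S - Q⟫_ℝ
  set a := ⟪m, S - Q⟫_ℝ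
  set b := ⟪n, S - Q⟫_ℝ
  have hcross : cross (ℓ • u) (S - (Q + ℓ • u)) = ℓ • (a • n + b • (-m)) := by
    -- The pair (a, b) is not normalized here; `cross_fold` does not need c² + s² = 1.
    have e : S - (Q + ℓ • u) = fold u m n a b (x - ℓ) 1 := by
      rw [← sub_sub, hS, fold]; module
    rw [e, cross_fold h, mul_one]
  rw [hcross, cross_smul_right, real_inner_smul_left, real_inner_smul_right,
    inner_cross_normal h] at hpos
  have hb : 0 < b := by
    rw [← mul_assoc] at hpos
    exact pos_of_mul_pos_right hpos (by positivity)
  rw [hcross, InnerProductGeometry.angle_smul_right_of_pos _ _ hℓ] at hθ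
  -- The normal of the side face is a positive multiple of an - bm and makes the angle θ with n. So
  -- (a, b) = y(cos θ, sin θ), where y is the height of S over the edge.
  obtain ⟨y, hy, hya, hyb⟩ := exists_polar (e := n) (f := -m) h.nn (by rw [inner_neg_neg, h.vv])
    (by rw [inner_neg_right, real_inner_comm, h.vn, neg_zero]) (x := a) hb
  rw [hθ] at hya hyb
  have hSQ : S = Q + fold u m n (Real.cos θ) (Real.sin θ) x y := by
    rw [fold, ← hya, ← hyb, ← hS]; module
  obtain ⟨z, ⟨α, β, hα, hβ, hαβ, hz⟩, ⟨α', β', hα', hβ', hαβ', hz'⟩⟩ := hconv.1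
  -- Convexity determines R: from αP + βR = α'Q + β'S at the crossing of the diagonals, R lies in
  -- the same half-plane as S, and its height β'y/β is positive.
  have hR : R = Q + fold u m n (Real.cos θ) (Real.sin θ) ((β' * x - α * ℓ) / β)
      (β' * y / β) := by
    have h1 : β • R = β • (Q + fold u m n (Real.cos θ) (Real.sin θ) ((β' * x - α * ℓ) / β)
      (β' * y / β)) := by
      rw [smul_add, smul_fold, mul_div_cancel₀ _ hβ.ne', mul_div_cancel₀ _ hβ.ne', fold_eq]
      have : β • R = z - α • (Q + ℓ • u) := by rw [← hz]; module
      rw [this, ← hz', hSQ, fold_eq x]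
      obtain rfl : α = 1 - β := by linarith
      obtain rfl : α' = 1 - β' := by linarith
      module
    exact smul_right_injective E3 hβ.ne' h1
  have hyR : 0 < β' * y / β := by positivity
  refine ⟨⟨ℓ, x, y, (β' * x - α * ℓ) / β, β' * y / β⟩, rfl,
    ⟨hℓ, hy, hyR, ⟨β, β', ⟨hβ, by linarith⟩, ⟨hβ', by linarith⟩, ?_, ?_⟩, ?_, ?_⟩, hSQ, hR⟩
  · obtain rfl : α = 1 - β := by linarith
    simp only
    field_simp
    ring
  · simp only
    field_simp
  · have e1 : Q -ᵥ (Q + ℓ • u) = ℓ • (-u) := by simp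
    have e2 : S -ᵥ (Q + ℓ • u) =
        (ℓ - x) • (-u) + y • fold u m n (Real.cos θ) (Real.sin θ) 0 1 := by
      rw [hSQ, vsub_eq_sub, add_sub_add_left_eq_sub, fold_eq]; module
    rw [EuclideanGeometry.angle, e1, e2, InnerProductGeometry.angle_smul_left_of_pos _ _ hℓ]
    exact exists_polar (by rw [inner_neg_neg, h.uu]) (h.inner_fold_zero_one hcs)
      (by rw [inner_neg_left, h.inner_left_fold_zero_one, neg_zero]) hy
  · have e1 : Q + ℓ • u -ᵥ Q = ℓ • u := by simp
    have e2 : R -ᵥ Q = ((β' * x - α * ℓ) / β) • u +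
        (β' * y / β) • fold u m n (Real.cos θ) (Real.sin θ) 0 1 := by
      rw [hR, vsub_eq_sub, add_sub_cancel_left, fold_eq]
    rw [EuclideanGeometry.angle, e1, e2, InnerProductGeometry.angle_smul_left_of_pos _ _ hℓ]
    exact exists_polar h.uu (h.inner_fold_zero_one hcs) h.inner_left_fold_zero_one hyR

end SideFace

/-! ### Half-angle cotangents -/

noncomputable def cosOfCot (w : ℝ) : ℝ := (w ^ 2 - 1) / (w ^ 2 + 1)

noncomputable def sinOfCot (w : ℝ) : ℝ := 2 * w / (w ^ 2 + 1)

lemma cosOfCot_sq_add_sinOfCot_sq (w : ℝ) : cosOfCot w ^ 2 + sinOfCot w ^ 2 = 1 := by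
  unfold cosOfCot sinOfCot; field_simp; ring

lemma sinOfCot_pos {w : ℝ} (hw : 0 < w) : 0 < sinOfCot w := by
  unfold sinOfCot; positivity

lemma cosOfCot_injOn : Set.InjOn cosOfCot (Set.Ioi 0) := by
  intro x hx y hy hxy
  have hx : 0 < x := hx
  have hy : 0 < y := hy
  unfold cosOfCot at hxy
  rw [div_eq_div_iff (by positivity) (by positivity)] at hxy
  exact (pow_left_inj₀ hx.le hy.le two_ne_zero).1 (by linarith)

lemma cos_sin_eq_ofCot {θ : ℝ} (hθ : θ ∈ Set.Ioo 0 Real.pi) :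
    0 < Real.cot (θ / 2) ∧ Real.cos θ = cosOfCot (Real.cot (θ / 2)) ∧
      Real.sin θ = sinOfCot (Real.cot (θ / 2)) := by
  have hs : 0 < Real.sin (θ / 2) :=
    Real.sin_pos_of_pos_of_lt_pi (by linarith [hθ.1]) (by linarith [hθ.1, hθ.2])
  have hc : 0 < Real.cos (θ / 2) :=
    Real.cos_pos_of_mem_Ioo ⟨by linarith [hθ.1, Real.pi_pos], by linarith [hθ.2]⟩
  have h1 := Real.sin_sq_add_cos_sq (θ / 2)
  have h2 : Real.cos θ = Real.cos (θ / 2) ^ 2 - Real.sin (θ / 2) ^ 2 := by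
    rw [← Real.cos_two_mul', mul_div_cancel₀ _ two_ne_zero]
  have h3 : Real.sin θ = 2 * Real.sin (θ / 2) * Real.cos (θ / 2) := by
    rw [← Real.sin_two_mul, mul_div_cancel₀ _ two_ne_zero]
  have h4 : (Real.cos (θ / 2) / Real.sin (θ / 2)) ^ 2 + 1 = 1 / Real.sin (θ / 2) ^ 2 := by
    field_simp; linarith
  rw [Real.cot_eq_cos_div_sin, cosOfCot, sinOfCot, h4, h2, h3]
  refine ⟨by positivity, ?_, ?_⟩ <;> field_simp

lemma exists_angle_of_cot {w : ℝ} (hw : 0 < w) : ∃ θ ∈ Set.Ioo 0 Real.pi,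
    Real.cot (θ / 2) = w ∧ Real.cos θ = cosOfCot w ∧ Real.sin θ = sinOfCot w := by
  have hcot : Real.cot (2 * Real.arctan w⁻¹ / 2) = w := by
    rw [mul_div_cancel_left₀ _ two_ne_zero, ← Real.tan_inv_eq_cot, Real.tan_arctan, inv_inv]
  have hθ : 2 * Real.arctan w⁻¹ ∈ Set.Ioo 0 Real.pi :=
    ⟨by have := Real.arctan_pos.2 (inv_pos.2 hw); linarith,
      by have := Real.arctan_lt_pi_div_two w⁻¹; linarith⟩
  have h := cos_sin_eq_ofCot hθ
  rw [hcot] at h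
  exact ⟨_, hθ, hcot, h.2⟩

/-! ### Nets with a rectangular central face -/

/-- A rectangle with corner `O` and sides along `u`, `v`, together with flat side faces. -/
structure RectNet where
  O : E3
  u : E3
  v : E3
  n : E3
  F : Fin 4 → FlatSide

/-- The angle at `A i` of the side face at the edge `A i, A (i + 1)`. -/
def FlatAngles.sideAngle (a : FlatAngles) : Fin 4 → ℝ := ![a.γ 0, a.α 1, a.γ 2, a.α 3]

/-- The angle at `A (i + 1)` of the side face at the edge `A i, A (i + 1)`. -/
def FlatAngles.sideAngle' (a : FlatAngles) : Fin 4 → ℝ := ![a.γ 1, a.α 2, a.γ 3, a.α 0]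

namespace FlatAngles

lemma forall_sideAngle {a : FlatAngles} {P : ℝ → ℝ → Prop} (h0 : P (a.γ 0) (a.γ 1))
    (h1 : P (a.α 1) (a.α 2)) (h2 : P (a.γ 2) (a.γ 3)) (h3 : P (a.α 3) (a.α 0)) (i : Fin 4) :
    P (a.sideAngle i) (a.sideAngle' i) := by
  fin_cases i
  exacts [h0, h1, h2, h3]

/-- All angles are in `[0, π]`, the angles `β` are not degenerate and the angles `δ` are right. -/
structure IsRectangular (a : FlatAngles) : Prop where
  α_mem : ∀ i, a.α i ∈ Set.Icc 0 Real.pi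
  β_mem : ∀ i, a.β i ∈ Set.Ioo 0 Real.pi
  γ_mem : ∀ i, a.γ i ∈ Set.Icc 0 Real.pi
  δ_eq : ∀ i, a.δ i = Real.pi / 2

variable {a : FlatAngles} (h : a.IsRectangular)

include h

lemma IsRectangular.sideAngle_mem (i : Fin 4) : a.sideAngle i ∈ Set.Icc 0 Real.pi := by
  fin_cases i
  exacts [h.γ_mem 0, h.α_mem 1, h.γ_mem 2, h.α_mem 3]

lemma IsRectangular.sideAngle'_mem (i : Fin 4) : a.sideAngle' i ∈ Set.Icc 0 Real.pi := by
  fin_cases i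
  exacts [h.γ_mem 1, h.α_mem 2, h.γ_mem 3, h.α_mem 0]

end FlatAngles

/-- The spherical cosine theorem at a vertex with `δ = π / 2`, in the cotangents `w` of the dihedral
half-angles. -/
def FlatAngles.CosineTheorem (a : FlatAngles) (w : Fin 4 → ℝ) : Prop :=
  ∀ i, Real.cos (a.β i) =
    Real.cos (a.α i) * Real.sin (a.γ i) * cosOfCot (w (γStrip i)) +
    Real.sin (a.α i) * Real.cos (a.γ i) * cosOfCot (w (αStrip i)) +
    Real.sin (a.α i) * Real.sin (a.γ i) * sinOfCot (w (αStrip i)) * sinOfCot (w (γStrip i))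

/-- Around the central face the α-strip is alternately the later and the earlier of the two strips
at a vertex; the formula is symmetric in them, so it can be indexed by consecutive strips. -/
lemma FlatAngles.CosineTheorem.cos_β {a : FlatAngles} {w : Fin 4 → ℝ} (h : a.CosineTheorem w)
    (j : Fin 4) : Real.cos (a.β (j + 1)) =
      Real.cos (a.sideAngle (j + 1)) * Real.sin (a.sideAngle' j) * cosOfCot (w j) +
      Real.sin (a.sideAngle (j + 1)) * Real.cos (a.sideAngle' j) * cosOfCot (w (j + 1)) +
      Real.sin (a.sideAngle (j + 1)) * Real.sin (a.sideAngle' j) *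
        sinOfCot (w (j + 1)) * sinOfCot (w j) := by
  have h0 := h 0
  have h2 := h 2
  simp only [αStrip, γStrip, Matrix.cons_val, show (4 : Fin 4) = 0 from rfl] at h0 h2
  fin_cases j
  · exact h 1
  · refine h2.trans ?_
    change _ = Real.cos (a.γ 2) * Real.sin (a.α 2) * cosOfCot (w 1) +
        Real.sin (a.γ 2) * Real.cos (a.α 2) * cosOfCot (w 2) +
        Real.sin (a.γ 2) * Real.sin (a.α 2) * sinOfCot (w 2) * sinOfCot (w 1)
    ring
  · exact h 3
  · refine h0.trans ?_
    change _ = Real.cos (a.γ 0) * Real.sin (a.α 0) * cosOfCot (w 3) +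
        Real.sin (a.γ 0) * Real.cos (a.α 0) * cosOfCot (w 0) +
        Real.sin (a.γ 0) * Real.sin (a.α 0) * sinOfCot (w 0) * sinOfCot (w 3)
    ring

/-- The net in which `A i, A (i + 1), R i, S i` are the side faces. -/
def stripNet (A S R : Fin 4 → E3) : Net where
  A := A
  B := ![R 3, S 1, R 1, S 3]
  C := ![S 0, R 0, S 2, R 2]

section StripNet

variable {A S R : Fin 4 → E3}

lemma stripNet_outer_self (i : Fin 4) : (stripNet A S R).outer i i = S i := by
  fin_cases i <;> rfl

lemma stripNet_outer_add_one (i : Fin 4) : (stripNet A S R).outer i (i + 1) = R i := by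
  fin_cases i <;> rfl

lemma stripNet_sideFace (i : Fin 4) :
    (stripNet A S R).sideFace i = ![A i, A (i + 1), R i, S i] := by
  rw [Net.sideFace, stripNet_outer_self, stripNet_outer_add_one]
  rfl

lemma eq_stripNet (N : Net) :
    N = stripNet N.A (fun i => N.outer i i) (fun i => N.outer i (i + 1)) := by
  obtain ⟨A, B, C⟩ := N
  have hB : B = (stripNet A (fun i => Net.outer ⟨A, B, C⟩ i i)
      (fun i => Net.outer ⟨A, B, C⟩ i (i + 1))).B := by
    funext i; fin_cases i <;> rfl
  have hC : C = (stripNet A (fun i => Net.outer ⟨A, B, C⟩ i i)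
      (fun i => Net.outer ⟨A, B, C⟩ i (i + 1))).C := by
    funext i; fin_cases i <;> rfl
  exact congrArg₂ (Net.mk A) hB hC

lemma Net.angle_outer_self (N : Net) (i : Fin 4) :
    EuclideanGeometry.angle (N.A (i + 1)) (N.A i) (N.outer i i) = N.flatAngles.sideAngle i := by
  fin_cases i
  exacts [EuclideanGeometry.angle_comm _ _ _, rfl, EuclideanGeometry.angle_comm _ _ _, rfl]

lemma Net.angle_outer_add_one (N : Net) (i : Fin 4) :
    EuclideanGeometry.angle (N.A i) (N.A (i + 1)) (N.outer i (i + 1)) =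
      N.flatAngles.sideAngle' i := by
  fin_cases i
  exacts [EuclideanGeometry.angle_comm _ _ _, rfl, EuclideanGeometry.angle_comm _ _ _, rfl]

lemma stripNet_angle_B_A_C {β : Fin 4 → ℝ}
    (hβ : ∀ j, EuclideanGeometry.angle (S (j + 1)) (A (j + 1)) (R j) = β (j + 1)) (i : Fin 4) :
    EuclideanGeometry.angle ((stripNet A S R).B i) ((stripNet A S R).A i) ((stripNet A S R).C i)
      = β i := by
  fin_cases i
  exacts [(EuclideanGeometry.angle_comm _ _ _).trans (hβ 3), hβ 0,
    (EuclideanGeometry.angle_comm _ _ _).trans (hβ 1), hβ 2]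

lemma stripNet_flatAngles {a : FlatAngles}
    (hS : ∀ i, EuclideanGeometry.angle (A (i + 1)) (A i) (S i) = a.sideAngle i)
    (hR : ∀ i, EuclideanGeometry.angle (A i) (A (i + 1)) (R i) = a.sideAngle' i)
    (hβ : ∀ j, EuclideanGeometry.angle (S (j + 1)) (A (j + 1)) (R j) = a.β (j + 1))
    (hδ : ∀ i, EuclideanGeometry.angle (A (i - 1)) (A i) (A (i + 1)) = a.δ i) :
    (stripNet A S R).flatAngles = a := by
  apply FlatAngles.ext
  · funext i
    fin_cases i
    exacts [hR 3, hS 1, hR 1, hS 3]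
  · exact funext (stripNet_angle_B_A_C hβ)
  · funext i
    fin_cases i
    exacts [(EuclideanGeometry.angle_comm _ _ _).trans (hS 0),
      (EuclideanGeometry.angle_comm _ _ _).trans (hR 0),
      (EuclideanGeometry.angle_comm _ _ _).trans (hS 2),
      (EuclideanGeometry.angle_comm _ _ _).trans (hR 2)]
  · exact funext hδ

/-- A relation between `S i` and `A i` and between `R i` and `A (i + 1)` for all side faces holds
between the outer vertices and the vertices of the central face. -/
lemma stripNet_forall {P : Fin 4 → E3 → Prop} (hS : ∀ i, P i (S i)) (hR : ∀ i, P (i + 1) (R i))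
    (i : Fin 4) : P i ((stripNet A S R).B i) ∧ P i ((stripNet A S R).C i) := by
  fin_cases i
  exacts [⟨hR 3, hS 0⟩, ⟨hS 1, hR 0⟩, ⟨hR 1, hS 2⟩, ⟨hS 3, hR 2⟩]

lemma stripNet_forall₂ {S' R' : Fin 4 → E3} {P : Fin 4 → E3 → E3 → Prop}
    (hS : ∀ i, P i (S i) (S' i)) (hR : ∀ i, P (i + 1) (R i) (R' i)) (i : Fin 4) :
    P i ((stripNet A S R).B i) ((stripNet A S' R').B i) ∧
      P i ((stripNet A S R).C i) ((stripNet A S' R').C i) := by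
  fin_cases i
  exacts [⟨hR 3, hS 0⟩, ⟨hS 1, hR 0⟩, ⟨hR 1, hS 2⟩, ⟨hS 3, hR 2⟩]

/-- Corner triangles are congruent by side-angle-side: two sides belong to side faces, and the
included angle is β. -/
lemma stripNet_facesCongruent {S' R' : Fin 4 → E3}
    (hside : ∀ i, Congruent ![A i, A (i + 1), R i, S i] ![A i, A (i + 1), R' i, S' i])
    (hβ : (stripNet A S R).flatAngles.β = (stripNet A S' R').flatAngles.β) :
    (stripNet A S R).FacesCongruent (stripNet A S' R') := by
  refine ⟨Congruent.refl _, fun i => ?_, fun i => ?_⟩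
  · rw [stripNet_sideFace, stripNet_sideFace]
    exact hside i
  obtain ⟨hB, hC⟩ := stripNet_forall₂ (A := A) (S := S) (R := R) (S' := S') (R' := R')
    (P := fun i X Y => dist X (A i) = dist Y (A i))
    (fun i => congruent_iff_dist_eq.1 (hside i) 3 0)
    (fun i => congruent_iff_dist_eq.1 (hside i) 2 1) i
  have hang : EuclideanGeometry.angle ((stripNet A S R).B i) (A i) ((stripNet A S R).C i) =
    EuclideanGeometry.angle ((stripNet A S' R').B i) (A i) ((stripNet A S' R').C i) :=
    congrFun hβ i
  change Congruent ![(stripNet A S R).B i, A i, (stripNet A S R).C i]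
    ![(stripNet A S' R').B i, A i, (stripNet A S' R').C i]
  generalize (stripNet A S R).B i = X, (stripNet A S R).C i = Y, (stripNet A S' R').B i = X',
    (stripNet A S' R').C i = Y', A i = Z at hB hC hang
  have hXY : dist X Y = dist X' Y' := by
    have l := EuclideanGeometry.law_cos X Z Y
    rw [hB, hC, hang] at l
    exact (mul_self_inj_of_nonneg dist_nonneg dist_nonneg).1
      (l.trans (EuclideanGeometry.law_cos _ _ _).symm)
  rw [congruent_iff_dist_eq]
  intro k l
  fin_cases k <;> fin_cases l
  exacts [(dist_self _).trans (dist_self _).symm, hB, hXY,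
    (dist_comm _ _).trans (hB.trans (dist_comm _ _)), rfl,
    (dist_comm _ _).trans (hC.trans (dist_comm _ _)),
    (dist_comm _ _).trans (hXY.trans (dist_comm _ _)), hC,
    (dist_self _).trans (dist_self _).symm]

end StripNet

namespace RectNet

variable (D : RectNet)

/-- The unit vectors along `A (i + 1), A i`. -/
def edge : Fin 4 → E3 := ![D.v, D.u, -D.v, -D.u]

/-- The unit vectors in the central face perpendicular to its edges, pointing inwards. -/
def inward : Fin 4 → E3 := ![-D.u, D.v, D.u, -D.v]

noncomputable def A : Fin 4 → E3 := ![D.O + (D.F 1).ℓ • D.u + (D.F 0).ℓ • D.v,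
  D.O + (D.F 1).ℓ • D.u, D.O, D.O + (D.F 0).ℓ • D.v]

/-- The vertex adjacent to `A i` of the side face at the edge `A i, A (i + 1)`, which is folded by
the angle with half-angle cotangent `w i`. -/
noncomputable def S (w : Fin 4 → ℝ) (i : Fin 4) : E3 := D.A (i + 1) +
  fold (D.edge i) (D.inward i) D.n (cosOfCot (w i)) (sinOfCot (w i)) (D.F i).xS (D.F i).yS

/-- The vertex adjacent to `A (i + 1)` of the side face at the edge `A i, A (i + 1)`. -/
noncomputable def R (w : Fin 4 → ℝ) (i : Fin 4) : E3 := D.A (i + 1) +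
  fold (D.edge i) (D.inward i) D.n (cosOfCot (w i)) (sinOfCot (w i)) (D.F i).xR (D.F i).yR

noncomputable def net (w : Fin 4 → ℝ) : Net := stripNet D.A (D.S w) (D.R w)

/-- Only faces 0 and 1 enter the lengths of the rectangle. The equalities for faces 2 and 3 make
those faces fit the opposite edges. -/
structure IsAdmissible (a : FlatAngles) : Prop where
  frame : IsFrame D.u D.v D.n
  ℓ_two : (D.F 2).ℓ = (D.F 0).ℓ
  ℓ_three : (D.F 3).ℓ = (D.F 1).ℓ
  hasAngles : ∀ i, (D.F i).HasAngles (a.sideAngle i) (a.sideAngle' i)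

variable {D}

lemma isFrame_edge (h : IsFrame D.u D.v D.n) (i : Fin 4) :
    IsFrame (D.edge i) (D.inward i) D.n := by
  have h1 := h.rotate
  have h2 := h1.rotate
  have h3 := h2.rotate
  rw [neg_neg] at h3
  fin_cases i
  exacts [h3, h, h1, h2]

namespace IsAdmissible

variable {a : FlatAngles} (h : D.IsAdmissible a)

include h

lemma isFrame (i : Fin 4) : IsFrame (D.edge i) (D.inward i) D.n := isFrame_edge h.frame i

lemma ℓ_pos (i : Fin 4) : 0 < (D.F i).ℓ := (h.hasAngles i).ℓ_pos

lemma A_eq (i : Fin 4) : D.A i = D.A (i + 1) + (D.F i).ℓ • D.edge i := by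
  have h2 := h.ℓ_two
  have h3 := h.ℓ_three
  fin_cases i <;> simp [A, edge, h2, h3, add_right_comm]

lemma centralNormal_eq (w : Fin 4 → ℝ) :
    (D.net w).centralNormal = ((D.F 1).ℓ * (D.F 0).ℓ) • D.n := by
  have : (D.net w).centralNormal = cross (D.A 1 - D.A 2) (D.A 3 - D.A 2) := rfl
  simp only [this, A, Matrix.cons_val, add_sub_cancel_left]
  rw [cross_smul_left, cross_smul_right, h.frame.cross_uv, smul_smul]

lemma S_sub_A (w : Fin 4 → ℝ) (i : Fin 4) : D.S w i - D.A i = fold (D.edge i) (D.inward i) D.n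
    (cosOfCot (w i)) (sinOfCot (w i)) ((D.F i).xS - (D.F i).ℓ) (D.F i).yS := by
  rw [S, h.A_eq i, add_sub_add_left_eq_sub, ← fold_zero_right, fold_sub, sub_zero]

lemma sideNormal_eq (w : Fin 4 → ℝ) (i : Fin 4) :
    (D.net w).sideNormal i = ((D.F i).ℓ * (D.F i).yS) •
      (cosOfCot (w i) • D.n + sinOfCot (w i) • (-D.inward i)) := by
  have : (D.net w).sideNormal i =
    cross (D.A i - D.A (i + 1)) ((D.net w).outer i i - D.A i) := rfl
  rw [this, net, stripNet_outer_self, h.S_sub_A, h.A_eq i, add_sub_cancel_left, cross_fold (h.isFrame i)]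

lemma dihedral_mem (w : Fin 4 → ℝ) (i : Fin 4) (hw : 0 < w i) :
    (D.net w).dihedral i ∈ Set.Ioo 0 Real.pi ∧ Real.cot ((D.net w).dihedral i / 2) = w i := by
  obtain ⟨θ, hθ, hcot, hc, hs⟩ := exists_angle_of_cot hw
  have hf := h.isFrame i
  have hl := h.ℓ_pos
  have hy := (h.hasAngles i).yS_pos
  have hval : (D.net w).dihedral i = θ := by
    have e : (D.net w).A i - (D.net w).A (i + 1) = (D.F i).ℓ • D.edge i := by
      change D.A i - D.A (i + 1) = _
      rw [h.A_eq i, add_sub_cancel_left]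
    rw [Net.dihedral, e, h.centralNormal_eq, h.sideNormal_eq, if_pos]
    · rw [InnerProductGeometry.angle_smul_left_of_pos _ _ (mul_pos (hl 1) (hl 0)),
        InnerProductGeometry.angle_smul_right_of_pos _ _ (mul_pos (hl i) hy), ← hc, ← hs]
      simpa using angle_polar (e := D.n) (f := -D.inward i) hf.nn
        (by rw [inner_neg_neg, hf.vv]) (by rw [inner_neg_right, real_inner_comm, hf.vn, neg_zero])
        one_pos ⟨hθ.1.le, hθ.2.le⟩
    · rw [cross_smul_left, cross_smul_right, real_inner_smul_left, real_inner_smul_left,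
        real_inner_smul_right, inner_cross_normal hf]
      have := hl 0
      have := hl 1
      have := hl i
      have := sinOfCot_pos hw
      positivity
  rw [hval]
  exact ⟨hθ, hcot⟩

lemma isConvexQuad_central :
    IsConvexQuad (D.A 1) (D.A 2) (D.A 3) (D.A 4) := by
  have h0 := h.ℓ_pos 0
  have h1 := h.ℓ_pos 1
  constructor
  · refine ⟨D.O + (1 / 2 : ℝ) • ((D.F 1).ℓ • D.u + (D.F 0).ℓ • D.v),
      ⟨1 / 2, 1 / 2, by norm_num, by norm_num, by norm_num, ?_⟩,
      ⟨1 / 2, 1 / 2, by norm_num, by norm_num, by norm_num, ?_⟩⟩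
    · change (1 / 2 : ℝ) • (D.O + (D.F 1).ℓ • D.u) + (1 / 2 : ℝ) • (D.O + (D.F 0).ℓ • D.v) = _
      module
    · change (1 / 2 : ℝ) • D.O + (1 / 2 : ℝ) • (D.O + (D.F 1).ℓ • D.u + (D.F 0).ℓ • D.v) = _
      module
  · intro hcol
    have hsub : ({D.A 1, D.A 2, D.A 3} : Set E3) ⊆ {D.A 1, D.A 2, D.A 3, D.A 4} := by
      intro x hx
      simp only [Set.mem_insert_iff, Set.mem_singleton_iff] at hx ⊢
      tauto
    have e1 : D.A 1 - D.A 2 = (D.F 1).ℓ • D.u := by simp [A]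
    have e3 : D.A 3 - D.A 2 = (D.F 0).ℓ • D.v := by simp [A]
    have hne {x : E3} (hx : ⟪x, x⟫_ℝ = 1) : x ≠ 0 := by
      rintro rfl
      simp at hx
    have hang : EuclideanGeometry.angle (D.A 1) (D.A 2) (D.A 3) = Real.pi / 2 := by
      rw [EuclideanGeometry.angle, ← InnerProductGeometry.inner_eq_zero_iff_angle_eq_pi_div_two,
        vsub_eq_sub, vsub_eq_sub, e1, e3, real_inner_smul_left, real_inner_smul_right, h.frame.uv]
      simp
    refine not_collinear_of_angle ?_ ?_ ?_ ?_ (hcol.subset hsub)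
    · rw [← sub_ne_zero, e1]; exact smul_ne_zero h1.ne' (hne h.frame.uu)
    · rw [← sub_ne_zero, e3]; exact smul_ne_zero h0.ne' (hne h.frame.vv)
    · rw [hang]; positivity
    · rw [hang]; linarith [Real.pi_pos]

lemma isConvexQuad_side (w : Fin 4 → ℝ) (i : Fin 4) :
    IsConvexQuad (D.A i) (D.A (i + 1)) (D.R w i) (D.S w i) := by
  have := isConvexQuad_fold (Q := D.A (i + 1)) (h.isFrame i) (cosOfCot_sq_add_sinOfCot_sq (w i))
    (h.hasAngles i)
  rwa [← h.A_eq i] at this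

end IsAdmissible

end RectNet

/-- The spherical cosine theorem at a right angle of the central face. -/
lemma angle_corner {u m n : E3} (h : IsFrame u m n) {c s c' s' : ℝ} (hcs : c ^ 2 + s ^ 2 = 1)
    (hcs' : c' ^ 2 + s' ^ 2 = 1) {ρ ρ' φ φ' β : ℝ} (hρ : 0 < ρ) (hρ' : 0 < ρ')
    (hβ : β ∈ Set.Icc 0 Real.pi) (hcos : Real.cos β = Real.cos φ * Real.sin φ' * c' +
      Real.sin φ * Real.cos φ' * c + Real.sin φ * Real.sin φ' * s * s') :
    InnerProductGeometry.angle (fold u m n c s (-(ρ * Real.cos φ)) (ρ * Real.sin φ))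
      (fold m (-u) n c' s' (ρ' * Real.cos φ') (ρ' * Real.sin φ')) = β := by
  have h' : IsFrame m (-u) n := by simpa using h.rotate.rotate.rotate
  have hin := h.inner_eq (-Real.cos φ) (Real.sin φ * c) (Real.sin φ * s)
    (-(Real.sin φ' * c')) (Real.cos φ') (Real.sin φ' * s')
  have e1 : fold u m n c s (-(ρ * Real.cos φ)) (ρ * Real.sin φ) =
      ρ • fold u m n c s (-Real.cos φ) (Real.sin φ) := by rw [smul_fold, mul_neg]
  rw [e1, ← smul_fold, InnerProductGeometry.angle_smul_left_of_pos _ _ hρ,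
    InnerProductGeometry.angle_smul_right_of_pos _ _ hρ', InnerProductGeometry.angle,
    h.norm_fold hcs, h'.norm_fold hcs', neg_sq, Real.cos_sq_add_sin_sq, Real.cos_sq_add_sin_sq,
    Real.sqrt_one, mul_one, div_one]
  have e2 : fold m (-u) n c' s' (Real.cos φ') (Real.sin φ') =
    (-(Real.sin φ' * c')) • u + Real.cos φ' • m + (Real.sin φ' * s') • n := by
    unfold fold; module
  rw [e2]
  change Real.arccos ⟪(-Real.cos φ) • u + (Real.sin φ * c) • m + (Real.sin φ * s) • n, _⟫_ℝ = β
  rw [hin, ← Real.arccos_cos hβ.1 hβ.2, hcos]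
  congr 1
  ring

/-! ### Flat angles and nondegeneracy of the folded net. -/

namespace RectNet.IsAdmissible

variable {D : RectNet} {a : FlatAngles} (h : D.IsAdmissible a) (ha : a.IsRectangular)

include h

lemma S_ne_A (w : Fin 4 → ℝ) (i : Fin 4) : D.S w i ≠ D.A i := by
  intro H
  have := h.S_sub_A w i
  rw [H, sub_self] at this
  have h2 := (h.isFrame i).norm_fold_sq (cosOfCot_sq_add_sinOfCot_sq (w i))
    ((D.F i).xS - (D.F i).ℓ) (D.F i).yS
  rw [← this, norm_zero] at h2
  nlinarith [(h.hasAngles i).yS_pos, sq_nonneg ((D.F i).xS - (D.F i).ℓ)]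

lemma R_ne_A (w : Fin 4 → ℝ) (i : Fin 4) : D.R w i ≠ D.A (i + 1) := by
  intro H
  have := add_eq_left.1 H
  have h2 := (h.isFrame i).norm_fold_sq (cosOfCot_sq_add_sinOfCot_sq (w i))
    (D.F i).xR (D.F i).yR
  rw [this, norm_zero] at h2
  nlinarith [(h.hasAngles i).yR_pos, sq_nonneg (D.F i).xR]

lemma angle_central (i : Fin 4) :
    EuclideanGeometry.angle (D.A (i - 1)) (D.A i) (D.A (i + 1)) = Real.pi / 2 := by
  have uv := h.frame.uv
  have vu := uv
  rw [real_inner_comm] at vu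
  have key : ∀ j, ⟪D.edge j, D.edge (j + 1)⟫_ℝ = 0 := by
    intro j
    fin_cases j
    exacts [vu, (inner_neg_right _ _).trans (neg_eq_zero.2 uv), (inner_neg_neg _ _).trans vu,
      (inner_neg_left _ _).trans (neg_eq_zero.2 uv)]
  have hi := key (i - 1)
  have e1 := h.A_eq (i - 1)
  rw [sub_add_cancel] at e1 hi
  rw [EuclideanGeometry.angle, ← InnerProductGeometry.inner_eq_zero_iff_angle_eq_pi_div_two,
    vsub_eq_sub, vsub_eq_sub, e1, add_sub_cancel_left, h.A_eq i, sub_add_cancel_left,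
    inner_neg_right, real_inner_smul_left, real_inner_smul_right, hi, mul_zero, mul_zero, neg_zero]

include ha

lemma angle_S (w : Fin 4 → ℝ) (i : Fin 4) :
    EuclideanGeometry.angle (D.A (i + 1)) (D.A i) (D.S w i) = a.sideAngle i := by
  have := angle_fold_left (Q := D.A (i + 1)) (h.isFrame i) (cosOfCot_sq_add_sinOfCot_sq (w i))
    (h.hasAngles i) (ha.sideAngle_mem i)
  rwa [← h.A_eq i] at this

lemma angle_R (w : Fin 4 → ℝ) (i : Fin 4) :
    EuclideanGeometry.angle (D.A i) (D.A (i + 1)) (D.R w i) = a.sideAngle' i := by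
  have := angle_fold_right (Q := D.A (i + 1)) (h.isFrame i) (cosOfCot_sq_add_sinOfCot_sq (w i))
    (h.hasAngles i) (ha.sideAngle'_mem i)
  rwa [← h.A_eq i] at this

/-- The angle `β` at the common vertex of the side faces `j` and `j + 1`. -/
lemma angle_S_R {w : Fin 4 → ℝ} (hw : a.CosineTheorem w) (j : Fin 4) :
    EuclideanGeometry.angle (D.S w (j + 1)) (D.A (j + 1)) (D.R w j) = a.β (j + 1) := by
  obtain ⟨ρ, hρ, h1, h2⟩ := (h.hasAngles (j + 1)).polarS
  obtain ⟨ρ', hρ', h1', h2'⟩ := (h.hasAngles j).polarR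
  have := angle_corner (h.isFrame (j + 1)) (cosOfCot_sq_add_sinOfCot_sq (w (j + 1)))
    (cosOfCot_sq_add_sinOfCot_sq (w j)) hρ hρ' (Set.Ioo_subset_Icc_self (ha.β_mem (j + 1)))
    (hw.cos_β j)
  rw [← h1, ← h2, ← h1', ← h2', neg_sub, ← h.S_sub_A] at this
  -- The frames at neighbouring edges differ by a quarter turn, which brings the two folds into the
  -- form required by `angle_corner`.
  have hinward : D.edge j = D.inward (j + 1) ∧ D.inward j = -D.edge (j + 1) := by
    fin_cases j
    exacts [⟨rfl, rfl⟩, ⟨rfl, (neg_neg _).symm⟩, ⟨rfl, (neg_neg _).symm⟩, ⟨rfl, rfl⟩]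
  rw [EuclideanGeometry.angle, vsub_eq_sub, vsub_eq_sub, RectNet.R, add_sub_cancel_left, ← this,
    hinward.1, hinward.2]

lemma flatAngles_net {w : Fin 4 → ℝ} (hw : a.CosineTheorem w) : (D.net w).flatAngles = a :=
  stripNet_flatAngles (h.angle_S ha w) (h.angle_R ha w) (h.angle_S_R ha hw)
    fun i => (h.angle_central i).trans (ha.δ_eq i).symm

lemma isPolyhedron_net {w : Fin 4 → ℝ} (hw : a.CosineTheorem w) : (D.net w).IsPolyhedron := by
  refine ⟨h.isConvexQuad_central, fun i => ?_, fun i => ?_⟩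
  · rw [net, stripNet_sideFace]
    exact h.isConvexQuad_side w i
  · obtain ⟨hB, hC⟩ := stripNet_forall (A := D.A) (P := fun i X => X ≠ D.A i)
      (h.S_ne_A w) (h.R_ne_A w) i
    have hβ := stripNet_angle_B_A_C (h.angle_S_R ha hw) i
    refine not_collinear_of_angle hB hC ?_ ?_
    · exact fun H => (ha.β_mem i).1.ne' (hβ.symm.trans H)
    · exact fun H => (ha.β_mem i).2.ne (hβ.symm.trans H)

end RectNet.IsAdmissible

/-! ### Congruent faces and incongruent nets. -/

namespace RectNet.IsAdmissible

variable {D : RectNet} {a : FlatAngles} (h : D.IsAdmissible a)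

include h

lemma congruent_side (w w' : Fin 4 → ℝ) (i : Fin 4) :
    Congruent ![D.A i, D.A (i + 1), D.R w i, D.S w i]
      ![D.A i, D.A (i + 1), D.R w' i, D.S w' i] := by
  have key (w : Fin 4 → ℝ) : ![D.A i, D.A (i + 1), D.R w i, D.S w i] = fun k => D.A (i + 1) +
      fold (D.edge i) (D.inward i) D.n (cosOfCot (w i)) (sinOfCot (w i))
        (![(D.F i).ℓ, 0, (D.F i).xR, (D.F i).xS] k) (![0, 0, (D.F i).yR, (D.F i).yS] k) := by
    funext k
    fin_cases k
    · change D.A i = D.A (i + 1) + fold _ _ _ _ _ (D.F i).ℓ 0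
      rw [fold_zero_right]
      exact h.A_eq i
    · change D.A (i + 1) = D.A (i + 1) + fold _ _ _ _ _ 0 0
      rw [fold_zero_right, zero_smul, add_zero]
    · rfl
    · rfl
  rw [key w, key w', congruent_iff_dist_eq]
  intro k l
  rw [dist_add_left, dist_add_left, dist_eq_norm, dist_eq_norm, fold_sub, fold_sub,
    (h.isFrame i).norm_fold (cosOfCot_sq_add_sinOfCot_sq _),
    (h.isFrame i).norm_fold (cosOfCot_sq_add_sinOfCot_sq _)]

lemma facesCongruent_net {w w' : Fin 4 → ℝ}
    (hβ : (D.net w).flatAngles.β = (D.net w').flatAngles.β) :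
    (D.net w).FacesCongruent (D.net w') :=
  stripNet_facesCongruent (h.congruent_side w w') hβ

/-- The points B₁ and A₄ lie on no common face. The square of their distance is affine in cos θ₁
with nonzero slope, and cos θ₁ determines a positive cotangent. -/
lemma eq_of_congruent {w w' : Fin 4 → ℝ} (hw : 0 < w 1) (hw' : 0 < w' 1)
    (hcong : Congruent (D.net w).points (D.net w').points) : w 1 = w' 1 := by
  have hd : dist (D.S w 1) (D.A 0) = dist (D.S w' 1) (D.A 0) :=
    congruent_iff_dist_eq.1 hcong (1, 1) (0, 0)
  have key (w : Fin 4 → ℝ) : dist (D.S w 1) (D.A 0) ^ 2 = ((D.F 1).xS - (D.F 1).ℓ) ^ 2 +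
      (D.F 1).yS ^ 2 + (D.F 0).ℓ ^ 2 - 2 * (D.F 1).yS * (D.F 0).ℓ * cosOfCot (w 1) := by
    have e : D.S w 1 - D.A 0 = ((D.F 1).xS - (D.F 1).ℓ) • D.u +
        ((D.F 1).yS * cosOfCot (w 1) - (D.F 0).ℓ) • D.v +
        ((D.F 1).yS * sinOfCot (w 1)) • D.n := by
      change (D.O + fold D.u D.v D.n _ _ _ _) - (D.O + (D.F 1).ℓ • D.u + (D.F 0).ℓ • D.v) = _
      unfold fold
      module
    rw [dist_eq_norm, e, ← real_inner_self_eq_norm_sq, h.frame.inner_eq]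
    linear_combination (D.F 1).yS ^ 2 * cosOfCot_sq_add_sinOfCot_sq (w 1)
  have h1 := key w
  rw [hd, key w'] at h1
  have h2 : (2 * (D.F 1).yS * (D.F 0).ℓ) * cosOfCot (w 1) =
    (2 * (D.F 1).yS * (D.F 0).ℓ) * cosOfCot (w' 1) := by linarith
  have hpos : 0 < 2 * (D.F 1).yS * (D.F 0).ℓ := by
    have := (h.hasAngles 1).yS_pos
    have := h.ℓ_pos 0
    positivity
  exact cosOfCot_injOn hw hw' (mul_left_cancel₀ hpos.ne' h2)

end RectNet.IsAdmissible

lemma RectNet.continuousOn_net (D : RectNet) {w : ℝ → Fin 4 → ℝ} {I : Set ℝ}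
    (hw : ∀ i, ContinuousOn (fun τ => w τ i) I) (i : Fin 4) :
    ContinuousOn (fun τ => (D.net (w τ)).A i) I ∧ ContinuousOn (fun τ => (D.net (w τ)).B i) I ∧
      ContinuousOn (fun τ => (D.net (w τ)).C i) I := by
  have hc (j) : ContinuousOn (fun τ => cosOfCot (w τ j)) I := by
    unfold cosOfCot
    exact (((hw j).pow 2).sub continuousOn_const).div (((hw j).pow 2).add continuousOn_const)
      fun τ _ => by positivity
  have hs (j) : ContinuousOn (fun τ => sinOfCot (w τ j)) I := by
    unfold sinOfCot
    exact (continuousOn_const.mul (hw j)).div (((hw j).pow 2).add continuousOn_const)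
      fun τ _ => by positivity
  have hfold (j) (x y : ℝ) : ContinuousOn (fun τ => D.A (j + 1) + fold (D.edge j) (D.inward j) D.n
      (cosOfCot (w τ j)) (sinOfCot (w τ j)) x y) I := by
    unfold fold
    exact continuousOn_const.add ((continuousOn_const.add
      ((continuousOn_const.mul (hc j)).smul continuousOn_const)).add
      ((continuousOn_const.mul (hs j)).smul continuousOn_const))
  have hS (j) : ContinuousOn (fun τ => D.S (w τ) j) I := hfold j _ _
  have hR (j) : ContinuousOn (fun τ => D.R (w τ) j) I := hfold j _ _
  refine ⟨continuousOn_const, ?_, ?_⟩ <;> fin_cases i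
  exacts [hR 3, hS 1, hR 1, hS 3, hS 0, hR 0, hS 2, hR 2]

lemma isRectangular_exampleAngles : exampleAngles.IsRectangular where
  α_mem i := (exampleAngles_mem_Icc i).1
  β_mem i := by
    have h := (exampleAngles_mem_Icc i).2.1
    have hs : 0 < Real.sin (exampleAngles.β i) := by
      rw [(exampleAngles_β i).2]; exact exampleSinβ_pos i
    refine ⟨h.1.lt_of_ne fun H => ?_, h.2.lt_of_ne fun H => ?_⟩
    · rw [← H, Real.sin_zero] at hs; exact hs.false
    · rw [H, Real.sin_pi] at hs; exact hs.false
  γ_mem i := (exampleAngles_mem_Icc i).2.2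
  δ_eq i := exampleAngles_δ i

/-! ### The explicit configurations -/

/-- The lists at A₄ and A₃ are those at A₁ and A₂ with the coefficients of w²z² and z², and of w²
and 1, exchanged. This is the effect of w ↦ 1/w, up to the factor w². -/
lemma exampleAngles_bricardCoeff : exampleAngles.bricardCoeff = fun i =>
      ![(√2 / 5) • ![-1, -4, -3, -6], (√2 / 5) • ![-3, -6, -1, -4],
        (√7 * √2 * √11 / 88) • ![-9, -10, -4, -5], (√7 * √2 * √11 / 88) • ![-4, -5, -9, -10]] i := by
  have h5 : √(5 : ℝ) ^ 2 = 5 := Real.sq_sqrt (by norm_num)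
  ext i j
  simp only [FlatAngles.bricardCoeff, exampleAngles_α, exampleAngles_β, exampleAngles_γ]
  fin_cases i <;> fin_cases j <;> simp [exampleCosα, exampleSinα,
    exampleCosβ, exampleCosγ, exampleSinγ] <;> ring_nf <;> (try simp only [h5]) <;> ring

lemma exampleAngles_linear_coeff (i : Fin 4) :
    4 * Real.sin (exampleAngles.α i) * Real.sin (exampleAngles.γ i) =
      ![12 * √2 / 5, 12 * √2 / 5, 35 * √2 * √11 / 44, 35 * √2 * √11 / 44] i := by
  have h5 : √(5 : ℝ) ^ 2 = 5 := Real.sq_sqrt (by norm_num)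
  have h7 : √(7 : ℝ) ^ 2 = 7 := Real.sq_sqrt (by norm_num)
  rw [(exampleAngles_α i).2, (exampleAngles_γ i).2]
  fin_cases i <;> simp [exampleSinα, exampleSinγ] <;> ring_nf <;> simp only [h5, h7] <;> ring

/-- Bricard's equation with `δ = π / 2` is the spherical cosine theorem. -/
lemma cos_β_eq_of_bricard (a : FlatAngles) (i : Fin 4) {w z : ℝ}
    (h : a.bricardCoeff i 0 * w ^ 2 * z ^ 2 + a.bricardCoeff i 1 * w ^ 2
      + a.bricardCoeff i 2 * z ^ 2 + a.bricardCoeff i 3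
      + (4 * Real.sin (a.α i) * Real.sin (a.γ i)) * w * z = 0) :
    Real.cos (a.β i) = Real.cos (a.α i) * Real.sin (a.γ i) * cosOfCot z +
      Real.sin (a.α i) * Real.cos (a.γ i) * cosOfCot w +
      Real.sin (a.α i) * Real.sin (a.γ i) * sinOfCot w * sinOfCot z := by
  simp only [FlatAngles.bricardCoeff, Matrix.cons_val] at h
  unfold cosOfCot sinOfCot
  field_simp
  linear_combination -h

section ExampleCot

variable {e t : ℝ}

lemma mem_exampleRange (ht : t ∈ exampleRange) : 0 < t ∧ 0 < (3 * t ^ 2 - 1) * (2 - 3 * t ^ 2) := by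
  have h3 : √(3 : ℝ) ^ 2 = 3 := Real.sq_sqrt (by norm_num)
  have h2 : √(2 : ℝ) ^ 2 = 2 := Real.sq_sqrt (by norm_num)
  have p3 : 0 < √(3 : ℝ) := by positivity
  obtain ⟨h, h'⟩ := ht
  have ht0 : 0 < t := lt_trans (by positivity) h
  rw [div_lt_iff₀ p3] at h
  rw [lt_div_iff₀ p3] at h'
  have l1 : 1 < 3 * t ^ 2 := by
    have := pow_lt_pow_left₀ h zero_le_one two_ne_zero
    rw [mul_pow, h3] at this; linarith
  have l2 : 3 * t ^ 2 < 2 := by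
    have := pow_lt_pow_left₀ h' (by positivity) two_ne_zero
    rw [mul_pow, h3, h2] at this; linarith
  exact ⟨ht0, mul_pos (by linarith) (by linarith)⟩

lemma exampleCot_zero_eq (he : e = 1 ∨ e = -1) (ht : t ∈ exampleRange) :
    0 < exampleCot e t 0 ∧ 3 * t ^ 2 * exampleCot e t 0 ^ 2 + 6 * t ^ 2 + exampleCot e t 0 ^ 2 + 4
      - 12 * t * exampleCot e t 0 = 0 := by
  obtain ⟨ht0, hp⟩ := mem_exampleRange ht
  have he2 : e ^ 2 = 1 := by rcases he with rfl | rfl <;> norm_num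
  have hd : 0 < 1 + 3 * t ^ 2 := by positivity
  have hsq : √(2 * (3 * t ^ 2 - 1) * (2 - 3 * t ^ 2)) ^ 2 = 2 * (3 * t ^ 2 - 1) * (2 - 3 * t ^ 2) :=
    Real.sq_sqrt (by rw [mul_assoc]; positivity)
  have hval : exampleCot e t 0 =
      (6 * t - e * √(2 * (3 * t ^ 2 - 1) * (2 - 3 * t ^ 2))) / (1 + 3 * t ^ 2) := rfl
  set r := √(2 * (3 * t ^ 2 - 1) * (2 - 3 * t ^ 2))
  have hr : 0 ≤ r := Real.sqrt_nonneg _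
  set z := exampleCot e t 0
  have hz : z * (1 + 3 * t ^ 2) = 6 * t - e * r := by rw [hval, div_mul_cancel₀ _ hd.ne']
  constructor
  · rw [hval]
    -- Indeed 36t² - r² = (1 + 3t²)(4 + 6t²), the product of the leading and constant coefficients
    -- of the quadratic.
    have : r < 6 * t := by
      apply lt_of_pow_lt_pow_left₀ 2 (by positivity)
      nlinarith [sq_nonneg (t ^ 2), sq_nonneg t]
    refine div_pos ?_ hd
    rcases he with rfl | rfl <;> linarith
  -- Multiplied by its leading coefficient, the quadratic is ((1 + 3t²)z - 6t)² minus its quarter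
  -- discriminant.
  · refine (mul_eq_zero.1 ?_).resolve_left hd.ne'
    linear_combination (z * (1 + 3 * t ^ 2) - 6 * t - e * r) * hz + e ^ 2 * hsq
      + 2 * (3 * t ^ 2 - 1) * (2 - 3 * t ^ 2) * he2

lemma exampleCot_two_eq (he : e = 1 ∨ e = -1) (ht : t ∈ exampleRange) :
    0 < exampleCot e t 2 ∧ 9 * t ^ 2 * exampleCot e t 2 ^ 2 + 10 * t ^ 2 + 4 * exampleCot e t 2 ^ 2
      + 5 - 10 * √7 * t * exampleCot e t 2 = 0 := by
  obtain ⟨ht0, hp⟩ := mem_exampleRange ht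
  have he2 : e ^ 2 = 1 := by rcases he with rfl | rfl <;> norm_num
  have h7 : √(7 : ℝ) ^ 2 = 7 := Real.sq_sqrt (by norm_num)
  have hd : 0 < 4 + 9 * t ^ 2 := by positivity
  have hsq : √(10 * (3 * t ^ 2 - 1) * (2 - 3 * t ^ 2)) ^ 2 =
    10 * (3 * t ^ 2 - 1) * (2 - 3 * t ^ 2) := Real.sq_sqrt (by rw [mul_assoc]; positivity)
  have hval : exampleCot e t 2 =
      (5 * √7 * t - e * √(10 * (3 * t ^ 2 - 1) * (2 - 3 * t ^ 2))) / (4 + 9 * t ^ 2) := rfl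
  set r := √(10 * (3 * t ^ 2 - 1) * (2 - 3 * t ^ 2))
  have hr : 0 ≤ r := Real.sqrt_nonneg _
  set z := exampleCot e t 2
  have hz : z * (4 + 9 * t ^ 2) = 5 * √7 * t - e * r := by rw [hval, div_mul_cancel₀ _ hd.ne']
  constructor
  · rw [hval]
    -- Here 175t² - r² = (4 + 9t²)(5 + 10t²).
    have : r < 5 * √7 * t := by
      apply lt_of_pow_lt_pow_left₀ 2 (by positivity)
      rw [mul_pow, mul_pow, h7, hsq]
      nlinarith [sq_nonneg (t ^ 2), sq_nonneg t]
    refine div_pos ?_ hd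
    rcases he with rfl | rfl <;> linarith
  · refine (mul_eq_zero.1 ?_).resolve_left hd.ne'
    linear_combination (z * (4 + 9 * t ^ 2) - 5 * √7 * t - e * r) * hz + e ^ 2 * hsq
      + 10 * (3 * t ^ 2 - 1) * (2 - 3 * t ^ 2) * he2 - 25 * t ^ 2 * h7

lemma exampleCot_pos (he : e = 1 ∨ e = -1) (ht : t ∈ exampleRange) (i : Fin 4) :
    0 < exampleCot e t i := by
  have ht0 := (mem_exampleRange ht).1
  fin_cases i
  exacts [(exampleCot_zero_eq he ht).1, ht0, (exampleCot_two_eq he ht).1, one_div_pos.2 ht0]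

lemma cosineTheorem_exampleCot (he : e = 1 ∨ e = -1) (ht : t ∈ exampleRange) :
    exampleAngles.CosineTheorem (exampleCot e t) := by
  intro i
  apply cos_β_eq_of_bricard
  have ht0 := (mem_exampleRange ht).1
  have h7 : √(7 : ℝ) ^ 2 = 7 := Real.sq_sqrt (by norm_num)
  have e0 := (exampleCot_zero_eq he ht).2
  have e2 := (exampleCot_two_eq he ht).2
  have w1 : exampleCot e t 1 = t := rfl
  have w3 : exampleCot e t 3 = 1 / t := rfl
  rw [exampleAngles_bricardCoeff, exampleAngles_linear_coeff]
  set z := exampleCot e t 0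
  set y := exampleCot e t 2
  fin_cases i
  · change (√2 / 5 * (-1)) * exampleCot e t 3 ^ 2 * z ^ 2 +
      (√2 / 5 * (-4)) * exampleCot e t 3 ^ 2 + (√2 / 5 * (-3)) * z ^ 2 + √2 / 5 * (-6)
      + 12 * √2 / 5 * exampleCot e t 3 * z = 0
    rw [w3]
    field_simp
    linear_combination (-√2) * e0
  · change (√2 / 5 * (-3)) * t ^ 2 * z ^ 2 +
      (√2 / 5 * (-6)) * t ^ 2 + (√2 / 5 * (-1)) * z ^ 2 + √2 / 5 * (-4)
      + 12 * √2 / 5 * t * z = 0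
    linear_combination (-√2 / 5) * e0
  · change (√7 * √2 * √11 / 88 * (-9)) * t ^ 2 * y ^ 2 +
      (√7 * √2 * √11 / 88 * (-10)) * t ^ 2 + (√7 * √2 * √11 / 88 * (-4)) * y ^ 2 +
      √7 * √2 * √11 / 88 * (-5) + 35 * √2 * √11 / 44 * t * y = 0
    linear_combination (-√7 * √2 * √11 / 88) * e2 - 10 * √2 * √11 / 88 * t * y * h7
  · change (√7 * √2 * √11 / 88 * (-4)) * exampleCot e t 3 ^ 2 * y ^ 2 +
      (√7 * √2 * √11 / 88 * (-5)) * exampleCot e t 3 ^ 2 + (√7 * √2 * √11 / 88 * (-9)) * y ^ 2 +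
      √7 * √2 * √11 / 88 * (-10) + 35 * √2 * √11 / 44 * exampleCot e t 3 * y = 0
    rw [w3]
    have ht' : t * (1 / t) = 1 := mul_one_div_cancel ht0.ne'
    generalize 1 / t = x at *
    linear_combination (-√7 * √2 * √11 / 88 * x ^ 2) * e2 - 10 * √2 * √11 / 88 * x * y * h7 +
      (√7 * √2 * √11 / 88 * ((9 * y ^ 2 + 10) * (t * x + 1) - 10 * √7 * x * y)) * ht'

lemma continuousOn_exampleCot (e : ℝ) (i : Fin 4) :
    ContinuousOn (fun τ => exampleCot e τ i) exampleRange := by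
  have h0 : ContinuousOn (fun τ : ℝ => (6 * τ - e * √(2 * (3 * τ ^ 2 - 1) * (2 - 3 * τ ^ 2))) /
      (1 + 3 * τ ^ 2)) exampleRange :=
    ContinuousOn.div (by fun_prop) (by fun_prop) fun τ _ => by positivity
  have h2 : ContinuousOn (fun τ : ℝ => (5 * √7 * τ - e * √(10 * (3 * τ ^ 2 - 1) * (2 - 3 * τ ^ 2))) /
      (4 + 9 * τ ^ 2)) exampleRange :=
    ContinuousOn.div (by fun_prop) (by fun_prop) fun τ _ => by positivity
  have h3 : ContinuousOn (fun τ : ℝ => 1 / τ) exampleRange :=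
    continuousOn_const.div continuousOn_id fun τ hτ => (mem_exampleRange hτ).1.ne'
  fin_cases i
  exacts [h0, continuousOn_id, h2, h3]

end ExampleCot

/-! ### The flexion. -/

namespace RectNet.IsAdmissible

variable {D : RectNet} (h : D.IsAdmissible exampleAngles) {e : ℝ} (he : e = 1 ∨ e = -1)

include h he

lemma isExample {t : ℝ} (ht : t ∈ exampleRange) : IsExample e t (D.net (exampleCot e t)) :=
  ⟨h.isPolyhedron_net isRectangular_exampleAngles (cosineTheorem_exampleCot he ht),
    h.flatAngles_net isRectangular_exampleAngles (cosineTheorem_exampleCot he ht),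
    fun i => h.dihedral_mem _ i (exampleCot_pos he ht i)⟩

lemma isFlexion {t : ℝ} (ht : t ∈ exampleRange) : (D.net (exampleCot e t)).IsFlexion exampleRange t
    (fun τ => D.net (exampleCot e τ)) := by
  refine ⟨rfl, D.continuousOn_net (continuousOn_exampleCot e), fun τ hτ => ⟨?_, ?_⟩, ?_⟩
  · exact (h.isExample he hτ).1
  · exact h.facesCongruent_net (by rw [(h.isExample he ht).2.1, (h.isExample he hτ).2.1])
  · intro s hs τ hτ hne hcong
    exact hne (h.eq_of_congruent (exampleCot_pos he hs 1) (exampleCot_pos he hτ 1) hcong)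

end RectNet.IsAdmissible

lemma Net.IsFlexion.isFlexible {N : Net} {I : Set ℝ} (hI : IsOpen I) {t : ℝ} (ht : t ∈ I)
    {V : ℝ → Net} (h : N.IsFlexion I t V) : N.IsFlexible := by
  obtain ⟨ε, hε, hsub⟩ := Metric.isOpen_iff.1 hI t ht
  have hmaps : Set.MapsTo (fun τ => t + τ) (Set.Ioo (-ε) ε) I := fun τ hτ =>
    hsub (by rw [Metric.mem_ball, Real.dist_eq, add_sub_cancel_left, abs_lt]; exact hτ)
  obtain ⟨h1, h2, h3, h4⟩ := h
  have hc : ContinuousOn (fun τ : ℝ => t + τ) (Set.Ioo (-ε) ε) := by fun_prop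
  refine ⟨ε, hε, fun τ => V (t + τ), by simpa using h1, fun i => ?_, fun τ hτ => h3 _ (hmaps hτ),
    fun s hs τ hτ hne => h4 _ (hmaps hs) _ (hmaps hτ) (by simpa using hne)⟩
  exact ⟨(h2 i).1.comp hc hmaps, (h2 i).2.1.comp hc hmaps, (h2 i).2.2.comp hc hmaps⟩

/-! ### Every polyhedron of the example arises by folding -/

lemma exists_rectNet {e t : ℝ} {N : Net} (hN : IsExample e t N) :
    ∃ D : RectNet, D.IsAdmissible exampleAngles ∧ N = D.net (exampleCot e t) := by
  obtain ⟨hpoly, hflat, hdih⟩ := hN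
  have hδ (i : Fin 4) : ⟪N.A (i - 1) - N.A i, N.A (i + 1) - N.A i⟫_ℝ = 0 :=
    (InnerProductGeometry.inner_eq_zero_iff_angle_eq_pi_div_two _ _).2
      (congrFun (congrArg FlatAngles.δ hflat) i)
  have d0 : ⟪N.A 3 - N.A 0, N.A 1 - N.A 0⟫_ℝ = 0 := hδ 0
  have d1 : ⟪N.A 0 - N.A 1, N.A 2 - N.A 1⟫_ℝ = 0 := hδ 1
  have d2 : ⟪N.A 1 - N.A 2, N.A 3 - N.A 2⟫_ℝ = 0 := hδ 2
  have d3 : ⟪N.A 2 - N.A 3, N.A 0 - N.A 3⟫_ℝ = 0 := hδ 3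
  obtain ⟨a, ha⟩ : ∃ a, a = N.A 1 - N.A 2 := ⟨_, rfl⟩
  obtain ⟨b, hb⟩ : ∃ b, b = N.A 3 - N.A 2 := ⟨_, rfl⟩
  obtain ⟨c, hc⟩ : ∃ c, c = N.A 0 - N.A 3 := ⟨_, rfl⟩
  have hA1 : N.A 1 = N.A 2 + a := by rw [ha]; abel
  have hA3 : N.A 3 = N.A 2 + b := by rw [hb]; abel
  have hA0 : N.A 0 = N.A 2 + b + c := by rw [hc, ← hA3]; abel
  -- Four right angles make a rectangle even without assuming planarity: they give ⟪c, c⟫ = ⟪a, c⟫ =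
  -- ⟪a, a⟫, whence ‖c - a‖ = 0.
  have hca : c = a := by
    rw [hA0, hA1, hA3] at d0
    rw [hA0, hA1] at d1
    rw [hA1, hA3] at d2
    rw [hA0, hA3] at d3
    rw [show N.A 2 + b - (N.A 2 + b + c) = -c by abel,
      show N.A 2 + a - (N.A 2 + b + c) = a - b - c by abel] at d0
    rw [show N.A 2 - (N.A 2 + a) = -a by abel,
      show N.A 2 + b + c - (N.A 2 + a) = b + c - a by abel] at d1
    rw [add_sub_cancel_left, add_sub_cancel_left] at d2
    rw [sub_add_cancel_left, add_sub_cancel_left] at d3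
    rw [← sub_eq_zero, ← inner_self_eq_zero (𝕜 := ℝ)]
    have ba := d2
    rw [real_inner_comm] at ba
    have cb : ⟪c, b⟫_ℝ = 0 := by rw [real_inner_comm]; simpa using d3
    simp only [inner_neg_left, inner_neg_right, inner_sub_left, inner_sub_right, inner_add_left,
      ba, cb] at d0 d1 ⊢
    linarith [real_inner_comm a c]
  rw [hca] at hA0
  have hncol := hpoly.1.2
  have ha0 : a ≠ 0 := by
    rintro rfl
    apply hncol
    rw [show N.A 4 = N.A 0 from rfl, hA0, hA1, hA3]
    convert collinear_pair ℝ (N.A 2) (N.A 2 + b) using 1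
    ext x
    simp only [add_zero, Set.mem_insert_iff, Set.mem_singleton_iff]
    tauto
  have hb0 : b ≠ 0 := by
    rintro rfl
    apply hncol
    rw [show N.A 4 = N.A 0 from rfl, hA0, hA1, hA3]
    convert collinear_pair ℝ (N.A 2) (N.A 2 + a) using 1
    ext x
    simp only [add_zero, Set.mem_insert_iff, Set.mem_singleton_iff]
    tauto
  have hab : ⟪a, b⟫_ℝ = 0 := by rw [ha, hb]; exact d2
  have pa : 0 < ‖a‖ := norm_pos_iff.2 ha0
  have pb : 0 < ‖b‖ := norm_pos_iff.2 hb0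
  obtain ⟨u, hu⟩ : ∃ u, u = ‖a‖⁻¹ • a := ⟨_, rfl⟩
  obtain ⟨v, hv⟩ : ∃ v, v = ‖b‖⁻¹ • b := ⟨_, rfl⟩
  have hua : a = ‖a‖ • u := by rw [hu, smul_inv_smul₀ pa.ne']
  have hvb : b = ‖b‖ • v := by rw [hv, smul_inv_smul₀ pb.ne']
  have hframe : IsFrame u v (cross u v) := by
    apply isFrame_cross
    · rw [real_inner_self_eq_norm_sq, hu, norm_smul, norm_inv, norm_norm,
        inv_mul_cancel₀ pa.ne', one_pow]
    · rw [real_inner_self_eq_norm_sq, hv, norm_smul, norm_inv, norm_norm,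
        inv_mul_cancel₀ pb.ne', one_pow]
    · rw [hu, hv, real_inner_smul_left, real_inner_smul_right, hab]; simp
  obtain ⟨n, hn⟩ : ∃ n, n = cross u v := ⟨_, rfl⟩
  rw [← hn] at hframe
  obtain ⟨la, hla⟩ : ∃ l, l = ‖a‖ := ⟨_, rfl⟩
  obtain ⟨lb, hlb⟩ : ∃ l, l = ‖b‖ := ⟨_, rfl⟩
  rw [← hla] at hua pa
  rw [← hlb] at hvb pb
  rw [hua] at hA0 hA1
  rw [hvb] at hA0 hA3
  -- The side faces here are placeholders; only the edge and inward vectors are used.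
  let D₀ : RectNet := ⟨N.A 2, u, v, n, fun _ => ⟨0, 0, 0, 0, 0⟩⟩
  have hf (i) : IsFrame (D₀.edge i) (D₀.inward i) n := RectNet.isFrame_edge (D := D₀) hframe i
  let l : Fin 4 → ℝ := ![lb, la, lb, la]
  have hl (i) : 0 < l i := by fin_cases i; exacts [pb, pa, pb, pa]
  have hA (i) : N.A i = N.A (i + 1) + l i • D₀.edge i := by
    fin_cases i
    · change N.A 0 = N.A 1 + lb • v
      rw [hA0, hA1]; abel
    · exact hA1
    · change N.A 2 = N.A 3 + lb • (-v)
      rw [hA3]; module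
    · change N.A 3 = N.A 0 + la • (-u)
      rw [hA3, hA0]; module
  have hnormal : N.centralNormal = (la * lb) • n := by
    rw [Net.centralNormal, hA1, hA3, add_sub_cancel_left, add_sub_cancel_left, cross_smul_left,
      cross_smul_right, ← hn, smul_smul]
  have hside (i) : ∃ F : FlatSide, F.ℓ = l i ∧
      F.HasAngles (exampleAngles.sideAngle i) (exampleAngles.sideAngle' i) ∧
      N.outer i i = N.A (i + 1) + fold (D₀.edge i) (D₀.inward i) n (cosOfCot (exampleCot e t i))
        (sinOfCot (exampleCot e t i)) F.xS F.yS ∧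
      N.outer i (i + 1) = N.A (i + 1) + fold (D₀.edge i) (D₀.inward i) n
        (cosOfCot (exampleCot e t i)) (sinOfCot (exampleCot e t i)) F.xR F.yR := by
    obtain ⟨hθ, hcot⟩ := hdih i
    obtain ⟨-, hcos, hsin⟩ := cos_sin_eq_ofCot hθ
    rw [hcot] at hcos hsin
    -- The other branch of `Net.dihedral` gives a nonpositive angle.
    have hpos : 0 < ⟪cross N.centralNormal (N.sideNormal i), N.A i - N.A (i + 1)⟫_ℝ := by
      by_contra hneg
      have := hθ.1
      rw [Net.dihedral, if_neg hneg] at this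
      linarith [InnerProductGeometry.angle_nonneg N.centralNormal (N.sideNormal i)]
    have hval : N.dihedral i = InnerProductGeometry.angle N.centralNormal (N.sideNormal i) := by
      rw [Net.dihedral, if_pos hpos]
    have hsn : N.sideNormal i = cross (l i • D₀.edge i)
        (N.outer i i - (N.A (i + 1) + l i • D₀.edge i)) := by
      rw [Net.sideNormal, ← hA i]
      congr 1
      rw [sub_eq_iff_eq_add']
      exact hA i
    rw [hnormal, hsn, show N.A i - N.A (i + 1) = l i • D₀.edge i from
      sub_eq_iff_eq_add'.2 (hA i), cross_smul_left, real_inner_smul_left] at hpos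
    rw [hnormal, InnerProductGeometry.angle_smul_left_of_pos _ _ (mul_pos pa pb), hsn] at hval
    have hconv : IsConvexQuad (N.A (i + 1) + l i • D₀.edge i) (N.A (i + 1)) (N.outer i (i + 1))
        (N.outer i i) := by
      have := hpoly.2.1 i
      rw [← hA i]
      exact this
    obtain ⟨F, hF1, hF2, hF3, hF4⟩ := exists_flatSide (hf i) (hl i) hconv
      (pos_of_mul_pos_right hpos (mul_pos pa pb).le) hval.symm
    rw [← hA i, N.angle_outer_self, N.angle_outer_add_one, hflat] at hF2
    rw [hcos, hsin] at hF3 hF4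
    exact ⟨F, hF1, hF2, hF3, hF4⟩
  choose F hF1 hF2 hF3 hF4 using hside
  let D : RectNet := ⟨N.A 2, u, v, n, F⟩
  have hDA : D.A = N.A := by
    have l0 : (F 0).ℓ = lb := hF1 0
    have l1 : (F 1).ℓ = la := hF1 1
    funext i
    fin_cases i
    · change N.A 2 + (F 1).ℓ • u + (F 0).ℓ • v = N.A 0
      rw [hA0, l0, l1]; abel
    · change N.A 2 + (F 1).ℓ • u = N.A 1
      rw [hA1, l1]
    · rfl
    · change N.A 2 + (F 0).ℓ • v = N.A 3
      rw [hA3, l0]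
  have hS : (fun i => N.outer i i) = D.S (exampleCot e t) := by
    funext i
    rw [RectNet.S, hDA]
    exact hF3 i
  have hR : (fun i => N.outer i (i + 1)) = D.R (exampleCot e t) := by
    funext i
    rw [RectNet.R, hDA]
    exact hF4 i
  refine ⟨D, ⟨hframe, (hF1 2).trans (hF1 0).symm, (hF1 3).trans (hF1 1).symm, hF2⟩, ?_⟩
  rw [RectNet.net, hDA, ← hS, ← hR]
  exact eq_stripNet N

/-! ### Existence of a polyhedron of the example. -/

/-- A side face of height `1` over an edge of length `1`. -/
lemma exists_flatSide_of_cot {φ φ' c s c' s' : ℝ} (h : Real.cos φ = c ∧ Real.sin φ = s)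
    (h' : Real.cos φ' = c' ∧ Real.sin φ' = s') (hs : 0 < s) (hs' : 0 < s')
    (hcot : c / s + c' / s' < 1) : ∃ F : FlatSide, F.ℓ = 1 ∧ F.HasAngles φ φ' := by
  obtain ⟨rfl, rfl⟩ := h
  obtain ⟨rfl, rfl⟩ := h'
  set x := Real.cos φ / Real.sin φ with hx
  set y := Real.cos φ' / Real.sin φ' with hy
  have hd : 0 < 2 - x - y := by linarith
  -- A trapezoid with parallel sides at heights 0 and 1. Its diagonals meet at the parameter 1/(2 -
  -- x - y) on both, which is below 1 exactly when x + y < 1.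
  refine ⟨⟨1, 1 - x, 1, y, 1⟩, rfl, one_pos, one_pos, one_pos, ⟨1 / (2 - x - y), 1 / (2 - x - y),
    ⟨by positivity, ?_⟩, ⟨by positivity, ?_⟩, ?_, rfl⟩,
    ⟨1 / Real.sin φ, by positivity, ?_, ?_⟩, ⟨1 / Real.sin φ', by positivity, ?_, ?_⟩⟩
  · rw [div_lt_one hd]; linarith
  · rw [div_lt_one hd]; linarith
  · simp only
    field_simp
    ring
  · simp only [hx]; ring
  · simp only; field_simp
  · simp only [hy]; ring
  · simp only; field_simp

/-- At the γ-strips the two cotangents cancel, and at the α-strips their sum is 1/2 + 1/(5√7). -/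
lemma exists_flatSide_exampleAngles (i : Fin 4) : ∃ F : FlatSide, F.ℓ = 1 ∧
    F.HasAngles (exampleAngles.sideAngle i) (exampleAngles.sideAngle' i) := by
  have l7 : 1 < √(7 : ℝ) := by rw [Real.lt_sqrt (by norm_num)]; norm_num
  have h0 : exampleCosγ 0 / exampleSinγ 0 + exampleCosγ 1 / exampleSinγ 1 < 1 := by
    simp only [exampleCosγ, exampleSinγ, Matrix.cons_val]; field_simp; nlinarith
  have h1 : exampleCosα 1 / exampleSinα 1 + exampleCosα 2 / exampleSinα 2 < 1 := by
    simp only [exampleCosα, exampleSinα, Matrix.cons_val]; field_simp; nlinarith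
  have h2 : exampleCosγ 2 / exampleSinγ 2 + exampleCosγ 3 / exampleSinγ 3 < 1 := by
    simp only [exampleCosγ, exampleSinγ, Matrix.cons_val]; field_simp; nlinarith
  have h3 : exampleCosα 3 / exampleSinα 3 + exampleCosα 0 / exampleSinα 0 < 1 := by
    simp only [exampleCosα, exampleSinα, Matrix.cons_val]; field_simp; nlinarith
  exact FlatAngles.forall_sideAngle (a := exampleAngles)
    (P := fun φ φ' => ∃ F : FlatSide, F.ℓ = 1 ∧ F.HasAngles φ φ')
    (exists_flatSide_of_cot (exampleAngles_γ 0) (exampleAngles_γ 1) (exampleSinγ_pos 0)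
      (exampleSinγ_pos 1) h0)
    (exists_flatSide_of_cot (exampleAngles_α 1) (exampleAngles_α 2) (exampleSinα_pos 1)
      (exampleSinα_pos 2) h1)
    (exists_flatSide_of_cot (exampleAngles_γ 2) (exampleAngles_γ 3) (exampleSinγ_pos 2)
      (exampleSinγ_pos 3) h2)
    (exists_flatSide_of_cot (exampleAngles_α 3) (exampleAngles_α 0) (exampleSinα_pos 3)
      (exampleSinα_pos 0) h3) i

lemma exists_isFrame : ∃ u v n, IsFrame u v n := by
  let u : E3 := !₂[1, 0, 0]
  let v : E3 := !₂[0, 1, 0]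
  exact ⟨u, v, cross u v, isFrame_cross (by rw [inner_E3]; simp [u]) (by rw [inner_E3]; simp [v])
    (by rw [inner_E3]; simp [u, v])⟩

lemma exists_isAdmissible : ∃ D : RectNet, D.IsAdmissible exampleAngles := by
  choose F hF1 hF2 using exists_flatSide_exampleAngles
  obtain ⟨u, v, n, h⟩ := exists_isFrame
  exact ⟨⟨0, u, v, n, F⟩, h, (hF1 2).trans (hF1 0).symm, (hF1 3).trans (hF1 1).symm, hF2⟩

theorem mainTheorem5 (e : ℝ) (he : e = 1 ∨ e = -1) (t : ℝ) (ht : t ∈ exampleRange) :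
    (∃ N : Net, IsExample e t N) ∧
    ∀ N : Net, IsExample e t N →
      -- the polyhedron is flexible, and the explicit formulae give a flexion of it
      N.IsFlexible ∧
      (∃ V : ℝ → Net, N.IsFlexion exampleRange t V ∧ ∀ τ ∈ exampleRange, IsExample e τ (V τ)) ∧
      -- it has equimodular elliptic type
      N.flatAngles.IsEquimodularElliptic ∧
      -- it is in the linear compound class after switching the strip along the edge `A₃A₄`
      (N.flatAngles.switch {3}).IsLinearCompound ∧
      -- it is in no other class, even after switching boundary strips
      ∀ S : Finset (Fin 4),
        ¬ (N.flatAngles.switch S).InOrthodiagonalClass ∧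
        ¬ (N.flatAngles.switch S).InIsogonalClass ∧
        ¬ (N.flatAngles.switch S).InConjugateModularClass ∧
        ¬ (N.flatAngles.switch S).InLinearlyConjugateClass ∧
        ¬ (N.flatAngles.switch S).InChimeraClass ∧
        ¬ (N.flatAngles.switch S).InTrivialClass := by
  constructor
  · obtain ⟨D, hD⟩ := exists_isAdmissible
    exact ⟨_, hD.isExample he ht⟩
  intro N hN
  have hflat := hN.2.1
  -- The flat data come from the given polyhedron itself, so the flexion passes through it whatever
  -- its edge lengths.
  obtain ⟨D, hD, rfl⟩ := exists_rectNet hN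
  rw [hflat]
  refine ⟨(hD.isFlexion he ht).isFlexible isOpen_Ioo ht,
    ⟨_, hD.isFlexion he ht, fun τ hτ => hD.isExample he hτ⟩, isEquimodularElliptic_exampleAngles,
    isLinearCompound_exampleAngles_switch, fun S => ?_⟩
  have h := isExampleUpToSigns_switch S
  exact ⟨h.not_inOrthodiagonalClass, h.not_inIsogonalClass, h.not_inConjugateModularClass,
    h.not_inLinearlyConjugateClass, h.not_inChimeraClass, h.not_inTrivialClass⟩
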